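/- Let $\Bbbk$ be an arbitrary field and let $\Omega=\{\circ_i\mid i\in I\}$ be a finite set of symbols of binary operations. Let $\mathcal F$ be the free operad of all $\Omega$-algebras: $\mathcal F(n)$ is spanned by the multilinear nonassociative $\Omega$-monomials in $x_1,\dots,x_n$. For a variety $\mathrm{Var}$ of $\Omega$-algebras defined by a family $S$ of multilinear identities, let $\mathcal P_{\mathrm{Var}}$ be the operad governing it, i.e. the quotient of $\mathcal F$ by the operad ideal generated by $S$; similarly for other sets of binary operations. *Di- and tri-algebras.* Put $\Omega^{(2)}=\{\vdash_i,\dashv_i\mid i\in I\}$ and $\Omega^{(3)}=\Omega^{(2)}\cup\{\perp_i\mid i\in I\}$. For an $\Omega$-monomial $u$ and a nonempty set $H$ of its variables (the emphasized ones), define the $\Omega^{(3)}$-monomial $\Phi(u^H)$ by $\Phi(x^{\{x\}})=x$ and, for $u=v\circ_i w$ with $H_1$, $H_2$ the sets of elements of $H$ that occur in $v$, $w$, respectively, $$\Phi(u^H)=\begin{cases}\Phi(v^{H_1})\perp_i\Phi(w^{H_2}), & H_1,H_2\neq\emptyset,\\ v^{\vdash}\vdash_i\Phi(w^{H}), & H_1=\emptyset,\\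 \Phi(v^{H})\dashv_i w^{\dashv}, & H_2=\emptyset,\end{cases}$$ where $v^\vdash$ (resp. $w^\dashv$) is obtained by replacing every $\circ_j$ with $\vdash_j$ (resp. $\dashv_j$); extend $\Phi$ linearly to multilinear polynomials $f$. A tri-$\mathrm{Var}$-algebra is an $\Omega^{(3)}$-algebra with the identities $(x_1\ast_i x_2)\vdash_j x_3=(x_1\vdash_i x_2)\vdash_j x_3$, $x_1\dashv_i(x_2\ast_j x_3)=x_1\dashv_i(x_2\dashv_j x_3)$ for $\ast\in\{\vdash,\dashv,\perp\}$, $i,j\in I$, and $\Phi(f^H)=0$ for all $f\in S$ and all nonempty sets $H$ of variables of $f$. A di-$\mathrm{Var}$-algebra is an $\Omega^{(2)}$-algebra with the same identities restricted to $\ast\in\{\vdash,\dashv\}$ and $|H|=1$. Let $\mathcal D_{\mathrm{Var}}$ and $\mathcal T_{\mathrm{Var}}$ be the operads governing di- and tri-$\mathrm{Var}$-algebras. *Dendriform algebras.* Define $\Phi^*(u^H)$ by the same recursion as $\Phi(u^H)$, with $v^\vdash$ and $w^\dashv$ replaced by $v^*$ and $w^*$, where $v^*$ is obtained from $v$ by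 replacing every $\circ_j$ with $\vdash_j+\dashv_j+\perp_j$. A tri-$\mathrm{Var}$-dendriform algebra is an $\Omega^{(3)}$-algebra with the identities $\Phi^*(f^H)=0$, $f\in S$, $H\ne\emptyset$; a di-$\mathrm{Var}$-dendriform algebra is an $\Omega^{(2)}$-algebra with the identities obtained from these by setting $\perp_i=0$ and taking $|H|=1$ only. Let $\mathrm{dend}\mathcal D_{\mathrm{Var}}$ and $\mathrm{dend}\mathcal T_{\mathrm{Var}}$ be the operads governing them. *Koszul duality.* A binary quadratic operad is an operad $\mathcal P(E,R)$, the quotient of the free operad $\mathcal F_E$ generated by an $S_2$-module $E$ in arity two by the operad ideal generated by some $R\subseteq\mathcal F_E(3)$. If $E$ is finite-dimensional and $R$ is an $S_3$-submodule, its Koszul dual is $\mathcal P(E,R)^!=\mathcal P(E^\vee,R^\perp)$, where $E^\vee$ is the dual space with the sign-twisted action of $S_2$ and $R^\perp\subseteq\mathcal F_{E^\vee}(3)$ is the orthogonal of $R$ under the natural pairing of $\mathcal F_{E^\vee}(3)$ with $\mathcal F_E(3)$. **Proposition.** Suppose that $\mathcal P_{\mathrm{Var}}$ is binary quadratic with $\mathcal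 P_{\mathrm{Var}}(1)=\Bbbk$, and let $\mathrm{Var}^!$ be any variety of algebras with binary operations, defined by multilinear identities, whose governing operad is isomorphic to the Koszul dual $\mathcal P_{\mathrm{Var}}^!$. Then $\mathcal D_{\mathrm{Var}}$ and $\mathcal T_{\mathrm{Var}}$ are binary quadratic, and there are isomorphisms of operads $$(\mathcal D_{\mathrm{Var}})^!\cong\mathrm{dend}\mathcal D_{\mathrm{Var}^!},\qquad(\mathcal T_{\mathrm{Var}})^!\cong\mathrm{dend}\mathcal T_{\mathrm{Var}^!}.$$ -/

import Mathlib

universe u v w w'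

/-! ## Symmetric operads in vector spaces

Operads are presented over finite label sets: `P.obj A` is the space of operations whose inputs are
labelled by the finite set `A` (so `P.obj (Fin n)` is the usual `P(n)` with its action of `S_n`), and
the partial composition plugs an operation into the distinguished input `none` of another one. -/

namespace KDual

/-- `A ⊔ (B ⊔ {*}) ≃ (A ⊔ B) ⊔ {*}`. -/
def sumOption (A B : Type) : A ⊕ Option B ≃ Option (A ⊕ B) where
  toFun x := match x with
    | Sum.inl a => some (Sum.inl a)
    | Sum.inr none => none
    | Sum.inr (some b) => some (Sum.inr b)
  invFun x := match x with
    | none => Sum.inr none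
    | some (Sum.inl a) => Sum.inl a
    | some (Sum.inr b) => Sum.inr (some b)
  left_inv := by rintro (a | _ | b) <;> rfl
  right_inv := by rintro (_ | a | b) <;> rfl

/-- `(A ⊔ {*}) ⊔ B ≃ (A ⊔ B) ⊔ {*}`. -/
def optionSum (A B : Type) : Option A ⊕ B ≃ Option (A ⊕ B) where
  toFun x := match x with
    | Sum.inl none => none
    | Sum.inl (some a) => some (Sum.inl a)
    | Sum.inr b => some (Sum.inr b)
  invFun x := match x with
    | none => Sum.inl none
    | some (Sum.inl a) => Sum.inl (some a)
    | some (Sum.inr b) => Sum.inr b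
  left_inv := by rintro ((_ | a) | b) <;> rfl
  right_inv := by rintro (_ | a | b) <;> rfl

/-- The exchange of the two distinguished points of `(A ⊔ {*}) ⊔ {*}`. -/
def optionSwap (A : Type) : Option (Option A) ≃ Option (Option A) where
  toFun x := match x with
    | none => some none
    | some none => none
    | some (some a) => some (some a)
  invFun x := match x with
    | none => some none
    | some none => none
    | some (some a) => some (some a)
  left_inv := by rintro (_ | _ | a) <;> rfl
  right_inv := by rintro (_ | _ | a) <;> rfl

/-- A one-point set as a set with a distinguished point and no other point. -/
def unitOption : Unit ≃ Option Empty where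
  toFun _ := none
  invFun _ := ()
  left_inv := fun _ => rfl
  right_inv := by rintro (_ | a); · rfl
                  · exact a.elim

/-- `(A ⊔ B) ⊔ C ≃ (A ⊔ C) ⊔ B`. -/
def sumRightComm (A B C : Type) : (A ⊕ B) ⊕ C ≃ (A ⊕ C) ⊕ B where
  toFun x := match x with
    | Sum.inl (Sum.inl a) => Sum.inl (Sum.inl a)
    | Sum.inl (Sum.inr b) => Sum.inr b
    | Sum.inr c => Sum.inl (Sum.inr c)
  invFun x := match x with
    | Sum.inl (Sum.inl a) => Sum.inl (Sum.inl a)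
    | Sum.inl (Sum.inr c) => Sum.inr c
    | Sum.inr b => Sum.inl (Sum.inr b)
  left_inv := by rintro ((a | b) | c) <;> rfl
  right_inv := by rintro ((a | b) | c) <;> rfl

/-- A symmetric operad in `k`-vector spaces. `comp f g` is the partial composition that substitutes
`g` for the input `none` of `f`. -/
structure LinOperad (k : Type u) [Field k] where
  obj : (A : Type) → [Finite A] → Type w
  [addCommGroup : ∀ (A : Type) [Finite A], AddCommGroup (obj A)]
  [module : ∀ (A : Type) [Finite A], Module k (obj A)]
  map : ∀ {A B : Type} [Finite A] [Finite B], (A ≃ B) → (obj A →ₗ[k] obj B)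
  one : obj Unit
  comp : ∀ {A B : Type} [Finite A] [Finite B], obj (Option A) →ₗ[k] obj B →ₗ[k] obj (A ⊕ B)
  map_refl : ∀ {A : Type} [Finite A] (f : obj A), map (Equiv.refl A) f = f
  map_trans : ∀ {A B C : Type} [Finite A] [Finite B] [Finite C] (σ : A ≃ B) (τ : B ≃ C)
    (f : obj A), map (σ.trans τ) f = map τ (map σ f)
  map_comp : ∀ {A A' B B' : Type} [Finite A] [Finite A'] [Finite B] [Finite B']
    (σ : A ≃ A') (τ : B ≃ B') (f : obj (Option A)) (g : obj B),
    map (Equiv.sumCongr σ τ) (comp f g) = comp (map (Equiv.optionCongr σ) f) (map τ g)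
  comp_one : ∀ {A : Type} [Finite A] (f : obj (Option A)),
    comp f one = map (Equiv.optionEquivSumPUnit A) f
  one_comp : ∀ {B : Type} [Finite B] (g : obj B),
    comp (map unitOption one) g = map (Equiv.emptySum Empty B).symm g
  comp_assoc : ∀ {A B C : Type} [Finite A] [Finite B] [Finite C]
    (f : obj (Option A)) (g : obj (Option B)) (h : obj C),
    map (Equiv.sumAssoc A B C) (comp (map (sumOption A B) (comp f g)) h) = comp f (comp g h)
  comp_parallel : ∀ {A B C : Type} [Finite A] [Finite B] [Finite C]
    (f : obj (Option (Option A))) (g : obj B) (h : obj C),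
    map (sumRightComm A B C) (comp (map (optionSum A B) (comp f g)) h) =
      comp (map (optionSum A C) (comp (map (optionSwap A) f) h)) g

attribute [instance] LinOperad.addCommGroup LinOperad.module

namespace LinOperad

variable {k : Type u} [Field k]

/-- An isomorphism of operads. -/
structure Iso (P : LinOperad.{u, w} k) (Q : LinOperad.{u, w'} k) where
  equiv : (A : Type) → [Finite A] → (P.obj A ≃ₗ[k] Q.obj A)
  equiv_map : ∀ {A B : Type} [Finite A] [Finite B] (σ : A ≃ B) (f : P.obj A),
    equiv B (P.map σ f) = Q.map σ (equiv A f)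
  equiv_one : equiv Unit P.one = Q.one
  equiv_comp : ∀ {A B : Type} [Finite A] [Finite B] (f : P.obj (Option A)) (g : P.obj B),
    equiv (A ⊕ B) (P.comp f g) = Q.comp (equiv (Option A) f) (equiv B g)

/-- An ideal of an operad. -/
structure OpIdeal (P : LinOperad.{u, w} k) where
  sub : (A : Type) → [Finite A] → Submodule k (P.obj A)
  map_mem : ∀ {A B : Type} [Finite A] [Finite B] (σ : A ≃ B) (f : P.obj A),
    f ∈ sub A → P.map σ f ∈ sub B
  comp_left : ∀ {A B : Type} [Finite A] [Finite B] (f : P.obj (Option A)) (g : P.obj B),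
    f ∈ sub (Option A) → P.comp f g ∈ sub (A ⊕ B)
  comp_right : ∀ {A B : Type} [Finite A] [Finite B] (f : P.obj (Option A)) (g : P.obj B),
    g ∈ sub B → P.comp f g ∈ sub (A ⊕ B)

/-- The ideal generated by a family of sets `S n ⊆ P(n)`: the smallest one containing it. -/
def idealSpan (P : LinOperad.{u, w} k) (S : ∀ n : ℕ, Set (P.obj (Fin n))) : OpIdeal P where
  sub A := ⨅ J : {J : OpIdeal P // ∀ n, S n ⊆ J.sub (Fin n)}, J.1.sub A
  map_mem σ f hf := by
    rw [Submodule.mem_iInf] at hf ⊢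
    exact fun J => J.1.map_mem σ f (hf J)
  comp_left f g hf := by
    rw [Submodule.mem_iInf] at hf ⊢
    exact fun J => J.1.comp_left f g (hf J)
  comp_right f g hg := by
    rw [Submodule.mem_iInf] at hg ⊢
    exact fun J => J.1.comp_right f g (hg J)

/-- Composition on the quotient by an ideal. -/
def quotComp (P : LinOperad.{u, w} k) (J : OpIdeal P) (A B : Type) [Finite A] [Finite B] :
    (P.obj (Option A) ⧸ J.sub (Option A)) →ₗ[k] (P.obj B ⧸ J.sub B) →ₗ[k]
      (P.obj (A ⊕ B) ⧸ J.sub (A ⊕ B)) :=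
  (J.sub (Option A)).liftQ
    { toFun := fun f => (J.sub B).mapQ (J.sub (A ⊕ B)) (P.comp f)
        (fun g hg => J.comp_right f g hg)
      map_add' := by
        intro f f'
        ext g
        simp
      map_smul' := by
        intro c f
        ext g
        simp }
    (by
      intro f hf
      rw [LinearMap.mem_ker]
      ext g
      simpa using J.comp_left f g hf)

/-- The quotient of an operad by an ideal. -/
def quot (P : LinOperad.{u, w} k) (J : OpIdeal P) : LinOperad.{u, w} k where
  obj A _ := P.obj A ⧸ J.sub A
  map {A B} _ _ σ := (J.sub A).mapQ (J.sub B) (P.map σ) (fun f hf => J.map_mem σ f hf)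
  one := (J.sub Unit).mkQ P.one
  comp {A B} _ _ := P.quotComp J A B
  map_refl := by
    intro A _ f
    obtain ⟨f, rfl⟩ := (J.sub _).mkQ_surjective f
    simp [P.map_refl]
  map_trans := by
    intro A B C _ _ _ σ τ f
    obtain ⟨f, rfl⟩ := (J.sub _).mkQ_surjective f
    simp [P.map_trans]
  map_comp := by
    intro A A' B B' _ _ _ _ σ τ f g
    obtain ⟨f, rfl⟩ := (J.sub _).mkQ_surjective f
    obtain ⟨g, rfl⟩ := (J.sub _).mkQ_surjective g
    simp [quotComp, P.map_comp]
  comp_one := by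
    intro A _ f
    obtain ⟨f, rfl⟩ := (J.sub _).mkQ_surjective f
    simp [quotComp, P.comp_one]
  one_comp := by
    intro B _ g
    obtain ⟨g, rfl⟩ := (J.sub _).mkQ_surjective g
    simp [quotComp, P.one_comp]
  comp_assoc := by
    intro A B C _ _ _ f g h
    obtain ⟨f, rfl⟩ := (J.sub _).mkQ_surjective f
    obtain ⟨g, rfl⟩ := (J.sub _).mkQ_surjective g
    obtain ⟨h, rfl⟩ := (J.sub _).mkQ_surjective h
    simp [quotComp, P.comp_assoc]
  comp_parallel := by
    intro A B C _ _ _ f g h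
    obtain ⟨f, rfl⟩ := (J.sub _).mkQ_surjective f
    obtain ⟨g, rfl⟩ := (J.sub _).mkQ_surjective g
    obtain ⟨h, rfl⟩ := (J.sub _).mkQ_surjective h
    simp [quotComp, P.comp_parallel]

end LinOperad

/-! ## Multilinear nonassociative polynomials and the free operad of `Ω`-algebras -/

/-- Nonassociative monomials: binary trees with inner vertices labelled by operation symbols from `Ω`
and leaves labelled by variables from `A`. -/
inductive MagTree (Ω : Type v) (A : Type) : Type v
  | leaf (a : A) : MagTree Ω A
  | node (o : Ω) (l r : MagTree Ω A) : MagTree Ω A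

namespace MagTree

variable {Ω : Type v} {Ω' : Type w} {A B C : Type}

/-- The variables of a monomial, from left to right. -/
def leaves : MagTree Ω A → List A
  | leaf a => [a]
  | node _ l r => l.leaves ++ r.leaves

/-- Substitution of monomials for variables. -/
def bind (φ : A → MagTree Ω B) : MagTree Ω A → MagTree Ω B
  | leaf a => φ a
  | node o l r => node o (l.bind φ) (r.bind φ)

/-- Change of operation symbols. -/
def mapOps (φ : Ω → Ω') : MagTree Ω A → MagTree Ω' A
  | leaf a => leaf a
  | node o l r => node (φ o) (l.mapOps φ) (r.mapOps φ)

/-- Every variable occurs exactly once. -/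
def IsMultilinear (t : MagTree Ω A) : Prop := t.leaves.Nodup ∧ ∀ a, a ∈ t.leaves

/-- Renaming of variables. -/
def rename (σ : A → B) (t : MagTree Ω A) : MagTree Ω B := t.bind fun a => leaf (σ a)

/-- Substitution of `s` for the variable `none`. -/
def graft (t : MagTree Ω (Option A)) (s : MagTree Ω B) : MagTree Ω (A ⊕ B) :=
  t.bind fun x => match x with
    | none => s.rename Sum.inr
    | some a => leaf (Sum.inl a)

theorem leaves_bind (φ : A → MagTree Ω B) (t : MagTree Ω A) :
    (t.bind φ).leaves = t.leaves.flatMap fun a => (φ a).leaves := by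
  induction t with
  | leaf a => simp [bind, leaves]
  | node o l r ihl ihr => simp [bind, leaves, ihl, ihr]

theorem leaves_rename (σ : A → B) (t : MagTree Ω A) : (t.rename σ).leaves = t.leaves.map σ := by
  induction t with
  | leaf a => rfl
  | node o l r ihl ihr =>
    simp only [rename] at ihl ihr
    simp [rename, bind, leaves, ihl, ihr]

theorem leaves_mapOps (φ : Ω → Ω') (t : MagTree Ω A) : (t.mapOps φ).leaves = t.leaves := by
  induction t with
  | leaf a => rfl
  | node o l r ihl ihr => simp [mapOps, leaves, ihl, ihr]

theorem bind_bind (φ : A → MagTree Ω B) (ψ : B → MagTree Ω C) (t : MagTree Ω A) :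
    (t.bind φ).bind ψ = t.bind fun a => (φ a).bind ψ := by
  induction t with
  | leaf a => rfl
  | node o l r ihl ihr => simp [bind, ihl, ihr]

theorem bind_leaf (t : MagTree Ω A) : t.bind leaf = t := by
  induction t with
  | leaf a => rfl
  | node o l r ihl ihr => simp [bind, ihl, ihr]

theorem IsMultilinear.rename {t : MagTree Ω A} (ht : t.IsMultilinear) (σ : A ≃ B) :
    (t.rename σ).IsMultilinear := by
  refine ⟨?_, fun b => ?_⟩
  · rw [leaves_rename]
    exact ht.1.map σ.injective
  · rw [leaves_rename, List.mem_map]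
    exact ⟨σ.symm b, ht.2 _, by simp⟩

theorem IsMultilinear.graft {t : MagTree Ω (Option A)} {s : MagTree Ω B}
    (ht : t.IsMultilinear) (hs : s.IsMultilinear) : (t.graft s).IsMultilinear := by
  refine ⟨?_, ?_⟩
  · rw [MagTree.graft, leaves_bind, List.nodup_flatMap]
    refine ⟨?_, ht.1.imp ?_⟩
    · rintro (_ | a) -
      · simpa [leaves_rename] using hs.1.map Sum.inr_injective
      · simp [leaves]
    · rintro (_ | a) (_ | b) hab <;>
        simp [Function.onFun, List.Disjoint, leaves_rename, leaves] at hab ⊢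
      exact hab
  · rintro (a | b)
    · rw [MagTree.graft, leaves_bind, List.mem_flatMap]
      exact ⟨some a, ht.2 _, by simp [leaves]⟩
    · rw [MagTree.graft, leaves_bind, List.mem_flatMap]
      exact ⟨none, ht.2 _, by simpa [leaves_rename] using hs.2 b⟩

end MagTree

/-- Multilinear monomials in the variables `A`. -/
def MTree (Ω : Type v) (A : Type) : Type v := {t : MagTree Ω A // t.IsMultilinear}

/-- Multilinear nonassociative polynomials in the variables `A`: the component `F(n)`, for
`A = Fin n`, of the free operad governing all `Ω`-algebras. -/
abbrev MPoly (k : Type u) [Field k] (Ω : Type v) (A : Type) : Type (max u v) := MTree Ω A →₀ k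

section FreeOperad

variable (k : Type u) [Field k] (Ω : Type v)

/-- The monomial `x` of degree one. -/
def MTree.unit : MTree Ω Unit :=
  ⟨MagTree.leaf (), List.nodup_singleton (), fun _ => List.mem_singleton_self ()⟩

/-- Renaming of variables in multilinear monomials. -/
def MTree.rename {Ω : Type v} {A B : Type} (σ : A ≃ B) (t : MTree Ω A) : MTree Ω B :=
  ⟨t.1.rename σ, t.2.rename σ⟩

/-- Substitution of a multilinear monomial for the variable `none` of another one. -/
def MTree.graft {Ω : Type v} {A B : Type} (t : MTree Ω (Option A)) (s : MTree Ω B) :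
    MTree Ω (A ⊕ B) :=
  ⟨t.1.graft s.1, t.2.graft s.2⟩

/-- Renaming of variables in multilinear polynomials. -/
noncomputable def MPoly.rename {A B : Type} (σ : A ≃ B) : MPoly k Ω A →ₗ[k] MPoly k Ω B :=
  Finsupp.lmapDomain k k (MTree.rename σ)

/-- Substitution of a multilinear polynomial for the variable `none` of another one. -/
noncomputable def MPoly.graft {A B : Type} :
    MPoly k Ω (Option A) →ₗ[k] MPoly k Ω B →ₗ[k] MPoly k Ω (A ⊕ B) :=
  Finsupp.linearCombination k fun t => Finsupp.lmapDomain k k (MTree.graft t)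

theorem MPoly.rename_single {A B : Type} (σ : A ≃ B) (t : MTree Ω A) (c : k) :
    MPoly.rename k Ω σ (Finsupp.single t c) = Finsupp.single (t.rename σ) c :=
  Finsupp.mapDomain_single

theorem MPoly.graft_single {A B : Type} (t : MTree Ω (Option A)) (s : MTree Ω B) (c d : k) :
    MPoly.graft k Ω (Finsupp.single t c) (Finsupp.single s d) =
      Finsupp.single (t.graft s) (c * d) := by
  rw [MPoly.graft, Finsupp.linearCombination_single, LinearMap.smul_apply,
    Finsupp.lmapDomain_apply, Finsupp.mapDomain_single, Finsupp.smul_single, smul_eq_mul]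

/-- The free operad `F` governing the variety of all `Ω`-algebras. -/
noncomputable def freeOperad : LinOperad.{u, max u v} k where
  obj A _ := MPoly k Ω A
  map σ := MPoly.rename k Ω σ
  one := Finsupp.single (MTree.unit Ω) 1
  comp := MPoly.graft k Ω
  map_refl := by
    intro A _ f
    induction f using Finsupp.induction_linear with
    | zero => simp
    | add f g hf hg => simp only [map_add, hf, hg]
    | single t c =>
      have h : t.rename (Equiv.refl A) = t := Subtype.ext (MagTree.bind_leaf t.1)
      rw [MPoly.rename_single, h]
  map_trans := by
    intro A B C _ _ _ σ τ f
    induction f using Finsupp.induction_linear with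
    | zero => simp
    | add f g hf hg => simp only [map_add, hf, hg]
    | single t c =>
      have h : t.rename (σ.trans τ) = (t.rename σ).rename τ :=
        Subtype.ext
          (MagTree.bind_bind (fun a => .leaf (σ a)) (fun b => .leaf (τ b)) t.1).symm
      rw [MPoly.rename_single, MPoly.rename_single, MPoly.rename_single, h]
  map_comp := by
    intro A A' B B' _ _ _ _ σ τ f g
    induction f using Finsupp.induction_linear with
    | zero => simp
    | add f f' hf hf' => simp only [map_add, LinearMap.add_apply, hf, hf']
    | single t c =>
      induction g using Finsupp.induction_linear with
      | zero => simp
      | add g g' hg hg' => simp only [map_add, hg, hg']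
      | single s d =>
        have h : (t.graft s).rename (Equiv.sumCongr σ τ) =
            (t.rename (Equiv.optionCongr σ)).graft (s.rename τ) := by
          apply Subtype.ext
          simp only [MTree.graft, MTree.rename, MagTree.graft, MagTree.rename, MagTree.bind_bind]
          congr 1
          funext x
          rcases x with _ | a <;> simp [MagTree.bind, MagTree.bind_bind]
        simp only [MPoly.rename_single, MPoly.graft_single, h]
  comp_one := by
    intro A _ f
    induction f using Finsupp.induction_linear with
    | zero => simp
    | add f f' hf hf' => simp only [map_add, LinearMap.add_apply, hf, hf']
    | single t c =>
      have h : t.graft (MTree.unit Ω) = t.rename (Equiv.optionEquivSumPUnit A) := by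
        apply Subtype.ext
        simp only [MTree.graft, MTree.rename, MTree.unit, MagTree.graft, MagTree.rename]
        congr 1
        funext x
        rcases x with _ | a <;> simp [MagTree.bind]
      rw [MPoly.rename_single, MPoly.graft_single, mul_one, h]
  one_comp := by
    intro B _ g
    induction g using Finsupp.induction_linear with
    | zero => simp
    | add g g' hg hg' => simp only [map_add, hg, hg']
    | single s d =>
      have h : ((MTree.unit Ω).rename unitOption).graft s =
          s.rename (Equiv.emptySum Empty B).symm := rfl
      rw [MPoly.rename_single, MPoly.rename_single, MPoly.graft_single, one_mul, h]
  comp_assoc := by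
    intro A B C _ _ _ f g h
    induction f using Finsupp.induction_linear with
    | zero => simp
    | add f f' hf hf' => simp only [map_add, LinearMap.add_apply, hf, hf']
    | single t c =>
      induction g using Finsupp.induction_linear with
      | zero => simp
      | add g g' hg hg' => simp only [map_add, LinearMap.add_apply, hg, hg']
      | single s d =>
        induction h using Finsupp.induction_linear with
        | zero => simp
        | add h h' hh hh' => simp only [map_add, hh, hh']
        | single r e =>
          have h : (((t.graft s).rename (sumOption A B)).graft r).rename (Equiv.sumAssoc A B C) =
              t.graft (s.graft r) := by
            apply Subtype.ext
            simp only [MTree.graft, MTree.rename, MagTree.graft, MagTree.rename,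
              MagTree.bind_bind]
            congr 1
            funext x
            rcases x with _ | a
            · simp only [MagTree.bind_bind]
              congr 1
              funext y
              rcases y with _ | b <;> simp [sumOption, MagTree.bind, MagTree.bind_bind]
            · simp [sumOption, MagTree.bind]
          simp only [MPoly.rename_single, MPoly.graft_single, mul_assoc, h]
  comp_parallel := by
    intro A B C _ _ _ f g h
    induction f using Finsupp.induction_linear with
    | zero => simp
    | add f f' hf hf' => simp only [map_add, LinearMap.add_apply, hf, hf']
    | single t c =>
      induction g using Finsupp.induction_linear with
      | zero => simp
      | add g g' hg hg' => simp only [map_add, LinearMap.add_apply, hg, hg']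
      | single s d =>
        induction h using Finsupp.induction_linear with
        | zero => simp
        | add h h' hh hh' => simp only [map_add, LinearMap.add_apply, hh, hh']
        | single r e =>
          have h : (((t.graft s).rename (optionSum A B)).graft r).rename (sumRightComm A B C) =
              (((t.rename (optionSwap A)).graft r).rename (optionSum A C)).graft s := by
            apply Subtype.ext
            simp only [MTree.graft, MTree.rename, MagTree.graft, MagTree.rename,
              MagTree.bind_bind]
            congr 1
            funext x
            rcases x with _ | _ | a <;>
              simp [optionSum, optionSwap, sumRightComm, MagTree.bind, MagTree.bind_bind]
          simp only [MPoly.rename_single, MPoly.graft_single, mul_right_comm, h]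

end FreeOperad

/-- A family of multilinear identities `f = 0` for `Ω`-algebras: `S n` are those of degree `n`, in
the variables `0, …, n - 1`. It determines a variety of `Ω`-algebras. -/
abbrev Identities (k : Type u) [Field k] (Ω : Type v) : Type (max u v) :=
  ∀ n : ℕ, Set (MPoly k Ω (Fin n))

/-- The operad governing the variety of `Ω`-algebras defined by the multilinear identities `S`:
the quotient of the free operad by the ideal generated by `S`. -/
noncomputable def operadOf {k : Type u} [Field k] {Ω : Type v} (S : Identities k Ω) :
    LinOperad.{u, max u v} k :=
  (freeOperad k Ω).quot ((freeOperad k Ω).idealSpan S)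

/-! ## Binary quadratic operads and Koszul duality -/

section Quadratic

variable {k : Type u} [Field k] {E : Type w} [AddCommGroup E] [Module k E]

/-- For a vector space `E` with an action of `S_2` (the transposition acts by `τ`), the value in
`E = F_E(2)` of a monomial of degree two with a label from `E`. -/
def coordTwo (τ : E →ₗ[k] E) : MagTree E (Fin 2) → E
  | .node μ (.leaf a) (.leaf _) => if a = 0 then μ else τ μ
  | _ => 0

/-- The identities of degree two that turn the free operad on the set `E` of binary operations into
the free operad `F_E` on the `S_2`-module `E`: linear dependence on the label, and
`(τ μ)(x₀, x₁) = μ(x₁, x₀)`. -/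
noncomputable def moduleIdentities (τ : E →ₗ[k] E) : Set (MPoly k E (Fin 2)) :=
  {f | Finsupp.linearCombination k (fun t : MTree E (Fin 2) => coordTwo τ t.1) f = 0}

/-- The operad `P(E, R)` for an `S_2`-module `E` and a set `R` of relations in `F_E(3)`
(given by representatives, i.e. combinations of monomials with labels from `E`). -/
noncomputable def quadraticOperad (τ : E →ₗ[k] E) (R : Set (MPoly k E (Fin 3))) :
    LinOperad.{u, max u w} k :=
  operadOf fun n => match n with
    | 2 => moduleIdentities τ
    | 3 => R
    | _ => ∅

/-- Coordinates in `F_E(3) = k S_3 ⊗_{k S_2} (E ⊗ E)`, with the three even permutations as coset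
representatives: the triple `(c, μ, ν)` stands for the monomial `μ(ν(x_{c+1}, x_{c+2}), x_c)`,
where `c : Fin 3` is read modulo `3`. The last line is never reached for multilinear monomials. -/
def coordThree (τ : E →ₗ[k] E) : MagTree E (Fin 3) → Fin 3 × E × E
  | .node μ (.node ν (.leaf a) (.leaf b)) (.leaf c) => (c, μ, if b = a + 1 then ν else τ ν)
  | .node μ (.leaf c) (.node ν (.leaf a) (.leaf b)) => (c, τ μ, if b = a + 1 then ν else τ ν)
  | _ => (0, 0, 0)

/-- The action of the transposition on the dual space `E^∨`, twisted by the sign: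
`⟨τ^∨ ν, μ⟩ = - ⟨ν, τ μ⟩`. -/
noncomputable def dualSwap (τ : E →ₗ[k] E) : Module.Dual k E →ₗ[k] Module.Dual k E :=
  -(Module.Dual.transpose τ)

/-- The pairing of monomials of `F_{E^∨}(3)` and `F_E(3)`. In the coordinates above it is the
componentwise pairing; it satisfies `⟨σ g, σ f⟩ = sgn(σ) ⟨g, f⟩` for `σ ∈ S_3`. -/
noncomputable def treePairing (τ : E →ₗ[k] E)
    (g : MagTree (Module.Dual k E) (Fin 3)) (f : MagTree E (Fin 3)) : k :=
  if (coordThree (dualSwap τ) g).1 = (coordThree τ f).1 then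
    (coordThree (dualSwap τ) g).2.1 (coordThree τ f).2.1 *
      (coordThree (dualSwap τ) g).2.2 (coordThree τ f).2.2
  else 0

/-- The bilinear extension of the pairing of monomials. -/
noncomputable def pairing (τ : E →ₗ[k] E) :
    MPoly k (Module.Dual k E) (Fin 3) →ₗ[k] MPoly k E (Fin 3) →ₗ[k] k :=
  Finsupp.linearCombination k fun g =>
    Finsupp.linearCombination k fun f => treePairing τ g.1 f.1

/-- The orthogonal `R^⊥ ⊆ F_{E^∨}(3)` of `R ⊆ F_E(3)`. -/
def orthogonalRel (τ : E →ₗ[k] E) (R : Set (MPoly k E (Fin 3))) :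
    Set (MPoly k (Module.Dual k E) (Fin 3)) :=
  {g | ∀ f ∈ R, pairing τ g f = 0}

end Quadratic

/-- The two inputs of a binary operation, the input `0` being the distinguished one. -/
def finTwoOption : Fin 2 ≃ Option Unit where
  toFun i := if i = 0 then none else some ()
  invFun x := match x with
    | none => 0
    | some _ => 1
  left_inv := by decide
  right_inv := by rintro (_ | _) <;> rfl

/-- The inputs of `μ(ν(x₀, x₁), x₂)`: those of `ν`, and the second input of `μ`. -/
def unitSumFinTwo : Unit ⊕ Fin 2 ≃ Fin 3 where
  toFun x := match x with
    | Sum.inl _ => 2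
    | Sum.inr i => i.castSucc
  invFun j := if j = 0 then Sum.inr 0 else if j = 1 then Sum.inr 1 else Sum.inl ()
  left_inv := by decide
  right_inv := by decide

namespace LinOperad

variable {k : Type u} [Field k]

/-- A binary quadratic operad: an operad of the form `P(E, R)`. -/
def IsBinaryQuadratic (P : LinOperad.{u, w} k) : Prop :=
  ∃ (E : Type w) (_ : AddCommGroup E) (_ : Module k E) (τ : E →ₗ[k] E)
    (R : Set (MPoly k E (Fin 3))),
    (∀ μ, τ (τ μ) = μ) ∧ Nonempty (Iso P (quadraticOperad τ R))

/-- The action of the transposition on `P(2)`. -/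
def swapTwo (P : LinOperad.{u, w} k) : P.obj (Fin 2) →ₗ[k] P.obj (Fin 2) :=
  P.map (Equiv.swap 0 1)

/-- The composition `μ(ν(x₀, x₁), x₂)` in `P(3)` of `μ, ν ∈ P(2)`. -/
def compTwo (P : LinOperad.{u, w} k) (μ ν : P.obj (Fin 2)) : P.obj (Fin 3) :=
  P.map unitSumFinTwo (P.comp (P.map finTwoOption μ) ν)

/-- The value in `P(3)` of a monomial of degree three with labels from `P(2)`. -/
def evalThree (P : LinOperad.{u, w} k) (t : MagTree (P.obj (Fin 2)) (Fin 3)) : P.obj (Fin 3) :=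
  P.map (Equiv.addRight ((coordThree P.swapTwo t).1 + 1))
    (P.compTwo (coordThree P.swapTwo t).2.1 (coordThree P.swapTwo t).2.2)

/-- The quadratic relations of `P`: the kernel `R` of `F_E(3) → P(3)`, where `E = P(2)`. -/
def quadRel (P : LinOperad.{u, w} k) : Set (MPoly k (P.obj (Fin 2)) (Fin 3)) :=
  {f | Finsupp.linearCombination k
    (fun t : MTree (P.obj (Fin 2)) (Fin 3) => P.evalThree t.1) f = 0}

/-- The Koszul dual operad `P^! = P(E^∨, R^⊥)` of a binary quadratic operad `P = P(E, R)`,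
where `E = P(2)` and `R` is the kernel of `F_E(3) → P(3)`. -/
noncomputable def koszulDual (P : LinOperad.{u, w} k) : LinOperad.{u, max u w} k :=
  quadraticOperad (dualSwap P.swapTwo) (orthogonalRel P.swapTwo P.quadRel)

end LinOperad

/-! ## Di- and tri-algebras, and their dendriform counterparts -/

/-- The symbols `⊢` and `⊣`. -/
inductive DiSym
  | vdash
  | dashv

/-- The symbols `⊢`, `⊣` and `⊥`. -/
inductive TriSym
  | vdash
  | dashv
  | perp

namespace MagTree

variable {Ω : Type v} {A : Type}

open Classical in
/-- All products are replaced with `⊢` or `⊣` in such a way that the horizontal dashes point to the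
selected variable `a`. -/
noncomputable def diMark (a : A) : MagTree Ω A → MagTree (DiSym × Ω) A
  | leaf b => leaf b
  | node o l r =>
    if a ∈ l.leaves then node (.dashv, o) (l.diMark a) (r.mapOps (Prod.mk .dashv))
    else node (.vdash, o) (l.mapOps (Prod.mk .vdash)) (r.diMark a)

open Classical in
/-- The map `Φ` on a monomial with the set `H` of emphasized variables. -/
noncomputable def triMark (H : Set A) : MagTree Ω A → MagTree (TriSym × Ω) A
  | leaf b => leaf b
  | node o l r =>
    if ∃ a ∈ l.leaves, a ∈ H then
      if ∃ a ∈ r.leaves, a ∈ H then node (.perp, o) (l.triMark H) (r.triMark H)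
      else node (.dashv, o) (l.triMark H) (r.mapOps (Prod.mk .dashv))
    else node (.vdash, o) (l.mapOps (Prod.mk .vdash)) (r.triMark H)

/-- The summands of the linear combination `v^*` obtained from the monomial `v` by replacing each
`o` with the sum of the `(d, o)`, `d ∈ D`. -/
def starTerms {D : Type} (L : List D) : MagTree Ω A → List (MagTree (D × Ω) A)
  | leaf b => [leaf b]
  | node o l r => L.flatMap fun d => (l.starTerms L).flatMap fun l' =>
      (r.starTerms L).map fun r' => node (d, o) l' r'

/-- The summands of `v^*` for dialgebras: each product is replaced with `⊢ + ⊣`. -/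
def diStar (t : MagTree Ω A) : List (MagTree (DiSym × Ω) A) :=
  t.starTerms [.vdash, .dashv]

/-- The summands of `v^*` for trialgebras: each product is replaced with `⊢ + ⊣ + ⊥`. -/
def triStar (t : MagTree Ω A) : List (MagTree (TriSym × Ω) A) :=
  t.starTerms [.vdash, .dashv, .perp]

open Classical in
/-- The summands of `Φ^*` of a monomial with one emphasized variable `a`, where `⊥ = 0`. -/
noncomputable def diDendTerms (a : A) : MagTree Ω A → List (MagTree (DiSym × Ω) A)
  | leaf b => [leaf b]
  | node o l r =>
    if a ∈ l.leaves then
      (l.diDendTerms a).flatMap fun l' => r.diStar.map fun r' => node (.dashv, o) l' r'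
    else l.diStar.flatMap fun l' => (r.diDendTerms a).map fun r' => node (.vdash, o) l' r'

open Classical in
/-- The summands of `Φ^*` of a monomial with the set `H` of emphasized variables. -/
noncomputable def triDendTerms (H : Set A) : MagTree Ω A → List (MagTree (TriSym × Ω) A)
  | leaf b => [leaf b]
  | node o l r =>
    if ∃ a ∈ l.leaves, a ∈ H then
      if ∃ a ∈ r.leaves, a ∈ H then
        (l.triDendTerms H).flatMap fun l' => (r.triDendTerms H).map fun r' => node (.perp, o) l' r'
      else (l.triDendTerms H).flatMap fun l' => r.triStar.map fun r' => node (.dashv, o) l' r'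
    else l.triStar.flatMap fun l' => (r.triDendTerms H).map fun r' => node (.vdash, o) l' r'

theorem leaves_diMark (a : A) (t : MagTree Ω A) : (t.diMark a).leaves = t.leaves := by
  induction t with
  | leaf b => rfl
  | node o l r ihl ihr =>
    rw [diMark]
    split_ifs <;> simp [leaves, leaves_mapOps, ihl, ihr]

theorem leaves_triMark (H : Set A) (t : MagTree Ω A) : (t.triMark H).leaves = t.leaves := by
  induction t with
  | leaf b => rfl
  | node o l r ihl ihr =>
    rw [triMark]
    split_ifs <;> simp only [leaves, leaves_mapOps, ihl, ihr]

theorem leaves_of_mem_starTerms {D : Type} (L : List D) (t : MagTree Ω A) :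
    ∀ t' ∈ t.starTerms L, t'.leaves = t.leaves := by
  induction t with
  | leaf b => simp [starTerms, leaves]
  | node o l r ihl ihr =>
    intro t' ht'
    simp only [starTerms, List.mem_flatMap, List.mem_map] at ht'
    obtain ⟨d, -, l', hl', r', hr', rfl⟩ := ht'
    simp [leaves, ihl l' hl', ihr r' hr']

theorem leaves_of_mem_diDendTerms (a : A) (t : MagTree Ω A) :
    ∀ t' ∈ t.diDendTerms a, t'.leaves = t.leaves := by
  induction t with
  | leaf b => simp [diDendTerms, leaves]
  | node o l r ihl ihr =>
    intro t' ht'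
    rw [diDendTerms] at ht'
    split_ifs at ht' <;> simp only [List.mem_flatMap, List.mem_map] at ht' <;>
      obtain ⟨l', hl', r', hr', rfl⟩ := ht'
    · simp [leaves, ihl l' hl', leaves_of_mem_starTerms _ r r' hr']
    · simp [leaves, ihr r' hr', leaves_of_mem_starTerms _ l l' hl']

theorem leaves_of_mem_triDendTerms (H : Set A) (t : MagTree Ω A) :
    ∀ t' ∈ t.triDendTerms H, t'.leaves = t.leaves := by
  induction t with
  | leaf b => simp [triDendTerms, leaves]
  | node o l r ihl ihr =>
    intro t' ht'
    rw [triDendTerms] at ht'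
    split_ifs at ht' <;> simp only [List.mem_flatMap, List.mem_map] at ht' <;>
      obtain ⟨l', hl', r', hr', rfl⟩ := ht'
    · simp [leaves, ihl l' hl', ihr r' hr']
    · simp [leaves, ihl l' hl', leaves_of_mem_starTerms _ r r' hr']
    · simp [leaves, ihr r' hr', leaves_of_mem_starTerms _ l l' hl']

theorem IsMultilinear.of_leaves_eq {Ω' : Type w} {t : MagTree Ω A} {t' : MagTree Ω' A}
    (ht : t.IsMultilinear) (h : t'.leaves = t.leaves) : t'.IsMultilinear := by
  rw [IsMultilinear, h]
  exact ht

end MagTree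

section Procedures

variable {k : Type u} [Field k] {Ω : Type v} {A : Type}

/-- The sum of a list of multilinear monomials. -/
noncomputable def monomialSum (L : List (MagTree Ω A)) (hL : ∀ t ∈ L, t.IsMultilinear) :
    MPoly k Ω A :=
  (L.attach.map fun t => (Finsupp.single (⟨t.1, hL t.1 t.2⟩ : MTree Ω A) (1 : k))).sum

/-- `f(x_1, …, ẋ_a, …, x_n)` for dialgebras. -/
noncomputable def diDot (a : A) : MPoly k Ω A →ₗ[k] MPoly k (DiSym × Ω) A :=
  Finsupp.lmapDomain k k fun t =>
    ⟨t.1.diMark a, t.2.of_leaves_eq (t.1.leaves_diMark a)⟩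

/-- `f(x_1, …, ẋ_{a_1}, …, ẋ_{a_l}, …, x_n)`, where `H = {a_1, …, a_l}`, for trialgebras. -/
noncomputable def triDot (H : Set A) : MPoly k Ω A →ₗ[k] MPoly k (TriSym × Ω) A :=
  Finsupp.lmapDomain k k fun t =>
    ⟨t.1.triMark H, t.2.of_leaves_eq (t.1.leaves_triMark H)⟩

/-- `f^*(x_1, …, ẋ_a, …, x_n)`, for dendriform dialgebras. -/
noncomputable def diDendDot (a : A) : MPoly k Ω A →ₗ[k] MPoly k (DiSym × Ω) A :=
  Finsupp.linearCombination k fun t =>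
    monomialSum (t.1.diDendTerms a)
      fun t' ht' => t.2.of_leaves_eq (t.1.leaves_of_mem_diDendTerms a t' ht')

/-- `f^*(x_1, …, ẋ_{a_1}, …, ẋ_{a_l}, …, x_n)`, where `H = {a_1, …, a_l}`, for dendriform
trialgebras. -/
noncomputable def triDendDot (H : Set A) : MPoly k Ω A →ₗ[k] MPoly k (TriSym × Ω) A :=
  Finsupp.linearCombination k fun t =>
    monomialSum (t.1.triDendTerms H)
      fun t' ht' => t.2.of_leaves_eq (t.1.leaves_of_mem_triDendTerms H t' ht')

variable (k)

/-- The polynomial `(x₀ p x₁) q x₂`. -/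
noncomputable def leftMonomial (p q : Ω) : MPoly k Ω (Fin 3) :=
  Finsupp.single ⟨.node q (.node p (.leaf 0) (.leaf 1)) (.leaf 2), by
    simp [MagTree.IsMultilinear, MagTree.leaves, Fin.forall_fin_succ]⟩ 1

/-- The polynomial `x₀ p (x₁ q x₂)`. -/
noncomputable def rightMonomial (p q : Ω) : MPoly k Ω (Fin 3) :=
  Finsupp.single ⟨.node p (.leaf 0) (.node q (.leaf 1) (.leaf 2)), by
    simp [MagTree.IsMultilinear, MagTree.leaves, Fin.forall_fin_succ]⟩ 1

end Procedures

section Varieties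

variable {k : Type u} [Field k] {Ω : Type v}

/-- The defining identities of di-`Var`-algebras, where `Var` is defined by `S`. -/
inductive DiIdentity (S : Identities k Ω) : ∀ n : ℕ, MPoly k (DiSym × Ω) (Fin n) → Prop
  | zero_left (i j : Ω) : DiIdentity S 3
      (leftMonomial k (.dashv, i) (.vdash, j) - leftMonomial k (.vdash, i) (.vdash, j))
  | zero_right (i j : Ω) : DiIdentity S 3
      (rightMonomial k (.dashv, i) (.vdash, j) - rightMonomial k (.dashv, i) (.dashv, j))
  | dot (n : ℕ) (f : MPoly k Ω (Fin n)) (hf : f ∈ S n) (a : Fin n) : DiIdentity S n (diDot a f)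

/-- The defining identities of tri-`Var`-algebras, where `Var` is defined by `S`. -/
inductive TriIdentity (S : Identities k Ω) : ∀ n : ℕ, MPoly k (TriSym × Ω) (Fin n) → Prop
  | zero_left (s : TriSym) (i j : Ω) : TriIdentity S 3
      (leftMonomial k (s, i) (.vdash, j) - leftMonomial k (.vdash, i) (.vdash, j))
  | zero_right (s : TriSym) (i j : Ω) : TriIdentity S 3
      (rightMonomial k (.dashv, i) (s, j) - rightMonomial k (.dashv, i) (.dashv, j))
  | dot (n : ℕ) (f : MPoly k Ω (Fin n)) (hf : f ∈ S n) (H : Set (Fin n)) (hH : H.Nonempty) :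
      TriIdentity S n (triDot H f)

/-- The variety of di-`Var`-algebras. -/
def diVar (S : Identities k Ω) : Identities k (DiSym × Ω) := fun n => {g | DiIdentity S n g}

/-- The variety of tri-`Var`-algebras. -/
def triVar (S : Identities k Ω) : Identities k (TriSym × Ω) := fun n => {g | TriIdentity S n g}

/-- The variety of di-`Var`-dendriform algebras. -/
def diDend (S : Identities k Ω) : Identities k (DiSym × Ω) :=
  fun n => {g | ∃ f ∈ S n, ∃ a : Fin n, g = diDendDot a f}

/-- The variety of tri-`Var`-dendriform algebras. -/
def triDend (S : Identities k Ω) : Identities k (TriSym × Ω) :=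
  fun n => {g | ∃ f ∈ S n, ∃ H : Set (Fin n), H.Nonempty ∧ g = triDendDot H f}

end Varieties

end KDual

/-!
Both halves of the statement have the form of a duality between an operad and its tensor product
with an operad in sets.

Let `C` be the operad `Perm`, with `C(n) = {1, …, n}`, in the case of dialgebras, and `ComTrias`,
with `C(n)` the nonempty subsets of `{1, …, n}`, in the case of trialgebras; an element of `C(n)`
tells which variables are emphasized, and `C(2)` is the set of symbols `⊢`, `⊣` (and `⊥`). Write
`C ⊗ P` for the Hadamard product (`SetOperad.had`).

* The operad of di- or tri-`Var`-algebras is `C ⊗ P_Var` (`Marking.varIso`). The morphism onto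
  `C ⊗ P_Var` forgets the marks of the operations and remembers the emphasized variables. It is
  injective since modulo the identities that do not involve `S` the argument that an operation does
  not emphasize loses its marks, so that a monomial is determined by the underlying monomial and the
  set of its emphasized variables (`Marking.exists_proj_eq_proj_dot`).
* A morphism from the operad of di- or tri-`Var`-dendriform algebras to `Q` is the same thing as a
  morphism from `P_Var` to `C ⊗ Q` (`SetOperad.dendLift`, `SetOperad.hadHom_dendLift`,
  `SetOperad.dend_hom_ext`). Indeed, `Φ^*(f^H)` is the coefficient of `H` in the image of `f` under
  the morphism that sends `x ∘ y` to the sum of the `h ⊗ (x ∘_h y)`, `h ∈ C(2)`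
  (`coeff_splitFree_di`, `coeff_splitFree_tri`).

If `P` has a finite-dimensional space of binary operations, the operad `(C ⊗ P)^!` has the same
universal property with respect to `P^!`: its generators are dual to `C(2) ⊗ P(2)`, and an element
of its third component is a relation if and only if its coordinates annihilate the linear relations
between the compositions of the basic operations (`mem_orthogonalRel_iff`). Compositions of basic
operations in `C ⊗ P` are compositions in `P` with a label from `C(3)`, and every label occurs, so
such a functional is a family of functionals for `P`, indexed by `C(3)`
(`freeLift_dualToHad`, `freeLift_dualFromHad`). Hence `(C ⊗ P)^!` is the operad of split operations
of a variety with operad `P^!` (`nonempty_koszulDual_iso`).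

The Hadamard product is binary quadratic because it may be computed from a quadratic presentation of
`P_Var`, and the marked variety of that presentation has identities of degrees two and three only
(`isBinaryQuadratic_operadOf`, `Marking.isBinaryQuadratic_var`).
-/

universe w₁ w₂

namespace KDual

namespace LinOperad

variable {k : Type u} [Field k]

/-! ### Morphisms of operads -/

/-- A morphism of operads. -/
structure Hom (P : LinOperad.{u, w} k) (Q : LinOperad.{u, w'} k) where
  app : (A : Type) → [Finite A] → (P.obj A →ₗ[k] Q.obj A)
  app_map : ∀ {A B : Type} [Finite A] [Finite B] (σ : A ≃ B) (f : P.obj A),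
    app B (P.map σ f) = Q.map σ (app A f)
  app_one : app Unit P.one = Q.one
  app_comp : ∀ {A B : Type} [Finite A] [Finite B] (f : P.obj (Option A)) (g : P.obj B),
    app (A ⊕ B) (P.comp f g) = Q.comp (app (Option A) f) (app B g)

namespace Hom

variable {P : LinOperad.{u, w} k} {Q : LinOperad.{u, w'} k} {R : LinOperad.{u, w₁} k}

theorem ext_app {F G : Hom P Q}
    (h : ∀ (A : Type) [Finite A] (x : P.obj A), F.app A x = G.app A x) : F = G := by
  obtain ⟨F, _, _, _⟩ := F
  obtain ⟨G, _, _, _⟩ := G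
  have : @F = @G := by
    funext A
    exact funext fun _ => LinearMap.ext (h A)
  subst this
  rfl

/-- The identity morphism. -/
def id (P : LinOperad.{u, w} k) : Hom P P where
  app _ _ := LinearMap.id
  app_map _ _ := rfl
  app_one := rfl
  app_comp _ _ := rfl

/-- The composite of two morphisms, the first argument being applied last. -/
def comp (G : Hom Q R) (F : Hom P Q) : Hom P R where
  app A _ := (G.app A).comp (F.app A)
  app_map σ f := by simp [F.app_map, G.app_map]
  app_one := by simp [F.app_one, G.app_one]
  app_comp f g := by simp [F.app_comp, G.app_comp]

@[simp] theorem id_app (A : Type) [Finite A] (x : P.obj A) : (id P).app A x = x := rfl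

@[simp] theorem comp_app (G : Hom Q R) (F : Hom P Q) (A : Type) [Finite A] (x : P.obj A) :
    (G.comp F).app A x = G.app A (F.app A x) := rfl

end Hom

namespace Iso

variable {P : LinOperad.{u, w} k} {Q : LinOperad.{u, w'} k} {R : LinOperad.{u, w₁} k}

/-- The morphism underlying an isomorphism. -/
def hom (e : Iso P Q) : Hom P Q where
  app A _ := (e.equiv A).toLinearMap
  app_map σ f := e.equiv_map σ f
  app_one := e.equiv_one
  app_comp f g := e.equiv_comp f g

/-- A morphism that is bijective in each arity is an isomorphism. -/
noncomputable def ofBijective (F : Hom P Q)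
    (h : ∀ (A : Type) [Finite A], Function.Bijective (F.app A)) : Iso P Q where
  equiv A _ := LinearEquiv.ofBijective (F.app A) (h A)
  equiv_map σ f := F.app_map σ f
  equiv_one := F.app_one
  equiv_comp f g := F.app_comp f g

/-- Mutually inverse morphisms form an isomorphism. -/
noncomputable def ofHoms (F : Hom P Q) (G : Hom Q P) (hGF : G.comp F = Hom.id P)
    (hFG : F.comp G = Hom.id Q) : Iso P Q :=
  ofBijective F fun A _ => by
    refine Function.bijective_iff_has_inverse.2 ⟨G.app A, fun x => ?_, fun y => ?_⟩
    · exact congrArg (fun H : Hom P P => H.app A x) hGF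
    · exact congrArg (fun H : Hom Q Q => H.app A y) hFG

/-- The inverse isomorphism. -/
def symm (e : Iso P Q) : Iso Q P where
  equiv A _ := (e.equiv A).symm
  equiv_map σ f := by rw [LinearEquiv.symm_apply_eq, e.equiv_map]; simp
  equiv_one := by rw [LinearEquiv.symm_apply_eq, e.equiv_one]
  equiv_comp f g := by rw [LinearEquiv.symm_apply_eq, e.equiv_comp]; simp

/-- The composite of two isomorphisms. -/
def trans (e : Iso P Q) (e' : Iso Q R) : Iso P R where
  equiv A _ := (e.equiv A).trans (e'.equiv A)
  equiv_map σ f := by simp [e.equiv_map, e'.equiv_map]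
  equiv_one := by simp [e.equiv_one, e'.equiv_one]
  equiv_comp f g := by simp [e.equiv_comp, e'.equiv_comp]

@[simp] theorem hom_app (e : Iso P Q) (A : Type) [Finite A] (x : P.obj A) :
    e.hom.app A x = e.equiv A x := rfl

end Iso

/-! ### The operation `μ(x, y)` for `μ` of arity two -/

variable (P : LinOperad.{u, w} k)

theorem map_map {A B C : Type} [Finite A] [Finite B] [Finite C] (σ : A ≃ B) (τ : B ≃ C)
    (f : P.obj A) : P.map τ (P.map σ f) = P.map (σ.trans τ) f :=
  (P.map_trans σ τ f).symm

theorem map_congr {A B : Type} [Finite A] [Finite B] {σ τ : A ≃ B} (h : ∀ a, σ a = τ a)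
    (f : P.obj A) : P.map σ f = P.map τ f := by
  rw [Equiv.ext h]

theorem comp_map_congr {A B C : Type} [Finite A] [Finite B] [Finite C] {σ τ : C ≃ Option A}
    (h : ∀ a, σ a = τ a) (f : P.obj C) (g : P.obj B) :
    P.comp (P.map σ f) g = P.comp (P.map τ f) g := by
  rw [Equiv.ext h]

theorem map_eq_self {A : Type} [Finite A] {σ : A ≃ A} (h : ∀ a, σ a = a)
    (f : P.obj A) : P.map σ f = f := by
  rw [show σ = Equiv.refl A from Equiv.ext h, P.map_refl]

theorem map_injective {A B : Type} [Finite A] [Finite B] (σ : A ≃ B) :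
    Function.Injective (P.map σ) := by
  intro x y h
  have h' := congrArg (P.map σ.symm) h
  rwa [map_map, map_map, map_eq_self _ (by simp), map_eq_self _ (by simp)] at h'

/-- `{*} ⊔ A` as a set with a distinguished point. -/
def unitSumOption (A : Type) : Unit ⊕ A ≃ Option A where
  toFun x := match x with
    | Sum.inl _ => none
    | Sum.inr a => some a
  invFun x := match x with
    | none => Sum.inl ()
    | some a => Sum.inr a
  left_inv := by rintro (_ | a) <;> rfl
  right_inv := by rintro (_ | a) <;> rfl

/-- The composition `μ(x, y)`. -/
def binary {A B : Type} [Finite A] [Finite B] :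
    P.obj (Fin 2) →ₗ[k] P.obj A →ₗ[k] P.obj B →ₗ[k] P.obj (A ⊕ B) :=
  LinearMap.mk₂ k
    (fun μ x => P.comp (P.map (unitSumOption A) (P.comp (P.map finTwoOption μ) x)))
    (by simp) (by simp) (by simp) (by simp)

theorem binary_apply {A B : Type} [Finite A] [Finite B] (μ : P.obj (Fin 2)) (x : P.obj A)
    (y : P.obj B) : P.binary μ x y =
      P.comp (P.map (unitSumOption A) (P.comp (P.map finTwoOption μ) x)) y := rfl

theorem Hom.app_binary {P : LinOperad.{u, w} k} {Q : LinOperad.{u, w'} k} (F : Hom P Q)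
    {A B : Type} [Finite A] [Finite B] (μ : P.obj (Fin 2)) (x : P.obj A) (y : P.obj B) :
    F.app _ (P.binary μ x y) = Q.binary (F.app _ μ) (F.app _ x) (F.app _ y) := by
  simp only [binary_apply, F.app_comp, F.app_map]

theorem map_binary {A A' B B' : Type} [Finite A] [Finite A'] [Finite B] [Finite B']
    (σ : A ≃ A') (τ : B ≃ B') (μ : P.obj (Fin 2)) (x : P.obj A) (y : P.obj B) :
    P.map (Equiv.sumCongr σ τ) (P.binary μ x y) = P.binary μ (P.map σ x) (P.map τ y) := by
  have h : P.comp (P.map finTwoOption μ) (P.map σ x) =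
      P.map (Equiv.sumCongr (Equiv.refl Unit) σ) (P.comp (P.map finTwoOption μ) x) := by
    rw [P.map_comp]
    congr 2
    exact (P.map_eq_self (by rintro (_ | _) <;> rfl) _).symm
  rw [binary_apply, binary_apply, P.map_comp, h, map_map, map_map]
  congr 2
  exact P.map_congr (by rintro (_ | _) <;> rfl) _

theorem comp_finTwo {A : Type} [Finite A] (μ : P.obj (Fin 2)) (x : P.obj A) :
    P.comp (P.map finTwoOption μ) x = P.map (Equiv.sumComm A Unit) (P.binary μ x P.one) := by
  rw [binary_apply, P.comp_one, map_map, map_map]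
  exact (P.map_eq_self (by rintro (_ | _) <;> rfl) _).symm

/-- Substitution into the right argument. -/
theorem binary_comp_right {A B C : Type} [Finite A] [Finite B] [Finite C] (μ : P.obj (Fin 2))
    (x : P.obj A) (y : P.obj (Option B)) (z : P.obj C) :
    P.map (Equiv.sumAssoc A B C) (P.comp (P.map (sumOption A B) (P.binary μ x y)) z) =
      P.binary μ x (P.comp y z) := by
  rw [binary_apply, binary_apply, P.comp_assoc]

/-- Substitution into the left argument. -/
theorem binary_comp_left {A B C : Type} [Finite A] [Finite B] [Finite C] (μ : P.obj (Fin 2))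
    (x : P.obj (Option A)) (y : P.obj B) (z : P.obj C) :
    P.map (sumRightComm A B C) (P.comp (P.map (optionSum A B) (P.binary μ x y)) z) =
      P.binary μ (P.comp x z) y := by
  rw [binary_apply, binary_apply, P.comp_parallel, map_map,
    ← P.comp_assoc, map_map, ← P.map_refl z]
  have h : P.map ((unitSumOption (Option A)).trans (optionSwap A))
      (P.comp (P.map finTwoOption μ) x) = P.map (Equiv.optionCongr (unitSumOption A))
        (P.map (sumOption Unit A) (P.comp (P.map finTwoOption μ) x)) := by
    rw [map_map]
    exact P.map_congr (by rintro (_ | _ | _) <;> rfl) _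
  rw [h, ← P.map_comp, map_map, P.map_refl]
  exact P.comp_map_congr (by rintro ((_ | _) | _) <;> rfl) _ _

/-- The two inputs of a binary operation as iterated distinguished points. -/
def finTwoOptionOption : Fin 2 ≃ Option (Option Empty) :=
  finTwoOption.trans (Equiv.optionCongr unitOption)

theorem binary_swapTwo {A B : Type} [Finite A] [Finite B] (μ : P.obj (Fin 2)) (x : P.obj A)
    (y : P.obj B) :
    P.binary (P.swapTwo μ) x y = P.map (Equiv.sumComm B A) (P.binary μ y x) := by
  have key : ∀ (ν : P.obj (Fin 2)) {C D : Type} [Finite C] [Finite D] (a : P.obj C)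
      (b : P.obj D), P.binary ν a b = P.map (Equiv.sumCongr (Equiv.emptySum Empty C)
        (Equiv.refl D)) (P.comp (P.map (optionSum Empty C)
          (P.comp (P.map finTwoOptionOption ν) a)) b) := by
    intro ν C D _ _ a b
    rw [P.map_comp, P.map_refl, map_map, binary_apply]
    have h : P.map finTwoOptionOption ν =
        P.map (Equiv.optionCongr unitOption) (P.map finTwoOption ν) := by rw [map_map]; rfl
    rw [h]
    nth_rw 2 [← P.map_refl a]
    rw [← P.map_comp, map_map]
    exact P.comp_map_congr (by rintro (_ | _) <;> rfl) _ _
  rw [key, key, swapTwo, map_map]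
  have h : P.map ((Equiv.swap 0 1).trans finTwoOptionOption) μ =
      P.map (optionSwap Empty) (P.map finTwoOptionOption μ) := by
    rw [map_map]
    refine P.map_congr (fun i => ?_) _
    fin_cases i <;> rfl
  rw [h, ← P.comp_parallel, map_map, map_map]
  exact P.map_congr (by rintro ((⟨⟨⟩⟩ | _) | _) <;> rfl) _

/-- The two-point set as the sum of two one-point sets. -/
def unitSumUnit : Unit ⊕ Unit ≃ Fin 2 where
  toFun x := match x with
    | Sum.inl _ => 0
    | Sum.inr _ => 1
  invFun i := if i = 0 then Sum.inl () else Sum.inr ()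
  left_inv := by rintro (_ | _) <;> rfl
  right_inv := by decide

theorem binary_one_one (μ : P.obj (Fin 2)) :
    P.map unitSumUnit (P.binary μ P.one P.one) = μ := by
  rw [binary_apply, P.comp_one, P.comp_one, map_map, map_map, map_map, map_map]
  refine P.map_eq_self (A := Fin 2) (fun i => ?_) _
  fin_cases i <;> rfl

/-- `({*} ⊔ {*}) ⊔ {*}` as a three-point set. -/
def unitSumThree : (Unit ⊕ Unit) ⊕ Unit ≃ Fin 3 where
  toFun x := match x with
    | Sum.inl (Sum.inl _) => 0
    | Sum.inl (Sum.inr _) => 1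
    | Sum.inr _ => 2
  invFun i := if i = 0 then Sum.inl (Sum.inl ()) else if i = 1 then Sum.inl (Sum.inr ()) else
    Sum.inr ()
  left_inv := by rintro ((_ | _) | _) <;> rfl
  right_inv := by decide

theorem compTwo_eq (μ ν : P.obj (Fin 2)) : P.compTwo μ ν =
    P.map unitSumThree (P.binary μ (P.binary ν P.one P.one) P.one) := by
  rw [compTwo, comp_finTwo]
  conv_lhs => rw [← P.binary_one_one ν]
  have h : P.binary μ (P.map unitSumUnit (P.binary ν P.one P.one)) P.one =
      P.map (Equiv.sumCongr unitSumUnit (Equiv.refl Unit))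
        (P.binary μ (P.binary ν P.one P.one) P.one) := by
    rw [P.map_binary, P.map_refl]
  rw [h, map_map, map_map]
  refine P.map_congr ?_ _
  rintro ((_ | _) | _) <;> rfl

end LinOperad

/-! ### Multilinear monomials -/

namespace MagTree

variable {Ω : Type v} {Ω' : Type w} {A B C : Type}

/-- The positions of the leaves of a tree. -/
def Pos : MagTree Ω A → Type
  | leaf _ => Unit
  | node _ l r => l.Pos ⊕ r.Pos

/-- The variable at a position. -/
def label : (t : MagTree Ω A) → t.Pos → A
  | leaf a, _ => a
  | node _ l _, Sum.inl p => l.label p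
  | node _ _ r, Sum.inr p => r.label p

instance finite_pos : (t : MagTree Ω A) → Finite t.Pos
  | leaf _ => inferInstanceAs (Finite Unit)
  | node _ l r =>
    have := finite_pos l
    have := finite_pos r
    inferInstanceAs (Finite (l.Pos ⊕ r.Pos))

theorem mem_leaves_iff (t : MagTree Ω A) (a : A) : a ∈ t.leaves ↔ ∃ p, t.label p = a := by
  induction t with
  | leaf b => exact ⟨fun h => ⟨(), (List.mem_singleton.1 h).symm⟩,
      fun ⟨_, h⟩ => List.mem_singleton.2 h.symm⟩
  | node o l r ihl ihr =>
    rw [leaves, List.mem_append, ihl, ihr]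
    constructor
    · rintro (⟨p, h⟩ | ⟨p, h⟩)
      exacts [⟨Sum.inl p, h⟩, ⟨Sum.inr p, h⟩]
    · rintro ⟨p | p, h⟩
      exacts [Or.inl ⟨p, h⟩, Or.inr ⟨p, h⟩]

theorem label_injective (t : MagTree Ω A) (h : t.leaves.Nodup) : Function.Injective t.label := by
  induction t with
  | leaf b => exact fun _ _ _ => rfl
  | node o l r ihl ihr =>
    rw [leaves, List.nodup_append'] at h
    rintro (p | p) (q | q) hpq
    · exact congrArg Sum.inl (ihl h.1 hpq)
    · exact (h.2.2 ((l.mem_leaves_iff _).2 ⟨p, rfl⟩) ((r.mem_leaves_iff _).2 ⟨q, hpq.symm⟩)).elim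
    · exact (h.2.2 ((l.mem_leaves_iff _).2 ⟨q, rfl⟩) ((r.mem_leaves_iff _).2 ⟨p, hpq⟩)).elim
    · exact congrArg Sum.inr (ihr h.2.1 hpq)

theorem label_bijective {t : MagTree Ω A} (h : t.IsMultilinear) : Function.Bijective t.label :=
  ⟨t.label_injective h.1, fun a => (t.mem_leaves_iff a).1 (h.2 a)⟩

/-- Renaming of variables does not affect positions. -/
def posRename (f : A → B) : (t : MagTree Ω A) → t.Pos ≃ (t.rename f).Pos
  | leaf _ => Equiv.refl Unit
  | node _ l r => Equiv.sumCongr (l.posRename f) (r.posRename f)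

theorem label_posRename (f : A → B) (t : MagTree Ω A) (p : t.Pos) :
    (t.rename f).label (t.posRename f p) = f (t.label p) := by
  induction t with
  | leaf b => rfl
  | node o l r ihl ihr =>
    rcases p with p | p
    exacts [ihl p, ihr p]

theorem rename_rename (f : A → B) (g : B → C) (t : MagTree Ω A) :
    (t.rename f).rename g = t.rename (g ∘ f) := bind_bind _ _ t

theorem mapOps_rename (φ : Ω → Ω') (f : A → B) (t : MagTree Ω A) :
    (t.rename f).mapOps φ = (t.mapOps φ).rename f := by
  induction t with
  | leaf b => rfl
  | node o l r ihl ihr => exact congrArg₂ (node (φ o)) ihl ihr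

end MagTree

namespace MTree

variable {Ω : Type v} {Ω' : Type w} {A A' B B' C : Type}

/-- The positions of the leaves of a multilinear monomial correspond to its variables. -/
noncomputable def posEquiv (t : MTree Ω A) : t.1.Pos ≃ A :=
  Equiv.ofBijective t.1.label (MagTree.label_bijective t.2)

protected theorem finite (t : MTree Ω A) : Finite A := Finite.of_equiv _ t.posEquiv

/-- The product of two multilinear monomials in disjoint sets of variables. -/
def node (o : Ω) (l : MTree Ω A) (r : MTree Ω B) : MTree Ω (A ⊕ B) :=
  ⟨.node o (l.1.rename Sum.inl) (r.1.rename Sum.inr), by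
    constructor
    · rw [MagTree.leaves, MagTree.leaves_rename, MagTree.leaves_rename, List.nodup_append']
      refine ⟨l.2.1.map Sum.inl_injective, r.2.1.map Sum.inr_injective, ?_⟩
      simp [List.Disjoint]
    · rintro (a | b)
      · simp [MagTree.leaves, MagTree.leaves_rename, l.2.2 a]
      · simp [MagTree.leaves, MagTree.leaves_rename, r.2.2 b]⟩

theorem rename_rename (σ : A ≃ B) (τ : B ≃ C) (t : MTree Ω A) :
    (t.rename σ).rename τ = t.rename (σ.trans τ) :=
  Subtype.ext (MagTree.rename_rename _ _ _)

theorem rename_refl (t : MTree Ω A) : t.rename (Equiv.refl A) = t :=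
  Subtype.ext (MagTree.bind_leaf t.1)

theorem rename_symm_rename (σ : A ≃ B) (t : MTree Ω A) : (t.rename σ).rename σ.symm = t := by
  rw [rename_rename, Equiv.self_trans_symm, rename_refl]

theorem rename_rename_symm (σ : A ≃ B) (t : MTree Ω B) : (t.rename σ.symm).rename σ = t := by
  rw [rename_rename, Equiv.symm_trans_self, rename_refl]

theorem node_rename (o : Ω) (l : MTree Ω A) (r : MTree Ω B) (σ : A ≃ A') (τ : B ≃ B') :
    (node o l r).rename (Equiv.sumCongr σ τ) = node o (l.rename σ) (r.rename τ) := by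
  apply Subtype.ext
  change MagTree.node o ((l.1.rename _).rename _) ((r.1.rename _).rename _) =
    MagTree.node o ((l.1.rename _).rename _) ((r.1.rename _).rename _)
  simp only [MagTree.rename_rename]
  rfl

theorem rename_graft (t : MTree Ω (Option A)) (s : MTree Ω B) (σ : A ≃ A') (τ : B ≃ B') :
    (t.graft s).rename (Equiv.sumCongr σ τ) =
      (t.rename (Equiv.optionCongr σ)).graft (s.rename τ) := by
  apply Subtype.ext
  simp only [graft, rename, MagTree.graft, MagTree.rename, MagTree.bind_bind]
  congr 1
  funext x
  rcases x with _ | a <;> simp [MagTree.bind, MagTree.bind_bind]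

theorem node_graft_right (o : Ω) (l : MTree Ω A) (r : MTree Ω (Option B)) (s : MTree Ω C) :
    (((node o l r).rename (sumOption A B)).graft s).rename (Equiv.sumAssoc A B C) =
      node o l (r.graft s) := by
  apply Subtype.ext
  simp only [node, graft, rename, MagTree.graft, MagTree.rename, MagTree.bind_bind, MagTree.bind]
  congr 2
  funext x
  rcases x with _ | a <;> simp [MagTree.bind, MagTree.bind_bind, sumOption]

theorem node_graft_left (o : Ω) (l : MTree Ω (Option A)) (r : MTree Ω B) (s : MTree Ω C) :
    (((node o l r).rename (optionSum A B)).graft s).rename (sumRightComm A B C) =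
      node o (l.graft s) r := by
  apply Subtype.ext
  simp only [node, graft, rename, MagTree.graft, MagTree.rename, MagTree.bind_bind, MagTree.bind]
  congr 2
  funext x
  rcases x with _ | a <;> simp [MagTree.bind, MagTree.bind_bind, optionSum, sumRightComm]

/-- A multilinear monomial whose variables are the positions of the leaves of a tree. -/
def ofPos : (t : MagTree Ω A) → MTree Ω t.Pos
  | .leaf _ => unit Ω
  | .node o l r => node o (ofPos l) (ofPos r)

theorem ofPos_rename (t : MagTree Ω A) : (ofPos t).1.rename t.label = t := by
  induction t with
  | leaf b => rfl
  | node o l r ihl ihr =>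
    conv_rhs => rw [← ihl, ← ihr]
    exact congrArg₂ (MagTree.node o)
      (MagTree.rename_rename Sum.inl (MagTree.node o l r).label (ofPos l).1)
      (MagTree.rename_rename Sum.inr (MagTree.node o l r).label (ofPos r).1)

/-- Multilinear monomials are built from variables by products and bijective renaming. -/
theorem induction {motive : ∀ A : Type, MTree Ω A → Prop} (unit : motive Unit (unit Ω))
    (node : ∀ {A B : Type} (o : Ω) (l : MTree Ω A) (r : MTree Ω B), motive A l → motive B r →
      motive (A ⊕ B) (node o l r))
    (rename : ∀ {A B : Type} (σ : A ≃ B) (t : MTree Ω A), motive A t → motive B (t.rename σ))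
    {A : Type} (t : MTree Ω A) : motive A t := by
  have h : ∀ s : MagTree Ω A, motive s.Pos (ofPos s) := by
    intro s
    induction s with
    | leaf a => exact unit
    | node o l r ihl ihr => exact node o _ _ ihl ihr
  have ht : (ofPos t.1).rename t.posEquiv = t := Subtype.ext (ofPos_rename t.1)
  rw [← ht]
  exact rename _ _ (h t.1)

end MTree

/-- A distinguished point of a disjoint union belongs to one of the two parts. -/
theorem exists_sum_equiv_option {X Y A : Type} (e : X ⊕ Y ≃ Option A) :
    (∃ (B : Type) (σ : X ≃ Option B) (τ : B ⊕ Y ≃ A),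
      e = (Equiv.sumCongr σ (Equiv.refl Y)).trans
        ((optionSum B Y).trans (Equiv.optionCongr τ))) ∨
    (∃ (B : Type) (σ : Y ≃ Option B) (τ : X ⊕ B ≃ A),
      e = (Equiv.sumCongr (Equiv.refl X) σ).trans
        ((sumOption X B).trans (Equiv.optionCongr τ))) := by
  classical
  have key : ∀ {Z : Type} (f : X ⊕ Y ≃ Option Z), f (e.symm none) = none →
      ∃ τ : Z ≃ A, e = f.trans (Equiv.optionCongr τ) := by
    intro Z f hf
    refine ⟨Equiv.removeNone (f.symm.trans e), ?_⟩
    have h : (f.symm.trans e) none = none := by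
      rw [← hf]; simp
    have h' : Equiv.optionCongr (Equiv.removeNone (f.symm.trans e)) = f.symm.trans e := by
      ext1 (_ | z)
      · exact h.symm
      · refine Equiv.removeNone_some _ (Option.ne_none_iff_exists'.1 fun hz => ?_)
        exact Option.some_ne_none z ((f.symm.trans e).injective (hz.trans h.symm))
    rw [h', ← Equiv.trans_assoc, Equiv.self_trans_symm, Equiv.refl_trans]
  rcases hx : e.symm none with x | y
  · obtain ⟨τ, h⟩ := key ((Equiv.sumCongr (Equiv.optionSubtypeNe x).symm (Equiv.refl Y)).trans
      (optionSum {z // z ≠ x} Y)) (by rw [hx]; simp [optionSum])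
    exact Or.inl ⟨_, _, τ, h⟩
  · obtain ⟨τ, h⟩ := key ((Equiv.sumCongr (Equiv.refl X) (Equiv.optionSubtypeNe y).symm).trans
      (sumOption X {z // z ≠ y})) (by rw [hx]; simp [sumOption])
    exact Or.inr ⟨_, _, τ, h⟩

open LinOperad

/-! ### The universal property of the free operad -/

section Free

variable {k : Type u} [Field k] {Ω : Type v} {A B : Type}

variable (k) in
/-- A multilinear monomial as an element of the free operad. -/
noncomputable def mono [Finite A] (t : MTree Ω A) : (freeOperad k Ω).obj A :=
  (Finsupp.single t 1 : MPoly k Ω A)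

variable (k) in
/-- The generator `x₀ o x₁` of the free operad. -/
noncomputable def gen (o : Ω) : (freeOperad k Ω).obj (Fin 2) :=
  mono k ((MTree.node o (MTree.unit Ω) (MTree.unit Ω)).rename unitSumUnit)

theorem map_mono [Finite A] [Finite B] (σ : A ≃ B) (t : MTree Ω A) :
    (freeOperad k Ω).map σ (mono k t) = mono k (t.rename σ) :=
  MPoly.rename_single k Ω σ t 1

theorem comp_mono [Finite A] [Finite B] (t : MTree Ω (Option A)) (s : MTree Ω B) :
    (freeOperad k Ω).comp (mono k t) (mono k s) = mono k (t.graft s) := by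
  refine (MPoly.graft_single k Ω t s 1 1).trans ?_
  rw [mul_one]
  rfl

theorem mono_unit : mono k (MTree.unit Ω) = (freeOperad k Ω).one := rfl

theorem mono_injective [Finite A] : Function.Injective (mono k : MTree Ω A → _) :=
  Finsupp.single_left_injective one_ne_zero

/-- Linear maps on multilinear polynomials are determined by their values on monomials. -/
theorem freeOperad_ext [Finite A] {M : Type w} [AddCommGroup M] [Module k M]
    {F G : (freeOperad k Ω).obj A →ₗ[k] M} (h : ∀ t, F (mono k t) = G (mono k t)) : F = G :=
  Finsupp.lhom_ext' (M := k) (R := k) (φ := F) (ψ := G) fun t => LinearMap.ext_ring (h t)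

theorem freeOperad_induction [Finite A] {p : (freeOperad k Ω).obj A → Prop}
    (hadd : ∀ f g, p f → p g → p (f + g)) (hsmul : ∀ (c : k) t, p (c • mono k t))
    (hzero : p 0) (f : (freeOperad k Ω).obj A) : p f := by
  refine Finsupp.induction_linear (motive := p) f hzero hadd fun t c => ?_
  have h : (Finsupp.single t c : MPoly k Ω A) = c • Finsupp.single t 1 := by
    rw [Finsupp.smul_single, smul_eq_mul, mul_one]
  rw [h]
  exact hsmul c t

/-- The linear map on multilinear polynomials with given values on monomials. -/
noncomputable def monoLift [Finite A] {M : Type w} [AddCommGroup M] [Module k M]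
    (F : MTree Ω A → M) : (freeOperad k Ω).obj A →ₗ[k] M :=
  Finsupp.linearCombination k F

@[simp] theorem monoLift_mono [Finite A] {M : Type w} [AddCommGroup M] [Module k M]
    (F : MTree Ω A → M) (t : MTree Ω A) : monoLift (k := k) F (mono k t) = F t := by
  refine (Finsupp.linearCombination_single k 1 t).trans ?_
  rw [one_smul]

theorem binary_gen_mono [Finite A] [Finite B] (o : Ω) (l : MTree Ω A) (r : MTree Ω B) :
    (freeOperad k Ω).binary (gen k o) (mono k l) (mono k r) = mono k (MTree.node o l r) := by
  rw [binary_apply, gen, map_mono, comp_mono, map_mono, comp_mono]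
  congr 1
  apply Subtype.ext
  simp only [MTree.node, MTree.graft, MTree.rename, MagTree.graft, MagTree.rename,
    MagTree.bind_bind, MagTree.bind, MTree.unit]
  exact congrArg₂ (MagTree.node o) (MagTree.bind_bind _ _ _) rfl

variable {Q : LinOperad.{u, w} k} (φ : Ω → Q.obj (Fin 2))

/-- The value of a tree in an operad, as an operation whose inputs are the positions of the
leaves. -/
def MagTree.eval {A : Type} : (t : MagTree Ω A) → Q.obj t.Pos
  | .leaf _ => Q.one
  | .node o l r => Q.binary (φ o) l.eval r.eval

theorem MagTree.eval_rename (f : A → B) (t : MagTree Ω A) :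
    (t.rename f).eval φ = Q.map (t.posRename f) (t.eval φ) := by
  induction t with
  | leaf a => exact (Q.map_refl _).symm
  | node o l r ihl ihr =>
    refine Eq.trans ?_ (Q.map_binary (l.posRename f) (r.posRename f) (φ o) _ _).symm
    rw [← ihl, ← ihr]
    rfl

/-- The value of a multilinear monomial in an operad. -/
noncomputable def MTree.eval [Finite A] (t : MTree Ω A) : Q.obj A :=
  Q.map t.posEquiv (t.1.eval φ)

theorem MTree.eval_rename [Finite A] [Finite B] (σ : A ≃ B) (t : MTree Ω A) :
    (t.rename σ).eval φ = Q.map σ (t.eval φ) := by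
  rw [eval, eval, map_map]
  refine Eq.trans (congrArg (Q.map _) (MagTree.eval_rename φ σ t.1)) ?_
  refine Eq.trans (map_map Q _ _ _) ?_
  exact Q.map_congr (fun p => MagTree.label_posRename σ t.1 p) _

theorem MTree.eval_unit : (MTree.unit Ω).eval φ = Q.one :=
  Q.map_eq_self (A := Unit) (fun _ => rfl) _

theorem MTree.eval_node [Finite A] [Finite B] (o : Ω) (l : MTree Ω A) (r : MTree Ω B) :
    (MTree.node o l r).eval φ = Q.binary (φ o) (l.eval φ) (r.eval φ) := by
  rw [eval, eval, eval, ← map_binary]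
  have h : (MTree.node o l r).1.eval φ =
      Q.map (Equiv.sumCongr (l.1.posRename Sum.inl) (r.1.posRename Sum.inr))
        (Q.binary (φ o) (l.1.eval φ) (r.1.eval φ)) := by
    rw [map_binary, ← MagTree.eval_rename, ← MagTree.eval_rename]
    rfl
  refine Eq.trans (congrArg (Q.map _) h) ?_
  refine Eq.trans (map_map Q _ _ _) ?_
  refine Q.map_congr ?_ _
  rintro (p | p)
  · exact MagTree.label_posRename (Sum.inl : A → A ⊕ B) l.1 p
  · exact MagTree.label_posRename (Sum.inr : B → A ⊕ B) r.1 p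

theorem MTree.eval_graft {A B : Type} [Finite A] [Finite B] (t : MTree Ω (Option A))
    (s : MTree Ω B) : (t.graft s).eval φ = Q.comp (t.eval φ) (s.eval φ) := by
  suffices H : ∀ {X : Type} (t : MTree Ω X) [Finite X] {A B : Type} [Finite A] [Finite B]
      (e : X ≃ Option A) (s : MTree Ω B),
      ((t.rename e).graft s).eval φ = Q.comp ((t.rename e).eval φ) (s.eval φ) by
    have h := H t (Equiv.refl _) s
    rwa [MTree.rename_refl] at h
  clear t s
  intro X t
  induction t using MTree.induction with
  | rename σ t ih =>
    intro _ A B _ _ e s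
    have := t.finite
    rw [MTree.rename_rename]
    exact ih _ s
  | unit =>
    intro _ A B _ _ e s
    obtain ⟨τ, rfl⟩ : ∃ τ : Empty ≃ A, e = unitOption.trans (Equiv.optionCongr τ) := by
      have hA : IsEmpty A := ⟨fun a => by
        exact Option.some_ne_none a (e.symm.injective rfl)⟩
      refine ⟨Equiv.equivOfIsEmpty _ _, Equiv.ext fun x => ?_⟩
      rcases e x with _ | a
      · rfl
      · exact hA.elim a
    have h : (((MTree.unit Ω).rename unitOption).graft s) =
        s.rename (Equiv.emptySum Empty B).symm := rfl
    conv_lhs => rw [← MTree.rename_refl s]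
    rw [← MTree.rename_rename, ← MTree.rename_graft, h, MTree.eval_rename, MTree.eval_rename,
      MTree.eval_rename, MTree.eval_rename, MTree.eval_unit, ← Q.one_comp, Q.map_comp, Q.map_refl]
  | node o l r ihl ihr =>
    intro _ A B _ _ e s
    have := l.finite
    have := r.finite
    rcases exists_sum_equiv_option e with ⟨Y, σ, τ, rfl⟩ | ⟨Y, σ, τ, rfl⟩
    · have : Finite (Option Y) := Finite.of_equiv _ σ
      have : Finite Y := Finite.of_injective (some : Y → Option Y) (Option.some_injective Y)
      rw [← MTree.rename_rename, ← MTree.rename_rename, MTree.node_rename, MTree.rename_refl]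
      conv_lhs => rw [← MTree.rename_refl s]
      rw [← MTree.rename_graft, MTree.eval_rename, MTree.eval_rename]
      rw [← Q.map_refl (s.eval φ)]
      rw [← Q.map_comp]
      congr 1
      apply Q.map_injective (sumRightComm _ _ _)
      rw [← MTree.eval_rename, MTree.node_graft_left, MTree.eval_node, ihl,
        MTree.eval_rename φ (optionSum _ _),
        MTree.eval_node, Q.binary_comp_left]
    · have : Finite (Option Y) := Finite.of_equiv _ σ
      have : Finite Y := Finite.of_injective (some : Y → Option Y) (Option.some_injective Y)
      rw [← MTree.rename_rename, ← MTree.rename_rename, MTree.node_rename, MTree.rename_refl]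
      conv_lhs => rw [← MTree.rename_refl s]
      rw [← MTree.rename_graft, MTree.eval_rename, MTree.eval_rename]
      rw [← Q.map_refl (s.eval φ)]
      rw [← Q.map_comp]
      congr 1
      apply Q.map_injective (Equiv.sumAssoc _ _ _)
      rw [← MTree.eval_rename, MTree.node_graft_right, MTree.eval_node, ihr,
        MTree.eval_rename φ (sumOption _ _),
        MTree.eval_node, Q.binary_comp_right]

/-- The morphism from the free operad that takes prescribed values on the generators. -/
noncomputable def freeLift (φ : Ω → Q.obj (Fin 2)) : Hom (freeOperad k Ω) Q where
  app _ _ := monoLift fun t => t.eval φ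
  app_map {A B} _ _ σ f := by
    refine LinearMap.congr_fun (f := (monoLift fun t => t.eval φ) ∘ₗ (freeOperad k Ω).map σ)
      (g := Q.map σ ∘ₗ monoLift fun t => t.eval φ) (freeOperad_ext fun t => ?_) f
    simp [map_mono, MTree.eval_rename]
  app_one := by rw [← mono_unit, monoLift_mono, MTree.eval_unit]
  app_comp {A B} _ _ f g := by
    refine LinearMap.congr_fun (LinearMap.congr_fun
      (f := (freeOperad k Ω).comp.compr₂ (monoLift fun t => t.eval φ))
      (g := Q.comp.compl₁₂ (monoLift fun t => t.eval φ) (monoLift fun t => t.eval φ)) ?_ f) g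
    refine freeOperad_ext fun t => freeOperad_ext fun s => ?_
    simp [comp_mono, MTree.eval_graft]

theorem freeLift_mono [Finite A] (t : MTree Ω A) : (freeLift φ).app A (mono k t) = t.eval φ :=
  monoLift_mono _ _

@[simp] theorem freeLift_gen (o : Ω) : (freeLift φ).app (Fin 2) (gen k o) = φ o := by
  rw [gen, freeLift_mono, MTree.eval_rename, MTree.eval_node, MTree.eval_unit, binary_one_one]

/-- A morphism from the free operad is determined by its values on the generators. -/
theorem freeOperad_hom_ext {F G : Hom (freeOperad k Ω) Q}
    (h : ∀ o, F.app (Fin 2) (gen k o) = G.app (Fin 2) (gen k o)) : F = G := by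
  suffices H : ∀ {A : Type} (t : MTree Ω A) [Finite A],
      F.app A (mono k t) = G.app A (mono k t) from
    Hom.ext_app fun A _ x => LinearMap.congr_fun (freeOperad_ext fun t => H t) x
  intro A t
  induction t using MTree.induction with
  | unit =>
    intro _
    rw [mono_unit, F.app_one, G.app_one]
  | node o l r ihl ihr =>
    intro _
    have := l.finite
    have := r.finite
    rw [← binary_gen_mono, F.app_binary, G.app_binary, h, ihl, ihr]
  | rename σ t ih =>
    intro _
    have := t.finite
    rw [← map_mono, F.app_map, G.app_map, ih]

end Free

/-! ### The universal property of the operad of a variety -/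

section Quotient

variable {k : Type u} [Field k]

namespace LinOperad

/-- The kernel of a morphism of operads. -/
def Hom.ker {P : LinOperad.{u, w} k} {Q : LinOperad.{u, w'} k} (F : Hom P Q) : OpIdeal P where
  sub A _ := LinearMap.ker (F.app A)
  map_mem σ f hf := by
    rw [LinearMap.mem_ker] at hf ⊢
    rw [F.app_map, hf, map_zero]
  comp_left f g hf := by
    rw [LinearMap.mem_ker] at hf ⊢
    rw [F.app_comp, hf, map_zero, LinearMap.zero_apply]
  comp_right f g hg := by
    rw [LinearMap.mem_ker] at hg ⊢
    rw [F.app_comp, hg, map_zero]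

theorem idealSpan_le {P : LinOperad.{u, w} k} {S : ∀ n : ℕ, Set (P.obj (Fin n))} {J : OpIdeal P}
    (h : ∀ n, S n ⊆ J.sub (Fin n)) (A : Type) [Finite A] : (P.idealSpan S).sub A ≤ J.sub A :=
  iInf_le (fun J : {J : OpIdeal P // ∀ n, S n ⊆ J.sub (Fin n)} => J.1.sub A) ⟨J, h⟩

theorem subset_idealSpan (P : LinOperad.{u, w} k) (S : ∀ n : ℕ, Set (P.obj (Fin n))) (n : ℕ) :
    S n ⊆ (P.idealSpan S).sub (Fin n) := by
  intro f hf
  change f ∈ ⨅ J : {J : OpIdeal P // ∀ n, S n ⊆ J.sub (Fin n)}, J.1.sub (Fin n)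
  rw [Submodule.mem_iInf]
  exact fun J => J.2 n hf

end LinOperad

variable {Ω : Type v} (S : Identities k Ω)

/-- The projection of the free operad onto the operad of a variety. -/
noncomputable def proj : Hom (freeOperad k Ω) (operadOf S) where
  app A _ := (((freeOperad k Ω).idealSpan S).sub A).mkQ
  app_map _ _ := rfl
  app_one := rfl
  app_comp _ _ := rfl

theorem proj_surjective (A : Type) [Finite A] : Function.Surjective ((proj S).app A) :=
  Submodule.mkQ_surjective _

theorem proj_eq_zero_iff {A : Type} [Finite A] (f : (freeOperad k Ω).obj A) :
    (proj S).app A f = 0 ↔ f ∈ ((freeOperad k Ω).idealSpan S).sub A :=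
  Submodule.Quotient.mk_eq_zero _

theorem proj_eq_zero {n : ℕ} {f : (freeOperad k Ω).obj (Fin n)} (hf : f ∈ S n) :
    (proj S).app (Fin n) f = 0 :=
  (proj_eq_zero_iff S (A := Fin n) f).2 (subset_idealSpan (freeOperad k Ω) S n hf)

/-- The generator `x₀ o x₁` of the operad of a variety. -/
noncomputable def cls (o : Ω) : (operadOf S).obj (Fin 2) := (proj S).app (Fin 2) (gen k o)

variable {S} {Q : LinOperad.{u, w} k}

theorem le_ker_of_identities (F : Hom (freeOperad k Ω) Q)
    (h : ∀ n, ∀ f : (freeOperad k Ω).obj (Fin n), f ∈ S n → F.app (Fin n) f = 0)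
    {A : Type} [Finite A] {f : (freeOperad k Ω).obj A}
    (hf : (proj S).app A f = 0) : F.app A f = 0 :=
  idealSpan_le (J := F.ker) (fun n f hf => h n f hf) A ((proj_eq_zero_iff S f).1 hf)

/-- A morphism from the free operad that annihilates the identities `S` factors through the operad
of the variety. -/
noncomputable def descend (F : Hom (freeOperad k Ω) Q)
    (h : ∀ n, ∀ f : (freeOperad k Ω).obj (Fin n), f ∈ S n → F.app (Fin n) f = 0) :
    Hom (operadOf S) Q where
  app A _ := (((freeOperad k Ω).idealSpan S).sub A).liftQ (F.app A) fun f hf =>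
    le_ker_of_identities F h ((proj_eq_zero_iff S f).2 hf)
  app_map {A B} _ _ σ f := by
    obtain ⟨f, rfl⟩ := proj_surjective S A f
    exact F.app_map σ f
  app_one := F.app_one
  app_comp {A B} _ _ f g := by
    obtain ⟨f, rfl⟩ := proj_surjective S _ f
    obtain ⟨g, rfl⟩ := proj_surjective S _ g
    exact F.app_comp f g

@[simp] theorem descend_proj (F : Hom (freeOperad k Ω) Q)
    (h : ∀ n, ∀ f : (freeOperad k Ω).obj (Fin n), f ∈ S n → F.app (Fin n) f = 0)
    {A : Type} [Finite A] (f : (freeOperad k Ω).obj A) :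
    (descend F h).app A ((proj S).app A f) = F.app A f := rfl

theorem descend_freeLift_cls (φ : Ω → Q.obj (Fin 2))
    (h : ∀ n, ∀ f : (freeOperad k Ω).obj (Fin n), f ∈ S n →
      (freeLift φ).app (Fin n) f = 0) (o : Ω) :
    (descend (freeLift φ) h).app (Fin 2) (cls S o) = φ o := by
  rw [cls, descend_proj, freeLift_gen]

theorem operadOf_hom_ext {F G : Hom (operadOf S) Q}
    (h : ∀ o, F.app (Fin 2) (cls S o) = G.app (Fin 2) (cls S o)) : F = G := by
  have h' : F.comp (proj S) = G.comp (proj S) := freeOperad_hom_ext h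
  refine Hom.ext_app fun A _ x => ?_
  obtain ⟨x, rfl⟩ := proj_surjective S A x
  exact congrArg (fun H : Hom (freeOperad k Ω) Q => H.app A x) h'

end Quotient

/-! ### Tensoring with an operad in sets -/

/-- A symmetric operad in sets with finite components. -/
structure SetOperad where
  obj : Type → Type
  finite : ∀ (A : Type) [Finite A], Finite (obj A)
  map : ∀ {A B : Type}, (A ≃ B) → obj A → obj B
  one : obj Unit
  comp : ∀ {A B : Type}, obj (Option A) → obj B → obj (A ⊕ B)
  map_refl : ∀ {A : Type} (f : obj A), map (Equiv.refl A) f = f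
  map_trans : ∀ {A B C : Type} (σ : A ≃ B) (τ : B ≃ C) (f : obj A),
    map (σ.trans τ) f = map τ (map σ f)
  map_comp : ∀ {A A' B B' : Type} (σ : A ≃ A') (τ : B ≃ B') (f : obj (Option A)) (g : obj B),
    map (Equiv.sumCongr σ τ) (comp f g) = comp (map (Equiv.optionCongr σ) f) (map τ g)
  comp_one : ∀ {A : Type} (f : obj (Option A)),
    comp f one = map (Equiv.optionEquivSumPUnit A) f
  one_comp : ∀ {B : Type} (g : obj B),
    comp (map unitOption one) g = map (Equiv.emptySum Empty B).symm g
  comp_assoc : ∀ {A B C : Type} (f : obj (Option A)) (g : obj (Option B)) (h : obj C),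
    map (Equiv.sumAssoc A B C) (comp (map (sumOption A B) (comp f g)) h) = comp f (comp g h)
  comp_parallel : ∀ {A B C : Type} (f : obj (Option (Option A))) (g : obj B) (h : obj C),
    map (sumRightComm A B C) (comp (map (optionSum A B) (comp f g)) h) =
      comp (map (optionSum A C) (comp (map (optionSwap A) f) h)) g

namespace SetOperad

variable (C : SetOperad) {k : Type u} [Field k]

/-- The composition `d(h, h')` in an operad in sets. -/
def binary {A B : Type} (d : C.obj (Fin 2)) (h : C.obj A) (h' : C.obj B) : C.obj (A ⊕ B) :=
  C.comp (C.map (unitSumOption A) (C.comp (C.map finTwoOption d) h)) h'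

section

variable (Q : LinOperad.{u, w} k)

/-- The action of bijections on the Hadamard product. -/
noncomputable def hadMap {A B : Type} [Finite A] [Finite B] (σ : A ≃ B) :
    (C.obj A →₀ Q.obj A) →ₗ[k] (C.obj B →₀ Q.obj B) :=
  Finsupp.lsum k fun h => Finsupp.lsingle (C.map σ h) ∘ₗ Q.map σ

/-- Composition in the Hadamard product. -/
noncomputable def hadComp {A B : Type} [Finite A] [Finite B] :
    (C.obj (Option A) →₀ Q.obj (Option A)) →ₗ[k] (C.obj B →₀ Q.obj B) →ₗ[k]
      (C.obj (A ⊕ B) →₀ Q.obj (A ⊕ B)) :=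
  Finsupp.lsum k fun h => LinearMap.flip (Finsupp.lsum k fun h' =>
    LinearMap.flip (Q.comp.compr₂ (Finsupp.lsingle (C.comp h h'))))

theorem hadMap_single {A B : Type} [Finite A] [Finite B] (σ : A ≃ B) (h : C.obj A)
    (x : Q.obj A) : C.hadMap Q σ (Finsupp.single h x) = Finsupp.single (C.map σ h) (Q.map σ x) := by
  simp [hadMap]

theorem hadComp_single {A B : Type} [Finite A] [Finite B] (h : C.obj (Option A)) (h' : C.obj B)
    (x : Q.obj (Option A)) (y : Q.obj B) :
    C.hadComp Q (Finsupp.single h x) (Finsupp.single h' y) =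
      Finsupp.single (C.comp h h') (Q.comp x y) := by
  simp [hadComp]

/-- The Hadamard product of an operad with (the linearization of) an operad in sets. -/
noncomputable def had : LinOperad.{u, w} k where
  obj A _ := C.obj A →₀ Q.obj A
  map σ := C.hadMap Q σ
  one := Finsupp.single C.one Q.one
  comp := C.hadComp Q
  map_refl := by
    intro A _ f
    induction f using Finsupp.induction_linear with
    | zero => simp
    | add f g hf hg => simp only [map_add, hf, hg]
    | single h x => rw [hadMap_single, C.map_refl, Q.map_refl]
  map_trans := by
    intro A B D _ _ _ σ τ f
    induction f using Finsupp.induction_linear with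
    | zero => simp
    | add f g hf hg => simp only [map_add, hf, hg]
    | single h x => simp only [hadMap_single, C.map_trans, Q.map_trans]
  map_comp := by
    intro A A' B B' _ _ _ _ σ τ f g
    induction f using Finsupp.induction_linear with
    | zero => simp
    | add f f' hf hf' => simp only [map_add, LinearMap.add_apply, hf, hf']
    | single h x =>
      induction g using Finsupp.induction_linear with
      | zero => simp
      | add g g' hg hg' => simp only [map_add, hg, hg']
      | single h' y => simp only [hadMap_single, hadComp_single, C.map_comp, Q.map_comp]
  comp_one := by
    intro A _ f
    induction f using Finsupp.induction_linear with
    | zero => simp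
    | add f f' hf hf' => simp only [map_add, LinearMap.add_apply, hf, hf']
    | single h x => simp only [hadMap_single, hadComp_single, C.comp_one, Q.comp_one]
  one_comp := by
    intro B _ g
    induction g using Finsupp.induction_linear with
    | zero => simp
    | add g g' hg hg' => simp only [map_add, hg, hg']
    | single h' y => simp only [hadMap_single, hadComp_single, C.one_comp, Q.one_comp]
  comp_assoc := by
    intro A B D _ _ _ f g h
    induction f using Finsupp.induction_linear with
    | zero => simp
    | add f f' hf hf' => simp only [map_add, LinearMap.add_apply, hf, hf']
    | single a x =>
      induction g using Finsupp.induction_linear with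
      | zero => simp
      | add g g' hg hg' => simp only [map_add, LinearMap.add_apply, hg, hg']
      | single b y =>
        induction h using Finsupp.induction_linear with
        | zero => simp
        | add h h' hh hh' => simp only [map_add, hh, hh']
        | single c z => simp only [hadMap_single, hadComp_single, C.comp_assoc, Q.comp_assoc]
  comp_parallel := by
    intro A B D _ _ _ f g h
    induction f using Finsupp.induction_linear with
    | zero => simp
    | add f f' hf hf' => simp only [map_add, LinearMap.add_apply, hf, hf']
    | single a x =>
      induction g using Finsupp.induction_linear with
      | zero => simp
      | add g g' hg hg' => simp only [map_add, LinearMap.add_apply, hg, hg']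
      | single b y =>
        induction h using Finsupp.induction_linear with
        | zero => simp
        | add h h' hh hh' => simp only [map_add, LinearMap.add_apply, hh, hh']
        | single c z =>
          simp only [hadMap_single, hadComp_single, C.comp_parallel, Q.comp_parallel]

/-- The element `x ⊗ h` of a Hadamard product. -/
noncomputable def tmul {A : Type} [Finite A] (h : C.obj A) : Q.obj A →ₗ[k] (C.had Q).obj A :=
  Finsupp.lsingle h

/-- The coefficient of `h` of an element of a Hadamard product. -/
noncomputable def coeff {A : Type} [Finite A] (h : C.obj A) : (C.had Q).obj A →ₗ[k] Q.obj A :=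
  Finsupp.lapply h

variable {Q}

open Classical in
theorem coeff_tmul {A : Type} [Finite A] (h h' : C.obj A) (x : Q.obj A) :
    C.coeff Q h (C.tmul Q h' x) = if h' = h then x else 0 :=
  Finsupp.single_apply

theorem coeff_tmul_self {A : Type} [Finite A] (h : C.obj A) (x : Q.obj A) :
    C.coeff Q h (C.tmul Q h x) = x :=
  Finsupp.single_eq_same

theorem coeff_tmul_of_ne {A : Type} [Finite A] {h h' : C.obj A} (hh : h' ≠ h) (x : Q.obj A) :
    C.coeff Q h (C.tmul Q h' x) = 0 := by
  rw [coeff_tmul, if_neg hh]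

theorem had_ext {A : Type} [Finite A] {x y : (C.had Q).obj A}
    (h : ∀ a, C.coeff Q a x = C.coeff Q a y) : x = y :=
  Finsupp.ext h

theorem had_hom_ext {A : Type} [Finite A] {M : Type w'} [AddCommGroup M] [Module k M]
    {F G : (C.had Q).obj A →ₗ[k] M} (h : ∀ a x, F (C.tmul Q a x) = G (C.tmul Q a x)) : F = G :=
  Finsupp.lhom_ext (φ := F) (ψ := G) h

noncomputable instance fintypeObj (A : Type) [Finite A] : Fintype (C.obj A) :=
  have := C.finite A
  Fintype.ofFinite _

theorem sum_tmul {A : Type} [Finite A] (x : (C.had Q).obj A) :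
    ∑ h, C.tmul Q h (C.coeff Q h x) = x := by
  classical
  refine C.had_ext fun a => ?_
  rw [map_sum, Finset.sum_eq_single a]
  · rw [coeff_tmul_self]
  · intro b _ hb
    rw [coeff_tmul_of_ne _ hb]
  · exact fun h => (h (Finset.mem_univ a)).elim

theorem map_tmul {A B : Type} [Finite A] [Finite B] (σ : A ≃ B) (h : C.obj A) (x : Q.obj A) :
    (C.had Q).map σ (C.tmul Q h x) = C.tmul Q (C.map σ h) (Q.map σ x) :=
  hadMap_single _ _ _ _ _

theorem comp_tmul {A B : Type} [Finite A] [Finite B] (h : C.obj (Option A)) (h' : C.obj B)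
    (x : Q.obj (Option A)) (y : Q.obj B) :
    (C.had Q).comp (C.tmul Q h x) (C.tmul Q h' y) = C.tmul Q (C.comp h h') (Q.comp x y) :=
  hadComp_single _ _ _ _ _ _

theorem binary_tmul {A B : Type} [Finite A] [Finite B] (d : C.obj (Fin 2)) (h : C.obj A)
    (h' : C.obj B) (μ : Q.obj (Fin 2)) (x : Q.obj A) (y : Q.obj B) :
    (C.had Q).binary (C.tmul Q d μ) (C.tmul Q h x) (C.tmul Q h' y) =
      C.tmul Q (C.binary d h h') (Q.binary μ x y) := by
  simp only [binary_apply, map_tmul, comp_tmul, binary]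

theorem one_had : (C.had Q).one = C.tmul Q C.one Q.one := rfl

theorem map_map {A B D : Type} (σ : A ≃ B) (τ : B ≃ D) (h : C.obj A) :
    C.map τ (C.map σ h) = C.map (σ.trans τ) h := (C.map_trans σ τ h).symm

theorem map_symm_map {A B : Type} (σ : A ≃ B) (h : C.obj A) : C.map σ.symm (C.map σ h) = h := by
  rw [map_map, Equiv.self_trans_symm, C.map_refl]

theorem map_map_symm {A B : Type} (σ : A ≃ B) (h : C.obj B) : C.map σ (C.map σ.symm h) = h := by
  rw [map_map, Equiv.symm_trans_self, C.map_refl]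

theorem coeff_map {A B : Type} [Finite A] [Finite B] (σ : A ≃ B) (h : C.obj A)
    (x : (C.had Q).obj A) :
    C.coeff Q (C.map σ h) ((C.had Q).map σ x) = Q.map σ (C.coeff Q h x) := by
  classical
  refine LinearMap.congr_fun (f := C.coeff Q (C.map σ h) ∘ₗ (C.had Q).map σ)
    (g := Q.map σ ∘ₗ C.coeff Q h) (C.had_hom_ext fun a y => ?_) x
  simp only [LinearMap.comp_apply, map_tmul, coeff_tmul]
  by_cases ha : a = h
  · rw [if_pos ha, if_pos (congrArg _ ha)]
  · rw [if_neg ha, if_neg, map_zero]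
    intro h'
    exact ha (by rw [← C.map_symm_map σ a, h', C.map_symm_map])

end

/-- The action of a morphism on a component of the Hadamard product. -/
noncomputable def hadApp {P : LinOperad.{u, w} k} {Q : LinOperad.{u, w'} k} (F : Hom P Q)
    (A : Type) [Finite A] : (C.had P).obj A →ₗ[k] (C.had Q).obj A :=
  Finsupp.mapRange.linearMap (F.app A)

theorem hadApp_tmul {P : LinOperad.{u, w} k} {Q : LinOperad.{u, w'} k} (F : Hom P Q)
    {A : Type} [Finite A] (h : C.obj A) (x : P.obj A) :
    C.hadApp F A (C.tmul P h x) = C.tmul Q h (F.app A x) :=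
  Finsupp.mapRange_single (hf := map_zero _)

/-- The Hadamard product as a functor. -/
noncomputable def hadHom {P : LinOperad.{u, w} k} {Q : LinOperad.{u, w'} k} (F : Hom P Q) :
    Hom (C.had P) (C.had Q) where
  app A _ := C.hadApp F A
  app_map {A B} _ _ σ f := by
    refine LinearMap.congr_fun (f := C.hadApp F B ∘ₗ (C.had P).map σ)
      (g := (C.had Q).map σ ∘ₗ C.hadApp F A) (C.had_hom_ext fun h x => ?_) f
    simp only [LinearMap.comp_apply, hadApp_tmul, map_tmul, F.app_map]
  app_one := by rw [one_had, hadApp_tmul, F.app_one, one_had]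
  app_comp {A B} _ _ f g := by
    refine LinearMap.congr_fun (LinearMap.congr_fun
      (f := (C.had P).comp.compr₂ (C.hadApp F (A ⊕ B)))
      (g := (C.had Q).comp.compl₁₂ (C.hadApp F (Option A)) (C.hadApp F B)) ?_ f) g
    refine C.had_hom_ext fun h x => C.had_hom_ext fun h' y => ?_
    simp only [LinearMap.compr₂_apply, LinearMap.compl₁₂_apply, hadApp_tmul, comp_tmul, F.app_comp]

theorem hadHom_tmul {P : LinOperad.{u, w} k} {Q : LinOperad.{u, w'} k} (F : Hom P Q)
    {A : Type} [Finite A] (h : C.obj A) (x : P.obj A) :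
    (C.hadHom F).app A (C.tmul P h x) = C.tmul Q h (F.app A x) :=
  C.hadApp_tmul F h x

theorem coeff_hadHom {P : LinOperad.{u, w} k} {Q : LinOperad.{u, w'} k} (F : Hom P Q)
    {A : Type} [Finite A] (h : C.obj A) (x : (C.had P).obj A) :
    C.coeff Q h ((C.hadHom F).app A x) = F.app A (C.coeff P h x) := rfl

/-- The Hadamard products of isomorphic operads are isomorphic. -/
noncomputable def hadIso {P : LinOperad.{u, w} k} {Q : LinOperad.{u, w'} k} (e : Iso P Q) :
    Iso (C.had P) (C.had Q) :=
  Iso.ofHoms (C.hadHom e.hom) (C.hadHom e.symm.hom)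
    (Hom.ext_app fun A _ _ => C.had_ext fun _ => (e.equiv A).symm_apply_apply _)
    (Hom.ext_app fun A _ _ => C.had_ext fun _ => (e.equiv A).apply_symm_apply _)

end SetOperad

section Ternary

variable {k : Type u} [Field k]

namespace LinOperad

variable (P : LinOperad.{u, w} k) {μ ν μ' ν' : P.obj (Fin 2)}

/-- An identity between operations `μ(ν(x, y), z)` may be checked on the units. -/
theorem binary_binary_eq_of_compTwo_eq (h : P.compTwo μ ν = P.compTwo μ' ν')
    {A B C : Type} [Finite A] [Finite B] [Finite C] (x : P.obj A) (y : P.obj B) (z : P.obj C) :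
    P.binary μ (P.binary ν x y) z = P.binary μ' (P.binary ν' x y) z := by
  have hmap : ∀ {A B C A' B' C' : Type} [Finite A] [Finite B] [Finite C] [Finite A'] [Finite B']
      [Finite C'] (σ : A ≃ A') (τ : B ≃ B') (ρ : C ≃ C') (x : P.obj A) (y : P.obj B) (z : P.obj C),
      P.binary μ (P.binary ν x y) z = P.binary μ' (P.binary ν' x y) z →
      P.binary μ (P.binary ν (P.map σ x) (P.map τ y)) (P.map ρ z) =
        P.binary μ' (P.binary ν' (P.map σ x) (P.map τ y)) (P.map ρ z) := by
    intro A B C A' B' C' _ _ _ _ _ _ σ τ ρ x y z h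
    rw [← map_binary, ← map_binary, ← map_binary, ← map_binary, h]
  have h1 : ∀ {A B C D : Type} [Finite A] [Finite B] [Finite C] [Finite D] (x : P.obj (Option A))
      (y : P.obj B) (z : P.obj C) (a : P.obj D),
      P.binary μ (P.binary ν x y) z = P.binary μ' (P.binary ν' x y) z →
      P.binary μ (P.binary ν (P.comp x a) y) z = P.binary μ' (P.binary ν' (P.comp x a) y) z := by
    intro A B C D _ _ _ _ x y z a h
    have key : ∀ μ ν : P.obj (Fin 2), P.binary μ (P.binary ν (P.comp x a) y) z =
        P.map (Equiv.sumCongr (sumRightComm A B D) (Equiv.refl C)) (P.map (sumRightComm (A ⊕ B) C D)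
          (P.comp (P.map (optionSum (A ⊕ B) C) (P.map (Equiv.sumCongr (optionSum A B)
            (Equiv.refl C)) (P.binary μ (P.binary ν x y) z))) a)) := by
      intro μ ν
      rw [map_binary, binary_comp_left, map_binary, binary_comp_left, P.map_refl, P.map_refl]
    rw [key, key, h]
  have h2 : ∀ {A B C D : Type} [Finite A] [Finite B] [Finite C] [Finite D] (x : P.obj A)
      (y : P.obj (Option B)) (z : P.obj C) (a : P.obj D),
      P.binary μ (P.binary ν x y) z = P.binary μ' (P.binary ν' x y) z →
      P.binary μ (P.binary ν x (P.comp y a)) z = P.binary μ' (P.binary ν' x (P.comp y a)) z := by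
    intro A B C D _ _ _ _ x y z a h
    have key : ∀ μ ν : P.obj (Fin 2), P.binary μ (P.binary ν x (P.comp y a)) z =
        P.map (Equiv.sumCongr (Equiv.sumAssoc A B D) (Equiv.refl C))
          (P.map (sumRightComm (A ⊕ B) C D)
          (P.comp (P.map (optionSum (A ⊕ B) C) (P.map (Equiv.sumCongr (sumOption A B)
            (Equiv.refl C)) (P.binary μ (P.binary ν x y) z))) a)) := by
      intro μ ν
      rw [map_binary, binary_comp_left, map_binary, binary_comp_right, P.map_refl, P.map_refl]
    rw [key, key, h]
  have h3 : ∀ {A B C D : Type} [Finite A] [Finite B] [Finite C] [Finite D] (x : P.obj A)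
      (y : P.obj B) (z : P.obj (Option C)) (a : P.obj D),
      P.binary μ (P.binary ν x y) z = P.binary μ' (P.binary ν' x y) z →
      P.binary μ (P.binary ν x y) (P.comp z a) = P.binary μ' (P.binary ν' x y) (P.comp z a) := by
    intro A B C D _ _ _ _ x y z a h
    rw [← binary_comp_right, ← binary_comp_right, h]
  have hone : ∀ {A : Type} [Finite A] (x : P.obj A),
      P.map (Equiv.emptySum Empty A) (P.comp (P.map unitOption P.one) x) = x := by
    intro A _ x
    rw [P.one_comp, map_map, P.map_eq_self (by simp)]
  rw [← hone x, ← hone y, ← hone z]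
  refine hmap _ _ _ _ _ _ (h1 _ _ _ _ (h2 _ _ _ _ (h3 _ _ _ _ (hmap _ _ _ _ _ _ ?_))))
  rw [compTwo_eq, compTwo_eq] at h
  exact P.map_injective _ h

end LinOperad

end Ternary

/-! ### Splitting the operations of a variety -/

namespace SetOperad

variable (C : SetOperad) {k : Type u} [Field k] {Ω : Type v} {D : Type} (hd : D ≃ C.obj (Fin 2))

variable (k Ω) in
/-- The morphism that replaces an operation `o` with the sum of the operations `(d, o)`, each
tensored with the corresponding element of the operad in sets. -/
noncomputable def splitFree :
    Hom (freeOperad k Ω) (C.had (freeOperad k (D × Ω))) :=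
  freeLift fun o => ∑ h, C.tmul _ h (gen k (hd.symm h, o))

/-- The identities obtained by splitting the operations in the identities `S`: all coefficients
of the images of these identities under `splitFree`. -/
def dend (S : Identities k Ω) : Identities k (D × Ω) :=
  fun n => {g | ∃ f ∈ S n, ∃ h : C.obj (Fin n),
    g = C.coeff (freeOperad k (D × Ω)) h ((C.splitFree k Ω hd).app (Fin n) f)}

variable (S : Identities k Ω)

/-- The descent of `splitFree` to the operads of the varieties. -/
noncomputable def split : Hom (operadOf S) (C.had (operadOf (C.dend hd S))) :=
  descend ((C.hadHom (proj (C.dend hd S))).comp (C.splitFree k Ω hd)) fun n f hf =>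
    C.had_ext fun h => by
      rw [Hom.comp_app, coeff_hadHom, map_zero]
      exact proj_eq_zero _ ⟨f, hf, h, rfl⟩

theorem split_cls (o : Ω) : (C.split hd S).app (Fin 2) (cls S o) =
    ∑ h, C.tmul _ h (cls (C.dend hd S) (hd.symm h, o)) := by
  rw [cls, split, descend_proj, Hom.comp_app, splitFree, freeLift_gen, map_sum]
  simp only [hadHom_tmul]
  rfl

theorem coeff_split_cls (d : D) (o : Ω) :
    C.coeff _ (hd d) ((C.split hd S).app (Fin 2) (cls S o)) = cls (C.dend hd S) (d, o) := by
  rw [split_cls, map_sum, Finset.sum_eq_single (hd d)]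
  · rw [coeff_tmul_self, hd.symm_apply_apply]
  · intro b _ hb
    rw [coeff_tmul_of_ne _ hb]
  · exact fun h => (h (Finset.mem_univ _)).elim

variable {S} {Q : LinOperad.{u, w} k}

/-- The universal property of the split variety: a morphism from the operad of `S` to the Hadamard
product `C ⊗ Q` is a morphism from the operad of the split variety to `Q`. -/
noncomputable def dendLift (ψ : Hom (operadOf S) (C.had Q)) : Hom (operadOf (C.dend hd S)) Q :=
  descend (freeLift fun p => C.coeff Q (hd p.1) (ψ.app (Fin 2) (cls S p.2))) fun n g hg => by
    obtain ⟨f, hf, h, rfl⟩ := hg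
    set F : Hom (freeOperad k (D × Ω)) Q :=
      freeLift fun p => C.coeff Q (hd p.1) (ψ.app (Fin 2) (cls S p.2)) with hF
    have key : (C.hadHom F).comp (C.splitFree k Ω hd) = ψ.comp (proj S) := by
      refine freeOperad_hom_ext fun o => ?_
      rw [Hom.comp_app, splitFree, freeLift_gen, map_sum]
      simp only [hadHom_tmul, hF, freeLift_gen, Equiv.apply_symm_apply]
      exact C.sum_tmul _
    have h1 := congrArg (fun G : Hom (freeOperad k Ω) (C.had Q) =>
      C.coeff Q h (G.app (Fin n) f)) key
    have h2 : (ψ.comp (proj S)).app (Fin n) f = 0 :=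
      (congrArg (ψ.app (Fin n)) (proj_eq_zero S hf)).trans (map_zero _)
    exact h1.trans ((congrArg _ h2).trans (map_zero _))

theorem dendLift_cls (ψ : Hom (operadOf S) (C.had Q)) (d : D) (o : Ω) :
    (C.dendLift hd ψ).app (Fin 2) (cls (C.dend hd S) (d, o)) =
      C.coeff Q (hd d) (ψ.app (Fin 2) (cls S o)) := by
  rw [dendLift, descend_freeLift_cls]

theorem hadHom_dendLift (ψ : Hom (operadOf S) (C.had Q)) :
    (C.hadHom (C.dendLift hd ψ)).comp (C.split hd S) = ψ := by
  refine operadOf_hom_ext fun o => ?_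
  rw [Hom.comp_app, split_cls, map_sum]
  simp only [hadHom_tmul, dendLift_cls, Equiv.apply_symm_apply]
  exact C.sum_tmul _

theorem dend_hom_ext {F G : Hom (operadOf (C.dend hd S)) Q}
    (h : (C.hadHom F).comp (C.split hd S) = (C.hadHom G).comp (C.split hd S)) : F = G := by
  refine operadOf_hom_ext fun ⟨d, o⟩ => ?_
  have h' := congrArg (fun H : Hom (operadOf S) (C.had Q) =>
    C.coeff Q (hd d) (H.app (Fin 2) (cls S o))) h
  simpa only [Hom.comp_app, coeff_hadHom, coeff_split_cls] using h'

end SetOperad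

/-! ### Relabelling monomials -/

namespace MTree

variable {Ω : Type v} {Ω' : Type w} {A B : Type}

/-- Change of operation symbols in a multilinear monomial. -/
def mapOps (φ : Ω → Ω') (t : MTree Ω A) : MTree Ω' A :=
  ⟨t.1.mapOps φ, t.2.of_leaves_eq (t.1.leaves_mapOps φ)⟩

theorem mapOps_rename (φ : Ω → Ω') (σ : A ≃ B) (t : MTree Ω A) :
    (t.rename σ).mapOps φ = (t.mapOps φ).rename σ :=
  Subtype.ext (MagTree.mapOps_rename φ σ t.1)

theorem mapOps_node (φ : Ω → Ω') (o : Ω) (l : MTree Ω A) (r : MTree Ω B) :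
    (node o l r).mapOps φ = node (φ o) (l.mapOps φ) (r.mapOps φ) :=
  Subtype.ext (congrArg₂ (MagTree.node (φ o)) (MagTree.mapOps_rename φ _ l.1)
    (MagTree.mapOps_rename φ _ r.1))

theorem mapOps_unit (φ : Ω → Ω') : (unit Ω).mapOps φ = unit Ω' := rfl

theorem _root_.KDual.MagTree.exists_rename_of_mapOps_eq (φ : Ω → Ω') (f : A → B)
    (u : MagTree Ω' A) (t : MagTree Ω B) (h : t.mapOps φ = u.rename f) :
    ∃ s : MagTree Ω A, s.rename f = t ∧ s.mapOps φ = u := by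
  induction u generalizing t with
  | leaf a =>
    cases t with
    | leaf b =>
      refine ⟨.leaf a, ?_, rfl⟩
      exact congrArg MagTree.leaf (MagTree.leaf.inj h).symm
    | node o l r => exact absurd h (by simp [MagTree.mapOps, MagTree.rename, MagTree.bind])
  | node o l r ihl ihr =>
    cases t with
    | leaf b => exact absurd h (by simp [MagTree.mapOps, MagTree.rename, MagTree.bind])
    | node o' l' r' =>
      obtain ⟨ho, hl, hr⟩ := MagTree.node.inj h
      obtain ⟨sl, rfl, rfl⟩ := ihl l' hl
      obtain ⟨sr, rfl, rfl⟩ := ihr r' hr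
      exact ⟨.node o' sl sr, rfl, by rw [MagTree.mapOps, ho]⟩

theorem eq_unit_of_mapOps_eq {φ : Ω → Ω'} {t : MTree Ω Unit} (h : t.mapOps φ = unit Ω') :
    t = unit Ω := by
  obtain ⟨t, ht⟩ := t
  cases t with
  | leaf a => rfl
  | node o l r => exact absurd (congrArg Subtype.val h) (by simp [mapOps, MagTree.mapOps, unit])

theorem exists_node_of_mapOps_eq {φ : Ω → Ω'} {o : Ω'} {l : MTree Ω' A} {r : MTree Ω' B}
    {t : MTree Ω (A ⊕ B)} (h : t.mapOps φ = node o l r) :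
    ∃ (p : Ω) (l' : MTree Ω A) (r' : MTree Ω B), t = node p l' r' ∧ φ p = o ∧
      l'.mapOps φ = l ∧ r'.mapOps φ = r := by
  obtain ⟨t, ht⟩ := t
  have h' := congrArg Subtype.val h
  cases t with
  | leaf a => exact absurd h' (by simp [mapOps, MagTree.mapOps, node])
  | node p tl tr =>
    obtain ⟨ho, hl, hr⟩ := MagTree.node.inj h'
    obtain ⟨sl, rfl, hsl⟩ := MagTree.exists_rename_of_mapOps_eq φ _ l.1 tl hl
    obtain ⟨sr, rfl, hsr⟩ := MagTree.exists_rename_of_mapOps_eq φ _ r.1 tr hr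
    refine ⟨p, ⟨sl, l.2.of_leaves_eq ?_⟩, ⟨sr, r.2.of_leaves_eq ?_⟩, rfl, ho, Subtype.ext hsl,
      Subtype.ext hsr⟩
    · rw [← hsl, MagTree.leaves_mapOps]
    · rw [← hsr, MagTree.leaves_mapOps]

end MTree

theorem MTree.nonempty {Ω : Type v} {A : Type} (t : MTree Ω A) : Nonempty A := by
  induction t using MTree.induction with
  | unit => exact ⟨()⟩
  | node o l r ihl ihr => exact ihl.map Sum.inl
  | rename σ t ih => exact ih.map σ

theorem eq_zero_of_isEmpty {k : Type u} [Field k] {Ω : Type v} {A : Type} [Finite A] [IsEmpty A]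
    (f : (freeOperad k Ω).obj A) : f = 0 :=
  Finsupp.ext fun t => (not_isEmpty_of_nonempty A (h := t.nonempty) ‹_›).elim

/-! ### Varieties obtained by marking variables -/

/-- The data that di- and tri-algebras have in common: an operad in sets `C`, whose elements tell
which variables are emphasized, a set `D` of symbols in bijection with the operations of arity two
of `C`, of which `vd` and `dd` ignore their left and right argument, respectively, and a procedure
`dot` that marks the operations of a monomial in accordance with the emphasized variables. -/
structure Marking (C : SetOperad) (D : Type) (Ω : Type v) where
  hd : D ≃ C.obj (Fin 2)
  vd : D
  dd : D
  dot : ∀ {A : Type}, C.obj A → MTree Ω A → MTree (D × Ω) A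
  binary_vd : ∀ {A B : Type} (a a' : C.obj A) (b : C.obj B),
    C.binary (hd vd) a b = C.binary (hd vd) a' b
  binary_dd : ∀ {A B : Type} (a : C.obj A) (b b' : C.obj B),
    C.binary (hd dd) a b = C.binary (hd dd) a b'
  eq_one : ∀ h : C.obj Unit, h = C.one
  exists_binary : ∀ {A B : Type} [Nonempty A] [Nonempty B] (h : C.obj (A ⊕ B)),
    ∃ d a b, h = C.binary (hd d) a b
  exists_comp : ∀ {A B : Type} [Nonempty B] (h : C.obj (A ⊕ B)), ∃ a b, h = C.comp a b
  dot_unit : dot C.one (MTree.unit Ω) = MTree.unit (D × Ω)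
  dot_rename : ∀ {A B : Type} (σ : A ≃ B) (h : C.obj A) (t : MTree Ω A),
    dot (C.map σ h) (t.rename σ) = (dot h t).rename σ
  dot_node : ∀ {A B : Type} (d : D) (o : Ω) (a : C.obj A) (b : C.obj B) (l : MTree Ω A)
    (r : MTree Ω B), ∃ (l' : MTree (D × Ω) A) (r' : MTree (D × Ω) B),
      l'.mapOps Prod.snd = l ∧ r'.mapOps Prod.snd = r ∧
      dot (C.binary (hd d) a b) (MTree.node o l r) = MTree.node (d, o) l' r' ∧
      (d = vd ∨ l' = dot a l) ∧ (d = dd ∨ r' = dot b r)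

theorem leftMonomial_eq {k : Type u} [Field k] {Ω : Type v} (p q : Ω) :
    leftMonomial k p q = (freeOperad k Ω).compTwo (gen k q) (gen k p) := by
  rw [compTwo_eq, ← mono_unit, binary_gen_mono, binary_gen_mono, map_mono]
  rfl

/-- `{*} ⊔ ({*} ⊔ {*})` as a three-point set. -/
def sumUnitThree : Unit ⊕ (Unit ⊕ Unit) ≃ Fin 3 :=
  (Equiv.sumAssoc Unit Unit Unit).symm.trans unitSumThree

theorem rightMonomial_eq {k : Type u} [Field k] {Ω : Type v} (p q : Ω) :
    rightMonomial k p q = (freeOperad k Ω).map sumUnitThree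
      ((freeOperad k Ω).binary (gen k p) (freeOperad k Ω).one
        ((freeOperad k Ω).binary (gen k q) (freeOperad k Ω).one (freeOperad k Ω).one)) := by
  rw [← mono_unit, binary_gen_mono, binary_gen_mono, map_mono]
  rfl

namespace Marking

variable {C : SetOperad} {D : Type} {Ω : Type v} (M : Marking C D Ω) {k : Type u} [Field k]

/-- The linear extension of the marking of monomials. -/
noncomputable def dotHom {A : Type} [Finite A] (h : C.obj A) :
    (freeOperad k Ω).obj A →ₗ[k] (freeOperad k (D × Ω)).obj A :=
  monoLift fun t => mono k (M.dot h t)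

theorem dotHom_mono {A : Type} [Finite A] (h : C.obj A) (t : MTree Ω A) :
    M.dotHom h (mono k t) = mono k (M.dot h t) := monoLift_mono _ _

/-- The identities of the variety obtained from `S` by marking variables. -/
inductive Identity (S : Identities k Ω) : ∀ n : ℕ, MPoly k (D × Ω) (Fin n) → Prop
  | zero_left (s : D) (i j : Ω) : Identity S 3
      (leftMonomial k (s, i) (M.vd, j) - leftMonomial k (M.vd, i) (M.vd, j))
  | zero_right (s : D) (i j : Ω) : Identity S 3
      (rightMonomial k (M.dd, i) (s, j) - rightMonomial k (M.dd, i) (M.dd, j))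
  | dot (n : ℕ) (f : MPoly k Ω (Fin n)) (hf : f ∈ S n) (h : C.obj (Fin n)) :
      Identity S n (M.dotHom h f)

/-- The variety obtained from `S` by marking variables. -/
def var (S : Identities k Ω) : Identities k (D × Ω) := fun n => {g | M.Identity S n g}

variable (k) in
/-- The morphism that forgets the marks of the operations and remembers the emphasized variables. -/
noncomputable def forgetFree : Hom (freeOperad k (D × Ω)) (C.had (freeOperad k Ω)) :=
  freeLift fun p => C.tmul _ (M.hd p.1) (gen k p.2)

theorem forgetFree_gen (p : D × Ω) :
    (M.forgetFree k).app _ (gen k p) = C.tmul _ (M.hd p.1) (gen k p.2) :=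
  freeLift_gen _ _

theorem forgetFree_node {A B : Type} [Finite A] [Finite B] {d : D} {o : Ω}
    {l : MTree (D × Ω) A} {r : MTree (D × Ω) B} {a : C.obj A} {b : C.obj B} {l' : MTree Ω A}
    {r' : MTree Ω B} (hl : (M.forgetFree k).app A (mono k l) = C.tmul _ a (mono k l'))
    (hr : (M.forgetFree k).app B (mono k r) = C.tmul _ b (mono k r')) :
    (M.forgetFree k).app (A ⊕ B) (mono k (MTree.node (d, o) l r)) =
      C.tmul _ (C.binary (M.hd d) a b) (mono k (MTree.node o l' r')) := by
  rw [← binary_gen_mono, Hom.app_binary, hl, hr, forgetFree_gen, C.binary_tmul, binary_gen_mono]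

theorem exists_forgetFree {A : Type} [Finite A] (t : MTree (D × Ω) A) :
    ∃ h, (M.forgetFree k).app A (mono k t) = C.tmul _ h (mono k (t.mapOps Prod.snd)) := by
  revert ‹Finite A›
  induction t using MTree.induction with
  | unit =>
    intro _
    exact ⟨C.one, (M.forgetFree k).app_one⟩
  | node p l r ihl ihr =>
    intro _
    have := l.finite
    have := r.finite
    obtain ⟨a, ha⟩ := ihl
    obtain ⟨b, hb⟩ := ihr
    refine ⟨C.binary (M.hd p.1) a b,
      (M.forgetFree_node (d := p.1) (o := p.2) ha hb).trans ?_⟩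
    rw [MTree.mapOps_node]
  | rename σ t ih =>
    intro _
    have := t.finite
    obtain ⟨h, hh⟩ := ih
    refine ⟨C.map σ h, ?_⟩
    rw [← map_mono, Hom.app_map, hh, C.map_tmul, map_mono, MTree.mapOps_rename]

theorem forgetFree_dot {A : Type} [Finite A] (h : C.obj A) (t : MTree Ω A) :
    (M.forgetFree k).app A (mono k (M.dot h t)) = C.tmul _ h (mono k t) := by
  revert ‹Finite A› h
  induction t using MTree.induction with
  | unit =>
    intro _ h
    rw [M.eq_one h, M.dot_unit]
    exact (M.forgetFree k).app_one
  | node o l r ihl ihr =>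
    intro _ h
    have := l.finite
    have := r.finite
    have := l.nonempty
    have := r.nonempty
    obtain ⟨d, a, b, rfl⟩ := M.exists_binary h
    obtain ⟨l', r', hl, hr, hlr, hl', hr'⟩ := M.dot_node d o a b l r
    rw [hlr]
    obtain ⟨a', ha⟩ := M.exists_forgetFree (k := k) l'
    obtain ⟨b', hb⟩ := M.exists_forgetFree (k := k) r'
    rw [hl] at ha
    rw [hr] at hb
    -- an operation that ignores an argument does not see how the latter is marked
    rcases hl' with rfl | rfl
    · rcases hr' with hr' | rfl
      · rw [M.forgetFree_node ha hb, hr', M.binary_dd a b b', ← hr', M.binary_vd a' a]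
      · rw [M.forgetFree_node ha (ihr b), M.binary_vd a' a]
    · rcases hr' with rfl | rfl
      · rw [M.forgetFree_node (ihl a) hb, M.binary_dd a b' b]
      · rw [M.forgetFree_node (ihl a) (ihr b)]
  | rename σ t ih =>
    intro _ h
    have := t.finite
    rw [← C.map_map_symm σ h, M.dot_rename, ← map_mono, Hom.app_map, ih, C.map_tmul, map_mono]

theorem forgetFree_dotHom {A : Type} [Finite A] (h : C.obj A) (f : (freeOperad k Ω).obj A) :
    (M.forgetFree k).app A (M.dotHom h f) = C.tmul _ h f :=
  LinearMap.congr_fun (f := (M.forgetFree k).app A ∘ₗ M.dotHom h) (g := C.tmul _ h)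
    (freeOperad_ext fun t => by rw [LinearMap.comp_apply, dotHom_mono, forgetFree_dot]) f

variable (S : Identities k Ω)

/-- The morphism from the operad of the marked variety to the Hadamard product. -/
noncomputable def forget : Hom (operadOf (M.var S)) (C.had (operadOf S)) :=
  descend ((C.hadHom (proj S)).comp (M.forgetFree k)) fun n f hf => by
    rw [Hom.comp_app]
    cases (show M.Identity S n f from hf) with
    | zero_left s i j =>
      refine (congrArg _ ?_).trans (map_zero _)
      refine (map_sub ((M.forgetFree k).app (Fin 3)) _ _).trans (sub_eq_zero.2 ?_)
      rw [leftMonomial_eq, leftMonomial_eq, compTwo_eq, compTwo_eq]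
      simp only [Hom.app_map, Hom.app_binary, forgetFree_gen, Hom.app_one, C.one_had,
        C.binary_tmul]
      rw [M.binary_vd]
    | zero_right s i j =>
      refine (congrArg _ ?_).trans (map_zero _)
      refine (map_sub ((M.forgetFree k).app (Fin 3)) _ _).trans (sub_eq_zero.2 ?_)
      rw [rightMonomial_eq, rightMonomial_eq]
      simp only [Hom.app_map, Hom.app_binary, forgetFree_gen, Hom.app_one, C.one_had,
        C.binary_tmul]
      rw [M.binary_dd]
    | dot n f hfS h =>
      refine (congrArg _ (M.forgetFree_dotHom h f)).trans ?_
      exact (C.hadHom_tmul (proj S) h f).trans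
        ((congrArg _ (proj_eq_zero S hfS)).trans (map_zero _))

variable {S}

theorem binary_vd_binary (s : D) (i j : Ω) {A B E : Type} [Finite A] [Finite B] [Finite E]
    (x : (operadOf (M.var S)).obj A) (y : (operadOf (M.var S)).obj B)
    (z : (operadOf (M.var S)).obj E) :
    (operadOf (M.var S)).binary (cls _ (M.vd, j)) ((operadOf (M.var S)).binary (cls _ (s, i)) x y)
        z =
    (operadOf (M.var S)).binary (cls _ (M.vd, j))
      ((operadOf (M.var S)).binary (cls _ (M.vd, i)) x y) z := by
  refine binary_binary_eq_of_compTwo_eq _ ?_ x y z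
  have h : (proj (M.var S)).app (Fin 3)
      (leftMonomial k (s, i) (M.vd, j) - leftMonomial k (M.vd, i) (M.vd, j)) = 0 :=
    proj_eq_zero _ (Identity.zero_left s i j)
  have h' := sub_eq_zero.1 ((map_sub _ _ _).symm.trans h)
  rw [leftMonomial_eq, leftMonomial_eq] at h'
  simp only [compTwo_eq, Hom.app_map, Hom.app_binary, Hom.app_one] at h' ⊢
  exact h'

theorem binary_dd_binary (s : D) (i j : Ω) {A B E : Type} [Finite A] [Finite B] [Finite E]
    (x : (operadOf (M.var S)).obj E) (y : (operadOf (M.var S)).obj A)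
    (z : (operadOf (M.var S)).obj B) :
    (operadOf (M.var S)).binary (cls _ (M.dd, i)) x
        ((operadOf (M.var S)).binary (cls _ (s, j)) y z) =
    (operadOf (M.var S)).binary (cls _ (M.dd, i)) x
      ((operadOf (M.var S)).binary (cls _ (M.dd, j)) y z) := by
  have hswap : ∀ (μ : (operadOf (M.var S)).obj (Fin 2)) {A B : Type} [Finite A] [Finite B]
      (x : (operadOf (M.var S)).obj A) (y : (operadOf (M.var S)).obj B),
      (operadOf (M.var S)).binary μ x y = (operadOf (M.var S)).map (Equiv.sumComm B A)
        ((operadOf (M.var S)).binary ((operadOf (M.var S)).swapTwo μ) y x) := by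
    intro μ A B _ _ x y
    rw [binary_swapTwo, map_map, map_eq_self _ (by rintro (_ | _) <;> rfl)]
  rw [hswap _ x, hswap _ x]
  congr 1
  refine binary_binary_eq_of_compTwo_eq _ ?_ y z x
  have h : (proj (M.var S)).app (Fin 3)
      (rightMonomial k (M.dd, i) (s, j) - rightMonomial k (M.dd, i) (M.dd, j)) = 0 :=
    proj_eq_zero _ (Identity.zero_right s i j)
  have h' := sub_eq_zero.1 ((map_sub _ _ _).symm.trans h)
  rw [rightMonomial_eq, rightMonomial_eq] at h'
  simp only [Hom.app_map, Hom.app_binary, Hom.app_one] at h'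
  have h'' := map_injective _ _ h'
  rw [compTwo_eq, compTwo_eq, binary_swapTwo, binary_swapTwo]
  exact congrArg _ (congrArg _ h'')

/-- The left argument of `⊢` and the right argument of `⊣` do not see the marks of operations. -/
theorem binary_congr_of_mapOps_eq {A : Type} [Finite A] (u : MTree Ω A) :
    ∀ t t' : MTree (D × Ω) A, t.mapOps Prod.snd = u → t'.mapOps Prod.snd = u →
    ∀ {B : Type} [Finite B] (j : Ω) (x : (operadOf (M.var S)).obj B),
      (operadOf (M.var S)).binary (cls _ (M.vd, j)) ((proj (M.var S)).app A (mono k t)) x =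
        (operadOf (M.var S)).binary (cls _ (M.vd, j)) ((proj (M.var S)).app A (mono k t')) x ∧
      (operadOf (M.var S)).binary (cls _ (M.dd, j)) x ((proj (M.var S)).app A (mono k t)) =
        (operadOf (M.var S)).binary (cls _ (M.dd, j)) x ((proj (M.var S)).app A (mono k t')) := by
  revert ‹Finite A›
  induction u using MTree.induction with
  | unit =>
    intro _ t t' ht ht' B _ j x
    rw [MTree.eq_unit_of_mapOps_eq ht, MTree.eq_unit_of_mapOps_eq ht']
    exact ⟨rfl, rfl⟩
  | rename σ u ih =>
    intro _ t t' ht ht' B _ j x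
    have := u.finite
    rw [← MTree.rename_rename_symm σ t, ← MTree.rename_rename_symm σ t'] at *
    rw [MTree.mapOps_rename] at ht ht'
    have hs := ih (t.rename σ.symm) (t'.rename σ.symm)
      (by rw [← MTree.rename_symm_rename σ (MTree.mapOps _ _), ht, MTree.rename_symm_rename])
      (by rw [← MTree.rename_symm_rename σ (MTree.mapOps _ _), ht', MTree.rename_symm_rename]) j x
    have hl : ∀ μ (s : MTree (D × Ω) _), (operadOf (M.var S)).binary μ
        ((proj (M.var S)).app _ (mono k (s.rename σ))) x =
        (operadOf (M.var S)).map (Equiv.sumCongr σ (Equiv.refl B))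
          ((operadOf (M.var S)).binary μ ((proj (M.var S)).app _ (mono k s)) x) := by
      intro μ s
      rw [map_binary, ← map_mono, Hom.app_map, LinOperad.map_refl]
    have hr : ∀ μ (s : MTree (D × Ω) _), (operadOf (M.var S)).binary μ x
        ((proj (M.var S)).app _ (mono k (s.rename σ))) =
        (operadOf (M.var S)).map (Equiv.sumCongr (Equiv.refl B) σ)
          ((operadOf (M.var S)).binary μ x ((proj (M.var S)).app _ (mono k s))) := by
      intro μ s
      rw [map_binary, ← map_mono, Hom.app_map, LinOperad.map_refl]
    rw [hl, hl, hr, hr, hs.1, hs.2]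
    exact ⟨rfl, rfl⟩
  | node o l r ihl ihr =>
    intro _ t t' ht ht' B _ j x
    have := l.finite
    have := r.finite
    obtain ⟨⟨d, p⟩, tl, tr, rfl, rfl, hl, hr⟩ := MTree.exists_node_of_mapOps_eq ht
    obtain ⟨⟨d', p'⟩, tl', tr', rfl, hp, hl', hr'⟩ := MTree.exists_node_of_mapOps_eq ht'
    obtain rfl : p' = p := hp
    have hb : ∀ (d : D) {A B : Type} [Finite A] [Finite B] (l : MTree (D × Ω) A)
        (r : MTree (D × Ω) B), (proj (M.var S)).app _ (mono k (MTree.node (d, p') l r)) =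
          (operadOf (M.var S)).binary (cls _ (d, p')) ((proj (M.var S)).app _ (mono k l))
            ((proj (M.var S)).app _ (mono k r)) := by
      intro d A B _ _ l r
      rw [← binary_gen_mono, Hom.app_binary]
      rfl
    rw [hb, hb]
    constructor
    · rw [binary_vd_binary, M.binary_vd_binary d', (ihl tl tl' hl hl' p' _).1,
        ← M.binary_vd_binary M.dd, (ihr tr tr' hr hr' p' _).2, M.binary_vd_binary M.dd]
    · rw [binary_dd_binary, M.binary_dd_binary d', (ihr tr tr' hr hr' p' _).2,
        ← M.binary_dd_binary M.vd, (ihl tl tl' hl hl' p' _).1, M.binary_dd_binary M.vd]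

/-- Modulo the identities of the marked variety, a monomial is determined by the underlying monomial
and the emphasized variables. -/
theorem exists_proj_eq_proj_dot {A : Type} [Finite A] (t : MTree (D × Ω) A) :
    ∃ h, (M.forgetFree k).app A (mono k t) = C.tmul _ h (mono k (t.mapOps Prod.snd)) ∧
      (proj (M.var S)).app A (mono k t) =
        (proj (M.var S)).app A (mono k (M.dot h (t.mapOps Prod.snd))) := by
  revert ‹Finite A›
  induction t using MTree.induction with
  | unit =>
    intro _
    refine ⟨C.one, (M.forgetFree k).app_one, ?_⟩
    rw [MTree.mapOps_unit, M.dot_unit]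
  | @node A B p l r ihl ihr =>
    intro _
    have := l.finite
    have := r.finite
    obtain ⟨a, ha, hla⟩ := ihl
    obtain ⟨b, hb, hrb⟩ := ihr
    obtain ⟨d, o⟩ := p
    refine ⟨C.binary (M.hd d) a b, (M.forgetFree_node ha hb).trans ?_, ?_⟩
    · rw [MTree.mapOps_node]
    obtain ⟨l', r', hl, hr, hlr, hl', hr'⟩ :=
      M.dot_node d o a b (l.mapOps Prod.snd) (r.mapOps Prod.snd)
    rw [MTree.mapOps_node, hlr, ← binary_gen_mono, ← binary_gen_mono, Hom.app_binary,
      Hom.app_binary]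
    have h1 : (operadOf (M.var S)).binary (B := B) (cls _ (d, o))
        ((proj (M.var S)).app A (mono k l)) =
        (operadOf (M.var S)).binary (cls _ (d, o)) ((proj (M.var S)).app A (mono k l')) := by
      rcases hl' with rfl | rfl
      · exact LinearMap.ext fun x => (M.binary_congr_of_mapOps_eq _ l l' rfl hl o x).1
      · rw [hla]
    refine (LinearMap.congr_fun h1 _).trans ?_
    rcases hr' with rfl | rfl
    · exact (M.binary_congr_of_mapOps_eq _ r r' rfl hr o _).2
    · rw [hrb]
      rfl
  | rename σ t ih =>
    intro _
    have := t.finite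
    obtain ⟨h, hh, hp⟩ := ih
    refine ⟨C.map σ h, ?_, ?_⟩
    · rw [← map_mono, Hom.app_map, hh, C.map_tmul, map_mono, MTree.mapOps_rename]
    · rw [MTree.mapOps_rename, M.dot_rename, ← map_mono, ← map_mono, Hom.app_map, hp, Hom.app_map]

theorem proj_eq_proj_dot {A : Type} [Finite A] {t : MTree (D × Ω) A} {h : C.obj A} {u : MTree Ω A}
    (ht : (M.forgetFree k).app A (mono k t) = C.tmul _ h (mono k u)) :
    (proj (M.var S)).app A (mono k t) = (proj (M.var S)).app A (mono k (M.dot h u)) := by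
  obtain ⟨h', hh, hp⟩ := M.exists_proj_eq_proj_dot (S := S) t
  rw [hh] at ht
  have hne : (mono k (t.mapOps Prod.snd) : (freeOperad k Ω).obj A) ≠ 0 :=
    fun h0 => one_ne_zero (Finsupp.single_eq_zero.1 h0)
  obtain ⟨rfl, h2⟩ | ⟨h1, _⟩ := (Finsupp.single_eq_single_iff _ _ _ _).1 ht
  · rw [hp, mono_injective h2]
  · exact (hne h1).elim

theorem dotHom_map {A B : Type} [Finite A] [Finite B] (σ : A ≃ B) (h : C.obj A)
    (f : (freeOperad k Ω).obj A) : M.dotHom (C.map σ h) ((freeOperad k Ω).map σ f) =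
      (freeOperad k (D × Ω)).map σ (M.dotHom h f) := by
  refine LinearMap.congr_fun (f := M.dotHom (C.map σ h) ∘ₗ (freeOperad k Ω).map σ)
    (g := (freeOperad k (D × Ω)).map σ ∘ₗ M.dotHom h) (freeOperad_ext fun t => ?_) f
  rw [LinearMap.comp_apply, LinearMap.comp_apply, map_mono, dotHom_mono, dotHom_mono, M.dot_rename,
    map_mono]

/-- Modulo the identities of the marked variety, marking is compatible with composition. -/
theorem proj_dotHom_comp {A B : Type} [Finite A] [Finite B] (a : C.obj (Option A)) (b : C.obj B)
    (f : (freeOperad k Ω).obj (Option A)) (g : (freeOperad k Ω).obj B) :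
    (proj (M.var S)).app _ (M.dotHom (C.comp a b) ((freeOperad k Ω).comp f g)) =
      (operadOf (M.var S)).comp ((proj (M.var S)).app _ (M.dotHom a f))
        ((proj (M.var S)).app _ (M.dotHom b g)) := by
  induction f using freeOperad_induction with
  | hzero => simp only [map_zero, LinearMap.zero_apply]
  | hadd f f' hf hf' => simp only [map_add, LinearMap.add_apply, hf, hf']
  | hsmul c t =>
    induction g using freeOperad_induction with
    | hzero => simp only [map_zero]
    | hadd g g' hg hg' => simp only [map_add, hg, hg']
    | hsmul d s =>
      simp only [map_smul, LinearMap.smul_apply, dotHom_mono, comp_mono]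
      rw [← Hom.app_comp, comp_mono]
      congr 2
      refine (M.proj_eq_proj_dot ?_).symm
      rw [← comp_mono, Hom.app_comp, forgetFree_dot, forgetFree_dot, C.comp_tmul, comp_mono]

/-- The multilinear polynomials that are identities of the marked variety whichever variables are
emphasized. -/
noncomputable def dotIdeal (S : Identities k Ω) : OpIdeal (freeOperad k Ω) where
  sub A _ := ⨅ h : C.obj A, LinearMap.ker ((proj (M.var S)).app A ∘ₗ M.dotHom h)
  map_mem {A B} _ _ σ f hf := by
    rw [Submodule.mem_iInf] at hf ⊢
    intro h
    rw [← C.map_map_symm σ h, LinearMap.mem_ker, LinearMap.comp_apply, dotHom_map, Hom.app_map,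
      show (proj (M.var S)).app A (M.dotHom (C.map σ.symm h) f) = 0 from hf _, map_zero]
  comp_left {A B} _ _ f g hf := by
    rw [Submodule.mem_iInf] at hf ⊢
    intro h
    rw [LinearMap.mem_ker, LinearMap.comp_apply]
    cases isEmpty_or_nonempty B
    · rw [eq_zero_of_isEmpty g, map_zero, map_zero, map_zero]
    obtain ⟨a, b, rfl⟩ := M.exists_comp h
    rw [proj_dotHom_comp, show (proj (M.var S)).app _ (M.dotHom a f) = 0 from hf _, map_zero,
      LinearMap.zero_apply]
  comp_right {A B} _ _ f g hg := by
    rw [Submodule.mem_iInf] at hg ⊢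
    intro h
    rw [LinearMap.mem_ker, LinearMap.comp_apply]
    cases isEmpty_or_nonempty B
    · rw [eq_zero_of_isEmpty g, map_zero, map_zero, map_zero]
    obtain ⟨a, b, rfl⟩ := M.exists_comp h
    rw [proj_dotHom_comp, show (proj (M.var S)).app _ (M.dotHom b g) = 0 from hg _, map_zero]

theorem mem_dotIdeal_iff {A : Type} [Finite A] {f : (freeOperad k Ω).obj A} :
    f ∈ (M.dotIdeal S).sub A ↔ ∀ h, (proj (M.var S)).app A (M.dotHom h f) = 0 :=
  Submodule.mem_iInf _

theorem proj_dotHom_eq_zero {A : Type} [Finite A] (h : C.obj A) {f : (freeOperad k Ω).obj A}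
    (hf : (proj S).app A f = 0) : (proj (M.var S)).app A (M.dotHom h f) = 0 := by
  have hJ : ∀ n, ∀ f : (freeOperad k Ω).obj (Fin n), f ∈ S n →
      f ∈ (M.dotIdeal S).sub (Fin n) := by
    intro n f hf
    refine M.mem_dotIdeal_iff.2 fun h => ?_
    have hI : M.dotHom h f ∈ M.var S n := Identity.dot n f hf h
    exact proj_eq_zero (M.var S) hI
  exact M.mem_dotIdeal_iff.1 (idealSpan_le (fun n f hf => hJ n f hf) A
    ((proj_eq_zero_iff S f).1 hf)) h

/-- The operad of the marked variety is the Hadamard product. -/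
noncomputable def varIso (S : Identities k Ω) : Iso (operadOf (M.var S)) (C.had (operadOf S)) :=
  Iso.ofBijective (M.forget S) fun A _ => by
    have hproj : ∀ h : C.obj A, ∀ f, (M.forget S).app A ((proj (M.var S)).app A (M.dotHom h f)) =
        C.tmul _ h ((proj S).app A f) := by
      intro h f
      rw [forget, descend_proj, Hom.comp_app, forgetFree_dotHom, C.hadHom_tmul]
    constructor
    · let s : C.obj A → ((operadOf S).obj A →ₗ[k] (operadOf (M.var S)).obj A) := fun h =>
        (((freeOperad k Ω).idealSpan S).sub A).liftQ ((proj (M.var S)).app A ∘ₗ M.dotHom h)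
          fun f hf => M.proj_dotHom_eq_zero h ((proj_eq_zero_iff S f).2 hf)
      let G : (C.had (operadOf S)).obj A →ₗ[k] (operadOf (M.var S)).obj A := Finsupp.lsum k s
      have hG : ∀ h f, G (C.tmul _ h ((proj S).app A f)) =
          (proj (M.var S)).app A (M.dotHom h f) := fun h f =>
        (Finsupp.sum_single_index (h := fun h x => s h x) (map_zero (s h))).trans rfl
      have hGF : G ∘ₗ (M.forget S).app A ∘ₗ (proj (M.var S)).app A = (proj (M.var S)).app A := by
        refine freeOperad_ext fun t => ?_
        obtain ⟨h, hh, hp⟩ := M.exists_proj_eq_proj_dot (S := S) t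
        simp only [LinearMap.comp_apply]
        rw [forget, descend_proj, Hom.comp_app, hh, C.hadHom_tmul, hG, dotHom_mono, ← hp]
      refine Function.LeftInverse.injective (g := G) fun x => ?_
      obtain ⟨x, rfl⟩ := proj_surjective _ A x
      exact LinearMap.congr_fun hGF x
    · intro y
      rw [← LinearMap.mem_range, ← C.sum_tmul y]
      refine Submodule.sum_mem _ fun h _ => ?_
      obtain ⟨f, hf⟩ := proj_surjective S A (C.coeff _ h y)
      exact ⟨_, (hproj h f).trans (by rw [hf])⟩

end Marking

/-! ### Monomials of degree two and three -/

namespace MagTree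

variable {Ω : Type v} {A : Type}

theorem length_leaves_pos (t : MagTree Ω A) : 0 < t.leaves.length := by
  induction t with
  | leaf a => exact Nat.one_pos
  | node o l r ihl ihr => rw [leaves, List.length_append]; omega

theorem eq_leaf_of_length {t : MagTree Ω A} (h : t.leaves.length = 1) : ∃ a, t = leaf a := by
  cases t with
  | leaf a => exact ⟨a, rfl⟩
  | node o l r =>
    have := l.length_leaves_pos
    have := r.length_leaves_pos
    rw [leaves, List.length_append] at h
    omega

theorem eq_node_of_length_two {t : MagTree Ω A} (h : t.leaves.length = 2) :
    ∃ o a b, t = node o (leaf a) (leaf b) := by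
  cases t with
  | leaf a => exact absurd h (by simp [leaves])
  | node o l r =>
    have := l.length_leaves_pos
    have := r.length_leaves_pos
    rw [leaves, List.length_append] at h
    obtain ⟨a, rfl⟩ := eq_leaf_of_length (t := l) (by omega)
    obtain ⟨b, rfl⟩ := eq_leaf_of_length (t := r) (by omega)
    exact ⟨o, a, b, rfl⟩

theorem IsMultilinear.length_leaves {n : ℕ} {t : MagTree Ω (Fin n)} (ht : t.IsMultilinear) :
    t.leaves.length = n := by
  rw [← List.toFinset_card_of_nodup ht.1,
    show t.leaves.toFinset = Finset.univ from Finset.eq_univ_iff_forall.2 fun a =>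
      List.mem_toFinset.2 (ht.2 a), Finset.card_univ, Fintype.card_fin]

theorem IsMultilinear.eq_of_two {t : MagTree Ω (Fin 2)} (ht : t.IsMultilinear) :
    ∃ o, t = node o (leaf 0) (leaf 1) ∨ t = node o (leaf 1) (leaf 0) := by
  obtain ⟨o, a, b, rfl⟩ := eq_node_of_length_two ht.length_leaves
  have h : a ≠ b := by simpa [leaves] using ht.1
  refine ⟨o, ?_⟩
  fin_cases a <;> fin_cases b <;> simp at h ⊢

theorem IsMultilinear.eq_of_three {t : MagTree Ω (Fin 3)} (ht : t.IsMultilinear) :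
    ∃ (p q : Ω) (σ : (Unit ⊕ Unit) ⊕ Unit ≃ Fin 3),
      t = node p (node q (leaf (σ (.inl (.inl ())))) (leaf (σ (.inl (.inr ())))))
        (leaf (σ (.inr ()))) ∨
      t = node p (leaf (σ (.inr ())))
        (node q (leaf (σ (.inl (.inl ())))) (leaf (σ (.inl (.inr ()))))) := by
  have key : ∀ a b c : Fin 3, a ≠ b → a ≠ c → b ≠ c → ∃ σ : (Unit ⊕ Unit) ⊕ Unit ≃ Fin 3,
      σ (.inl (.inl ())) = a ∧ σ (.inl (.inr ())) = b ∧ σ (.inr ()) = c := by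
    intro a b c hab hac hbc
    let f : (Unit ⊕ Unit) ⊕ Unit → Fin 3 := Sum.elim (Sum.elim (fun _ => a) fun _ => b) fun _ => c
    have hf : Function.Injective f := by
      rintro ((_ | _) | _) ((_ | _) | _) h <;> simp_all [f]
    exact ⟨Equiv.ofBijective f ((Fintype.bijective_iff_injective_and_card f).2 ⟨hf, by simp⟩),
      rfl, rfl, rfl⟩
  have hlen := ht.length_leaves
  cases t with
  | leaf a => exact absurd hlen (by simp [leaves])
  | node p l r =>
    have := l.length_leaves_pos
    have := r.length_leaves_pos
    rw [leaves, List.length_append] at hlen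
    rcases (by omega : l.leaves.length = 1 ∨ r.leaves.length = 1) with h | h
    · obtain ⟨c, rfl⟩ := eq_leaf_of_length h
      obtain ⟨q, a, b, rfl⟩ := eq_node_of_length_two (t := r) (by omega)
      have hn := ht.1
      simp only [leaves, List.cons_append, List.nil_append, List.nodup_cons, List.mem_cons,
        List.not_mem_nil, or_false, not_or] at hn
      obtain ⟨σ, ha, hb, hc⟩ := key a b c hn.2.1 (Ne.symm hn.1.1) (Ne.symm hn.1.2)
      exact ⟨p, q, σ, Or.inr (by rw [ha, hb, hc])⟩
    · obtain ⟨c, rfl⟩ := eq_leaf_of_length h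
      obtain ⟨q, a, b, rfl⟩ := eq_node_of_length_two (t := l) (by omega)
      have hn := ht.1
      simp only [leaves, List.cons_append, List.nil_append, List.nodup_cons, List.mem_cons,
        List.not_mem_nil, or_false, not_or] at hn
      obtain ⟨σ, ha, hb, hc⟩ := key a b c hn.1.1 hn.1.2 hn.2.1
      exact ⟨p, q, σ, Or.inl (by rw [ha, hb, hc])⟩

end MagTree

section Evaluation

variable {k : Type u} [Field k]

theorem LinOperad.compTwo_swapTwo (P : LinOperad.{u, w} k) (μ ν : P.obj (Fin 2)) :
    P.compTwo μ (P.swapTwo ν) = P.map (Equiv.swap 0 1) (P.compTwo μ ν) := by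
  have h : P.binary μ (P.map (Equiv.sumComm Unit Unit) (P.binary ν P.one P.one)) P.one =
      P.map (Equiv.sumCongr (Equiv.sumComm Unit Unit) (Equiv.refl Unit))
        (P.binary μ (P.binary ν P.one P.one) P.one) := by
    rw [P.map_binary, P.map_refl]
  rw [compTwo_eq, compTwo_eq, binary_swapTwo, h, map_map, map_map]
  refine P.map_congr ?_ _
  rintro ((_ | _) | _) <;> rfl

theorem swapTwo_swapTwo (P : LinOperad.{u, w} k) (μ : P.obj (Fin 2)) :
    P.swapTwo (P.swapTwo μ) = μ := by
  rw [swapTwo, map_map, map_eq_self _ (by simp)]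

variable {E : Type w'} [AddCommGroup E] [Module k E] {τ : E →ₗ[k] E} {Q : LinOperad.{u, w} k}
  (φ : E →ₗ[k] Q.obj (Fin 2))

theorem eval_two (hφ : ∀ e, φ (τ e) = Q.swapTwo (φ e)) (t : MTree E (Fin 2)) :
    t.eval φ = φ (coordTwo τ t.1) := by
  have h0 : ∀ (o : E) (σ : Unit ⊕ Unit ≃ Fin 2) (t : MTree E (Fin 2)),
      t.1 = .node o (.leaf (σ (.inl ()))) (.leaf (σ (.inr ()))) →
      t.eval φ = Q.map σ (Q.binary (φ o) Q.one Q.one) := by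
    intro o σ t ht
    rw [show t = (MTree.node o (MTree.unit E) (MTree.unit E)).rename σ from Subtype.ext ht,
      MTree.eval_rename, MTree.eval_node, MTree.eval_unit]
  obtain ⟨o, ht | ht⟩ := t.2.eq_of_two
  · rw [h0 o unitSumUnit t ht, binary_one_one, ht, coordTwo, if_pos rfl]
  · rw [h0 o (unitSumUnit.trans (Equiv.swap 0 1)) t ht, ← map_map, binary_one_one, ht, coordTwo,
      if_neg (by decide), hφ]
    rfl

theorem eval_three (hφ : ∀ e, φ (τ e) = Q.swapTwo (φ e)) (t : MTree E (Fin 3)) :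
    t.eval φ = Q.map (Equiv.addRight ((coordThree τ t.1).1 + 1))
      (Q.compTwo (φ (coordThree τ t.1).2.1) (φ (coordThree τ t.1).2.2)) := by
  have key : ∀ (σ : (Unit ⊕ Unit) ⊕ Unit ≃ Fin 3) (μ ν : E),
      Q.map σ (Q.binary (φ μ) (Q.binary (φ ν) Q.one Q.one) Q.one) =
      Q.map (Equiv.addRight (σ (.inr ()) + 1)) (Q.compTwo (φ μ)
        (φ (if σ (.inl (.inr ())) = σ (.inl (.inl ())) + 1 then ν else τ ν))) := by
    intro σ μ ν
    have h1 : σ (.inl (.inl ())) ≠ σ (.inl (.inr ())) := by simp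
    have h2 : σ (.inl (.inl ())) ≠ σ (.inr ()) := by simp
    have h3 : σ (.inl (.inr ())) ≠ σ (.inr ()) := by simp
    have hσ : ∀ x, σ x = Sum.elim (Sum.elim (fun _ => σ (.inl (.inl ()))) fun _ =>
        σ (.inl (.inr ()))) (fun _ => σ (.inr ())) x := by
      rintro ((_ | _) | _) <;> rfl
    split_ifs with h
    · rw [compTwo_eq, map_map]
      refine Q.map_congr (fun x => ?_) _
      rw [hσ x]
      revert h h1 h2 h3
      generalize σ (.inl (.inl ())) = a
      generalize σ (.inl (.inr ())) = b
      generalize σ (.inr ()) = c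
      revert a b c x
      decide
    · rw [hφ, compTwo_swapTwo, compTwo_eq, map_map, map_map]
      refine Q.map_congr (fun x => ?_) _
      rw [hσ x]
      revert h h1 h2 h3
      generalize σ (.inl (.inl ())) = a
      generalize σ (.inl (.inr ())) = b
      generalize σ (.inr ()) = c
      revert a b c x
      decide
  obtain ⟨μ, ν, σ, ht | ht⟩ := t.2.eq_of_three
  · rw [show t = (MTree.node μ (MTree.node ν (MTree.unit E) (MTree.unit E)) (MTree.unit E)).rename σ
      from Subtype.ext ht, MTree.eval_rename, MTree.eval_node, MTree.eval_node,
      MTree.eval_unit, key]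
    rfl
  · rw [show t = (MTree.node μ (MTree.unit E) (MTree.node ν (MTree.unit E)
      (MTree.unit E))).rename ((Equiv.sumComm Unit (Unit ⊕ Unit)).trans σ) from Subtype.ext ht,
      MTree.eval_rename, MTree.eval_node, MTree.eval_node, MTree.eval_unit, ← map_map,
      ← binary_swapTwo, ← hφ, key]
    rfl

theorem freeLift_two (hφ : ∀ e, φ (τ e) = Q.swapTwo (φ e)) (f : (freeOperad k E).obj (Fin 2)) :
    (freeLift φ).app (Fin 2) f =
      φ (Finsupp.linearCombination k (fun t : MTree E (Fin 2) => coordTwo τ t.1) f) := by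
  refine LinearMap.congr_fun (f := (freeLift φ).app (Fin 2))
    (g := φ ∘ₗ monoLift fun t : MTree E (Fin 2) => coordTwo τ t.1)
    (freeOperad_ext fun t => ?_) f
  rw [freeLift_mono, LinearMap.comp_apply, monoLift_mono, eval_two φ hφ]

end Evaluation

/-! ### Quadratic operads -/

section Quadratic

variable {k : Type u} [Field k] {E : Type w'} [AddCommGroup E] [Module k E] {τ : E →ₗ[k] E}
  {R : Set (MPoly k E (Fin 3))} {Q : LinOperad.{u, w} k}

variable (τ R) in
/-- The identities that define a quadratic operad. -/
def quadIdentities : Identities k E := fun n => match n with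
  | 2 => moduleIdentities τ
  | 3 => R
  | _ => ∅

variable (τ R) in
/-- The generators of a quadratic operad. -/
noncomputable def quadGen : E →ₗ[k] (quadraticOperad τ R).obj (Fin 2) where
  toFun e := cls (quadIdentities τ R) e
  map_add' e e' := by
    have h : (gen k (e + e') - (gen k e + gen k e') : (freeOperad k E).obj (Fin 2)) ∈
        quadIdentities τ R 2 := by
      change Finsupp.linearCombination k (fun t : MTree E (Fin 2) => coordTwo τ t.1) _ = 0
      refine (map_sub (monoLift (k := k) fun t : MTree E (Fin 2) => coordTwo τ t.1) _ _).trans ?_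
      rw [map_add, gen, gen, gen, monoLift_mono, monoLift_mono, monoLift_mono]
      exact sub_self _
    have h' := proj_eq_zero _ h
    rw [map_sub, map_add, sub_eq_zero] at h'
    exact h'
  map_smul' c e := by
    have h : (gen k (c • e) - c • gen k e : (freeOperad k E).obj (Fin 2)) ∈
        quadIdentities τ R 2 := by
      change Finsupp.linearCombination k (fun t : MTree E (Fin 2) => coordTwo τ t.1) _ = 0
      refine (map_sub (monoLift (k := k) fun t : MTree E (Fin 2) => coordTwo τ t.1) _ _).trans ?_
      rw [map_smul, gen, gen, monoLift_mono, monoLift_mono]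
      exact sub_self _
    have h' := proj_eq_zero _ h
    rw [map_sub, map_smul, sub_eq_zero] at h'
    exact h'

theorem quadGen_tau (e : E) :
    quadGen τ R (τ e) = (quadraticOperad τ R).swapTwo (quadGen τ R e) := by
  have h : (gen k (τ e) - (freeOperad k E).map (Equiv.swap 0 1) (gen k e) :
      (freeOperad k E).obj (Fin 2)) ∈ quadIdentities τ R 2 := by
    change Finsupp.linearCombination k (fun t : MTree E (Fin 2) => coordTwo τ t.1) _ = 0
    refine (map_sub (monoLift (k := k) fun t : MTree E (Fin 2) => coordTwo τ t.1) _ _).trans ?_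
    rw [gen, gen, map_mono, monoLift_mono, monoLift_mono]
    exact sub_self _
  have h' := proj_eq_zero _ h
  rw [map_sub, sub_eq_zero, Hom.app_map] at h'
  exact h'

/-- A morphism from a quadratic operad is an equivariant linear map on the generators that
annihilates the relations. -/
noncomputable def quadLift (φ : E →ₗ[k] Q.obj (Fin 2)) (hφ : ∀ e, φ (τ e) = Q.swapTwo (φ e))
    (hR : ∀ f : (freeOperad k E).obj (Fin 3), f ∈ R → (freeLift φ).app (Fin 3) f = 0) :
    Hom (quadraticOperad τ R) Q :=
  descend (S := quadIdentities τ R) (freeLift φ) fun n f hf => by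
    match n, f, hf with
    | 2, f, hf =>
      rw [freeLift_two φ hφ]
      exact (congrArg φ hf).trans (map_zero φ)
    | 3, f, hf => exact hR f hf

theorem quadLift_quadGen (φ : E →ₗ[k] Q.obj (Fin 2)) (hφ : ∀ e, φ (τ e) = Q.swapTwo (φ e))
    (hR : ∀ f : (freeOperad k E).obj (Fin 3), f ∈ R → (freeLift φ).app (Fin 3) f = 0) (e : E) :
    (quadLift φ hφ hR).app (Fin 2) (quadGen τ R e) = φ e :=
  descend_freeLift_cls _ _ e

theorem quad_hom_ext {F G : Hom (quadraticOperad τ R) Q}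
    (h : ∀ e, F.app (Fin 2) (quadGen τ R e) = G.app (Fin 2) (quadGen τ R e)) : F = G :=
  operadOf_hom_ext (S := quadIdentities τ R) h

/-- The projection of the free operad onto a quadratic operad is induced by `quadGen`. -/
theorem freeLift_quadGen {A : Type} [Finite A] (f : (freeOperad k E).obj A) :
    (freeLift (quadGen τ R)).app A f = (proj (quadIdentities τ R)).app A f :=
  congrArg (fun F : Hom (freeOperad k E) (quadraticOperad τ R) => F.app A f)
    (freeOperad_hom_ext fun o => freeLift_gen _ o)

theorem freeLift_quadGen_eq_zero {f : (freeOperad k E).obj (Fin 3)} (hf : f ∈ R) :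
    (freeLift (quadGen τ R)).app (Fin 3) f = 0 :=
  (freeLift_quadGen f).trans (proj_eq_zero (quadIdentities τ R) (n := 3) hf)

theorem mem_quadRel_iff (P : LinOperad.{u, w} k) (f : (freeOperad k (P.obj (Fin 2))).obj (Fin 3)) :
    f ∈ P.quadRel ↔ (freeLift (Q := P) fun e => e).app (Fin 3) f = 0 := by
  have h : (freeLift (Q := P) fun e => e).app (Fin 3) =
      monoLift (k := k) fun t : MTree (P.obj (Fin 2)) (Fin 3) => P.evalThree t.1 := by
    refine freeOperad_ext fun t => ?_
    rw [freeLift_mono, monoLift_mono]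
    exact eval_three (τ := P.swapTwo) LinearMap.id (fun _ => rfl) t
  rw [h]
  rfl

theorem LinOperad.IsBinaryQuadratic.of_iso {P P' : LinOperad.{u, w} k} (e : Iso P P')
    (h : P'.IsBinaryQuadratic) : P.IsBinaryQuadratic := by
  obtain ⟨E, _, _, τ, R, hτ, ⟨e'⟩⟩ := h
  exact ⟨E, _, _, τ, R, hτ, ⟨e.trans e'⟩⟩

/-- The operad of a variety defined by identities of degrees two and three is binary quadratic. -/
theorem isBinaryQuadratic_operadOf {Ω : Type v} (S : Identities k Ω)
    (hS : ∀ n, ∀ f ∈ S n, n = 2 ∨ n = 3) : (operadOf S).IsBinaryQuadratic := by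
  set P := operadOf S with hP
  refine ⟨P.obj (Fin 2), _, _, P.swapTwo, P.quadRel, swapTwo_swapTwo P, ⟨?_⟩⟩
  -- the relations of arity two and three are exactly the kernel of the evaluation in `P`
  have hproj : (proj S) = (freeLift (Q := P) fun e => e).comp
      (freeLift fun o => gen k (cls S o)) := by
    refine freeOperad_hom_ext fun o => ?_
    rw [Hom.comp_app, freeLift_gen, freeLift_gen]
    rfl
  have hker : ∀ n, n = 2 ∨ n = 3 → ∀ f : (freeOperad k (P.obj (Fin 2))).obj (Fin n),
      (freeLift (Q := P) fun e => e).app (Fin n) f = 0 →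
      (proj (quadIdentities P.swapTwo P.quadRel)).app (Fin n) f = 0 := by
    rintro n (rfl | rfl) f hf
    · refine proj_eq_zero (quadIdentities P.swapTwo P.quadRel) (n := 2) ?_
      exact (freeLift_two (τ := P.swapTwo) (Q := P) LinearMap.id (fun _ => rfl) f).symm.trans hf
    · exact proj_eq_zero (quadIdentities P.swapTwo P.quadRel) (n := 3)
        ((mem_quadRel_iff P f).2 hf)
  let F : Hom P (quadraticOperad P.swapTwo P.quadRel) :=
    descend ((proj (quadIdentities P.swapTwo P.quadRel)).comp
      (freeLift fun o => gen k (cls S o))) fun n f hf =>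
        hker n (hS n f hf) _ ((congrArg (fun H : Hom (freeOperad k Ω) P => H.app (Fin n) f)
          hproj).symm.trans (proj_eq_zero S hf))
  let G : Hom (quadraticOperad P.swapTwo P.quadRel) P :=
    quadLift LinearMap.id (fun _ => rfl) fun f hf => (mem_quadRel_iff P f).1 hf
  have hG : ∀ {A : Type} [Finite A] (f : (freeOperad k (P.obj (Fin 2))).obj A),
      G.app A ((proj (quadIdentities P.swapTwo P.quadRel)).app A f) =
        (freeLift (Q := P) fun e => e).app A f := fun f => rfl
  have hF : ∀ {A : Type} [Finite A] (f : (freeOperad k Ω).obj A), F.app A ((proj S).app A f) =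
      (proj (quadIdentities P.swapTwo P.quadRel)).app A
        ((freeLift fun o => gen k (cls S o)).app A f) := fun f => rfl
  refine Iso.ofHoms F G (operadOf_hom_ext fun o => ?_) (quad_hom_ext fun e => ?_)
  · rw [Hom.comp_app, cls, hF, hG, freeLift_gen, freeLift_gen]
    rfl
  · obtain ⟨f, hf⟩ := proj_surjective S (Fin 2) e
    have h1 : G.app (Fin 2) (quadGen P.swapTwo P.quadRel e) = e :=
      quadLift_quadGen (Q := P) LinearMap.id _ _ e
    rw [Hom.comp_app, h1, Hom.id_app, ← sub_eq_zero]
    have h2 := hker 2 (Or.inl rfl) ((freeLift fun o => gen k (cls S o)).app (Fin 2) f - gen k e)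
      (by
        rw [map_sub, freeLift_gen, sub_eq_zero]
        exact (congrArg (fun H : Hom (freeOperad k Ω) P => H.app (Fin 2) f) hproj).symm.trans hf)
    rw [map_sub] at h2
    refine Eq.trans ?_ h2
    rw [← hF, hf]
    rfl

end Quadratic

/-! ### Orthogonality in coordinates -/

section Annihilator

variable {k : Type u} [Field k] {X Z I : Type} [Fintype X] [Fintype Z]
  {V : Type w} [AddCommGroup V] [Module k V] {W : Type w'} [AddCommGroup W] [Module k W]

/-- The functional with coordinates `y` annihilates the linear relations between the vectors
`m x`. -/
def Annihilates (m : X → V) (y : X → k) : Prop :=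
  ∀ a : X → k, ∑ x, a x • m x = 0 → ∑ x, y x * a x = 0

theorem Annihilates.eq_of_eq {m : X → V} {y : X → k} (h : Annihilates m y) {x x' : X}
    (hm : m x = m x') : y x = y x' := by
  classical
  have := h (Pi.single x 1 - Pi.single x' 1) (by
    simp [sub_smul, Finset.sum_sub_distrib, Pi.single_apply, hm])
  simpa [mul_sub, Finset.sum_sub_distrib, Pi.single_apply, sub_eq_zero] using this

theorem Annihilates.comp {m : X → V} {n : Z → W} {y : Z → k} (h : Annihilates n y) (s : X → Z)
    (t : V →ₗ[k] W) (hs : ∀ x, n (s x) = t (m x)) : Annihilates m (y ∘ s) := by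
  classical
  intro a ha
  have h1 := h (fun z => ∑ x, if s x = z then a x else 0) (by
    simp only [Finset.sum_smul, ite_smul, zero_smul]
    rw [Finset.sum_comm]
    simp only [Finset.sum_ite_eq, Finset.mem_univ, if_true, hs, ← map_smul, ← map_sum, ha,
      map_zero])
  simp only [Finset.mul_sum, mul_ite, mul_zero] at h1
  rw [Finset.sum_comm] at h1
  simpa only [Finset.sum_ite_eq, Finset.mem_univ, if_true, Function.comp_apply] using h1

open Classical in
theorem Annihilates.lift {m : X → V} {n : Z → W} {y : X → k} (h : Annihilates m y) (p : Z → X)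
    (Θ : Z → I) (i : I) (r : W →ₗ[k] V) (hr : ∀ z, r (n z) = if Θ z = i then m (p z) else 0) :
    Annihilates n fun z => if Θ z = i then y (p z) else 0 := by
  intro a ha
  have h1 := h (fun x => ∑ z, if p z = x then if Θ z = i then a z else 0 else 0) (by
    have h2 := congrArg r ha
    rw [map_zero, map_sum] at h2
    rw [← h2]
    simp only [Finset.sum_smul, ite_smul, zero_smul]
    rw [Finset.sum_comm]
    simp only [Finset.sum_ite_eq, Finset.mem_univ, if_true, map_smul, hr, smul_ite, smul_zero])
  refine Eq.trans ?_ h1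
  simp only [Finset.mul_sum, mul_ite, mul_zero]
  rw [Finset.sum_comm]
  simp only [Finset.sum_ite_eq, Finset.mem_univ, if_true, ite_mul, zero_mul]

end Annihilator

section Coordinates

variable {k : Type u} [Field k] {ι : Type} {V : Type w'} [AddCommGroup V] [Module k V]
  (b : Module.Basis ι k V) (τ : V →ₗ[k] V) {Q : LinOperad.{u, w} k}

/-- The bilinear extension of `compTwo`, followed by the cyclic permutation that puts the variable
`c` in the last place. -/
def LinOperad.rotComp (Q : LinOperad.{u, w} k) (c : Fin 3) :
    Q.obj (Fin 2) →ₗ[k] Q.obj (Fin 2) →ₗ[k] Q.obj (Fin 3) :=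
  LinearMap.mk₂ k (fun μ ν => Q.map (Equiv.addRight (c + 1)) (Q.compTwo μ ν))
    (by simp [compTwo]) (by simp [compTwo]) (by simp [compTwo]) (by simp [compTwo])

theorem LinOperad.rotComp_apply (c : Fin 3) (μ ν : Q.obj (Fin 2)) :
    Q.rotComp c μ ν = Q.map (Equiv.addRight (c + 1)) (Q.compTwo μ ν) := rfl

theorem Hom.app_rotComp {P : LinOperad.{u, w'} k} (F : Hom P Q) (c : Fin 3)
    (μ ν : P.obj (Fin 2)) :
    F.app (Fin 3) (P.rotComp c μ ν) = Q.rotComp c (F.app _ μ) (F.app _ ν) := by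
  simp only [rotComp_apply, compTwo, F.app_map, F.app_comp]

open Classical in
/-- The coordinates of an element of `F_V(3)` with respect to a basis of `V`. -/
noncomputable def coords :
    (freeOperad k V).obj (Fin 3) →ₗ[k] (Fin 3 × ι × ι → k) :=
  monoLift fun t x => if (coordThree τ t.1).1 = x.1 then
    b.repr (coordThree τ t.1).2.1 x.2.1 * b.repr (coordThree τ t.1).2.2 x.2.2 else 0

open Classical in
theorem coords_mono (t : MTree V (Fin 3)) (x : Fin 3 × ι × ι) :
    coords b τ (mono k t) x = if (coordThree τ t.1).1 = x.1 then
      b.repr (coordThree τ t.1).2.1 x.2.1 * b.repr (coordThree τ t.1).2.2 x.2.2 else 0 :=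
  congrFun (monoLift_mono _ _) x

variable [Fintype ι]

theorem freeLift_three (φ : V →ₗ[k] Q.obj (Fin 2)) (hφ : ∀ e, φ (τ e) = Q.swapTwo (φ e))
    (f : (freeOperad k V).obj (Fin 3)) :
    (freeLift φ).app (Fin 3) f =
      ∑ x, coords b τ f x • Q.rotComp x.1 (φ (b x.2.1)) (φ (b x.2.2)) := by
  refine LinearMap.congr_fun (f := (freeLift φ).app (Fin 3))
    (g := ∑ x, ((LinearMap.proj x : (Fin 3 × ι × ι → k) →ₗ[k] k) ∘ₗ coords b τ).smulRight
      (Q.rotComp x.1 (φ (b x.2.1)) (φ (b x.2.2)))) (freeOperad_ext fun t => ?_) f |>.trans ?_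
  · rw [freeLift_mono, eval_three φ hφ, ← rotComp_apply]
    simp only [LinearMap.sum_apply, LinearMap.smulRight_apply, LinearMap.comp_apply,
      LinearMap.proj_apply, coords_mono]
    generalize coordThree τ t.1 = s
    obtain ⟨c, μ, ν⟩ := s
    rw [Fintype.sum_prod_type, Finset.sum_eq_single c]
    · conv_lhs => rw [← b.sum_repr μ, ← b.sum_repr ν]
      simp only [map_sum, map_smul, LinearMap.sum_apply, LinearMap.smul_apply, if_true,
        Fintype.sum_prod_type, Finset.smul_sum, smul_smul]
      rw [Finset.sum_comm]
      exact Finset.sum_congr rfl fun i _ => Finset.sum_congr rfl fun j _ => by rw [mul_comm]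
    · intro c' _ hc
      simp [Ne.symm hc]
    · simp
  · simp [LinearMap.sum_apply]

theorem coords_surjective (a : Fin 3 × ι × ι → k) :
    ∃ f : (freeOperad k V).obj (Fin 3), coords b τ f = a := by
  classical
  let T : Fin 3 × ι × ι → MTree V (Fin 3) := fun x =>
    ⟨.node (b x.2.1) (.node (b x.2.2) (.leaf (x.1 + 1)) (.leaf (x.1 + 2))) (.leaf x.1), by
      simp only [MagTree.IsMultilinear, MagTree.leaves]
      generalize x.1 = c
      revert c
      decide⟩
  refine ⟨∑ x, a x • mono k (T x), ?_⟩
  have hT : ∀ x, coords b τ (mono k (T x)) = Pi.single x 1 := by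
    rintro ⟨c, i, j⟩
    funext ⟨c', i', j'⟩
    have hc : c + 2 = c + 1 + 1 := by revert c; decide
    have hx : coordThree τ (T (c, i, j)).1 = (c, b i, b j) := by
      change ((c, b i, if c + 2 = c + 1 + 1 then b j else τ (b j)) : Fin 3 × V × V) = _
      rw [if_pos hc]
    rw [coords_mono, hx]
    simp only [Module.Basis.repr_self, Finsupp.single_apply, Pi.single_apply, Prod.mk.injEq]
    clear hx hc
    split_ifs <;> simp_all
  rw [map_sum]
  simp only [map_smul, hT]
  funext x
  simp [Finset.sum_apply, Pi.single_apply]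

variable [DecidableEq ι]

theorem pairing_eq (g : (freeOperad k (Module.Dual k V)).obj (Fin 3))
    (f : (freeOperad k V).obj (Fin 3)) :
    pairing τ g f = ∑ x, coords b.dualBasis (dualSwap τ) g x * coords b τ f x := by
  let B : (freeOperad k (Module.Dual k V)).obj (Fin 3) →ₗ[k] (freeOperad k V).obj (Fin 3) →ₗ[k] k :=
    monoLift fun g => monoLift fun f => treePairing τ g.1 f.1
  have hB : ∀ s t, B (mono k s) (mono k t) = treePairing τ s.1 t.1 := fun s t => by
    simp only [B, monoLift_mono]
  refine LinearMap.congr_fun (LinearMap.congr_fun (f := B)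
    (g := ∑ x, (LinearMap.mul k k).compl₁₂
      ((LinearMap.proj x : (Fin 3 × ι × ι → k) →ₗ[k] k) ∘ₗ coords b.dualBasis (dualSwap τ))
      ((LinearMap.proj x : (Fin 3 × ι × ι → k) →ₗ[k] k) ∘ₗ coords b τ))
    (freeOperad_ext fun s => freeOperad_ext fun t => ?_) g) f |>.trans ?_
  · rw [hB]
    simp only [LinearMap.sum_apply, LinearMap.compl₁₂_apply, LinearMap.mul_apply',
      LinearMap.comp_apply, LinearMap.proj_apply, coords_mono, treePairing]
    generalize coordThree (dualSwap τ) s.1 = s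
    generalize coordThree τ t.1 = t
    obtain ⟨c, ξ, η⟩ := s
    obtain ⟨c', μ, ν⟩ := t
    rw [Fintype.sum_prod_type, Finset.sum_eq_single c]
    · by_cases hc : c = c'
      · subst hc
        simp only [if_true, Fintype.sum_prod_type, Module.Basis.dualBasis_repr]
        conv_lhs => rw [← b.sum_repr μ, ← b.sum_repr ν]
        simp only [map_sum, map_smul, smul_eq_mul, Finset.sum_mul_sum]
        refine Finset.sum_congr rfl fun i _ => Finset.sum_congr rfl fun j _ => by ring
      · simp [hc, Ne.symm hc]
    · intro d _ hd
      simp [Ne.symm hd]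
    · simp
  · simp only [LinearMap.sum_apply, LinearMap.compl₁₂_apply, LinearMap.mul_apply',
      LinearMap.comp_apply, LinearMap.proj_apply]

/-- A polynomial is orthogonal to the relations of `P` if and only if its coordinates annihilate
the linear relations between the compositions of basic operations in `P`. -/
theorem mem_orthogonalRel_iff (P : LinOperad.{u, w} k) (b : Module.Basis ι k (P.obj (Fin 2)))
    (g : (freeOperad k (Module.Dual k (P.obj (Fin 2)))).obj (Fin 3)) :
    g ∈ orthogonalRel P.swapTwo P.quadRel ↔
      Annihilates (fun x : Fin 3 × ι × ι => P.rotComp x.1 (b x.2.1) (b x.2.2))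
        (coords b.dualBasis (dualSwap P.swapTwo) g) := by
  have h1 : ∀ f : (freeOperad k (P.obj (Fin 2))).obj (Fin 3), f ∈ P.quadRel ↔
      ∑ x, coords b P.swapTwo f x • P.rotComp x.1 (b x.2.1) (b x.2.2) = 0 := by
    intro f
    rw [mem_quadRel_iff]
    exact Iff.of_eq (congrArg (· = 0)
      (freeLift_three b P.swapTwo (Q := P) LinearMap.id (fun _ => rfl) f))
  constructor
  · intro hg a ha
    obtain ⟨f, rfl⟩ := coords_surjective b P.swapTwo a
    rw [← pairing_eq]
    exact hg f ((h1 f).2 ha)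
  · intro hg f hf
    exact (pairing_eq b P.swapTwo g f).trans (hg _ ((h1 f).1 hf))

end Coordinates

/-! ### The Koszul dual of a Hadamard product -/

section KoszulDual

variable {k : Type u} [Field k] (P : LinOperad.{u, w} k) {Q : LinOperad.{u, w'} k}

/-- The generators of the Koszul dual operad. -/
noncomputable def LinOperad.dualGen :
    Module.Dual k (P.obj (Fin 2)) →ₗ[k] P.koszulDual.obj (Fin 2) :=
  quadGen (dualSwap P.swapTwo) (orthogonalRel P.swapTwo P.quadRel)

theorem LinOperad.dualGen_dualSwap (ξ : Module.Dual k (P.obj (Fin 2))) :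
    P.dualGen (dualSwap P.swapTwo ξ) = P.koszulDual.swapTwo (P.dualGen ξ) :=
  quadGen_tau (τ := dualSwap P.swapTwo) ξ

variable {P}

theorem freeLift_dualGen_eq_zero
    {f : (freeOperad k (Module.Dual k (P.obj (Fin 2)))).obj (Fin 3)}
    (hf : f ∈ orthogonalRel P.swapTwo P.quadRel) : (freeLift P.dualGen).app (Fin 3) f = 0 :=
  freeLift_quadGen_eq_zero (τ := dualSwap P.swapTwo) hf

theorem dual_hom_ext {F G : Hom P.koszulDual Q}
    (h : ∀ ξ, F.app (Fin 2) (P.dualGen ξ) = G.app (Fin 2) (P.dualGen ξ)) : F = G :=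
  quad_hom_ext (τ := dualSwap P.swapTwo) h

theorem exists_dual_hom (φ : Module.Dual k (P.obj (Fin 2)) →ₗ[k] Q.obj (Fin 2))
    (hφ : ∀ ξ, φ (dualSwap P.swapTwo ξ) = Q.swapTwo (φ ξ))
    (hR : ∀ f : (freeOperad k (Module.Dual k (P.obj (Fin 2)))).obj (Fin 3),
      f ∈ orthogonalRel P.swapTwo P.quadRel → (freeLift φ).app (Fin 3) f = 0) :
    ∃ F : Hom P.koszulDual Q, ∀ ξ, F.app (Fin 2) (P.dualGen ξ) = φ ξ :=
  ⟨quadLift φ hφ hR, quadLift_quadGen φ hφ hR⟩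

end KoszulDual

section Koszul

variable (C : SetOperad) {k : Type u} [Field k]

namespace SetOperad

/-- The counterpart of `LinOperad.rotComp` for operads in sets. -/
def rotComp (c : Fin 3) (h h' : C.obj (Fin 2)) : C.obj (Fin 3) :=
  C.map (Equiv.addRight (c + 1)) (C.map unitSumFinTwo (C.comp (C.map finTwoOption h) h'))

variable {Q : LinOperad.{u, w} k}

theorem rotComp_tmul (c : Fin 3) (h h' : C.obj (Fin 2)) (x y : Q.obj (Fin 2)) :
    (C.had Q).rotComp c (C.tmul Q h x) (C.tmul Q h' y) =
      C.tmul Q (C.rotComp c h h') (Q.rotComp c x y) := by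
  simp only [rotComp_apply, compTwo, map_tmul, comp_tmul, rotComp]

open Classical in
theorem coeff_rotComp (c : Fin 3) (H : C.obj (Fin 3)) (x y : (C.had Q).obj (Fin 2)) :
    C.coeff Q H ((C.had Q).rotComp c x y) = ∑ h, ∑ h', if C.rotComp c h h' = H then
      Q.rotComp c (C.coeff Q h x) (C.coeff Q h' y) else 0 := by
  conv_lhs => rw [← C.sum_tmul x, ← C.sum_tmul y]
  simp only [map_sum, LinearMap.sum_apply, rotComp_tmul, coeff_tmul]
  exact Finset.sum_comm

end SetOperad

variable {C} {P : LinOperad.{u, w} k} {D : LinOperad.{u, w'} k} (e : Iso D (C.had P))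

namespace LinOperad.Iso

/-- The component of a binary operation of `D ≅ C ⊗ P`. -/
noncomputable def ev (h : C.obj (Fin 2)) : D.obj (Fin 2) →ₗ[k] P.obj (Fin 2) :=
  C.coeff P h ∘ₗ (e.equiv (Fin 2)).toLinearMap

/-- The inclusion of the binary operations of `P` in those of `D ≅ C ⊗ P`. -/
noncomputable def inc (h : C.obj (Fin 2)) : P.obj (Fin 2) →ₗ[k] D.obj (Fin 2) :=
  (e.equiv (Fin 2)).symm.toLinearMap ∘ₗ C.tmul P h

open Classical in
theorem ev_inc (h h' : C.obj (Fin 2)) (x : P.obj (Fin 2)) :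
    e.ev h (e.inc h' x) = if h' = h then x else 0 := by
  simp [ev, inc, C.coeff_tmul]

theorem sum_inc_ev (d : D.obj (Fin 2)) : ∑ h, e.inc h (e.ev h d) = d := by
  simp only [ev, inc, LinearMap.comp_apply, ← map_sum]
  exact (congrArg _ (C.sum_tmul _)).trans ((e.equiv (Fin 2)).symm_apply_apply d)

theorem ev_swapTwo (h : C.obj (Fin 2)) (d : D.obj (Fin 2)) :
    e.ev (C.map (Equiv.swap 0 1) h) (D.swapTwo d) = P.swapTwo (e.ev h d) := by
  simp only [ev, LinearMap.comp_apply, LinearEquiv.coe_coe, swapTwo, e.equiv_map]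
  exact C.coeff_map _ _ _

theorem swapTwo_inc (h : C.obj (Fin 2)) (x : P.obj (Fin 2)) :
    D.swapTwo (e.inc h x) = e.inc (C.map (Equiv.swap 0 1) h) (P.swapTwo x) := by
  simp only [inc, LinearMap.comp_apply, LinearEquiv.coe_coe, swapTwo]
  rw [LinearEquiv.eq_symm_apply, e.equiv_map, LinearEquiv.apply_symm_apply, C.map_tmul]

theorem rotComp_inc (c : Fin 3) (h h' : C.obj (Fin 2)) (x y : P.obj (Fin 2)) :
    D.rotComp c (e.inc h x) (e.inc h' y) =
      (e.equiv (Fin 3)).symm (C.tmul P (C.rotComp c h h') (P.rotComp c x y)) := by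
  rw [LinearEquiv.eq_symm_apply, ← hom_app, Hom.app_rotComp, ← C.rotComp_tmul]
  simp [inc]

variable {ι : Type} (b : Module.Basis ι k (P.obj (Fin 2)))

/-- The basis of the space of binary operations of `D ≅ C ⊗ P` induced by a basis for `P`. -/
noncomputable def basisTwo : Module.Basis (Σ _ : C.obj (Fin 2), ι) k (D.obj (Fin 2)) :=
  (Finsupp.basis fun _ : C.obj (Fin 2) => b).map (e.equiv (Fin 2)).symm

theorem basisTwo_apply (z : Σ _ : C.obj (Fin 2), ι) : e.basisTwo b z = e.inc z.1 (b z.2) :=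
  (Module.Basis.map_apply _ _ _).trans
    (congrArg _ (congrFun (Finsupp.coe_basis fun _ : C.obj (Fin 2) => b) z))

variable [Fintype ι] [DecidableEq ι] [DecidableEq (C.obj (Fin 2))]

theorem dualBasis_basisTwo (z : Σ _ : C.obj (Fin 2), ι) :
    (e.basisTwo b).dualBasis z = b.dualBasis z.2 ∘ₗ e.ev z.1 := by
  refine (e.basisTwo b).ext fun z' => ?_
  obtain ⟨h, i⟩ := z
  obtain ⟨h', i'⟩ := z'
  rw [Module.Basis.dualBasis_apply_self, basisTwo_apply, LinearMap.comp_apply, ev_inc]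
  by_cases hh : h' = h
  · subst hh
    rw [if_pos rfl, Module.Basis.dualBasis_apply_self]
    simp
  · simp [hh]

end LinOperad.Iso

open LinOperad.Iso

/-- The monomial of degree three with operations from `P` that underlies one with operations from
`D ≅ C ⊗ P`. -/
def underlying {ι : Type} (z : Fin 3 × (Σ _ : C.obj (Fin 2), ι) × (Σ _ : C.obj (Fin 2), ι)) :
    Fin 3 × ι × ι :=
  (z.1, z.2.1.2, z.2.2.2)

/-- The component in `C(3)` of a monomial of degree three with operations from `D ≅ C ⊗ P`. -/
def component {ι : Type} (z : Fin 3 × (Σ _ : C.obj (Fin 2), ι) × (Σ _ : C.obj (Fin 2), ι)) :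
    C.obj (Fin 3) :=
  C.rotComp z.1 z.2.1.1 z.2.2.1

theorem sum_underlying {ι : Type} [Fintype ι] {M : Type w} [AddCommMonoid M]
    (F : Fin 3 × ι × ι → C.obj (Fin 2) → C.obj (Fin 2) → M) :
    ∑ z, F (underlying z) z.2.1.1 z.2.2.1 = ∑ x, ∑ h, ∑ h', F x h h' := by
  simp only [Fintype.sum_prod_type, Fintype.sum_sigma, underlying]
  refine Finset.sum_congr rfl fun c _ => ?_
  rw [Finset.sum_comm]
  refine Finset.sum_congr rfl fun i _ => ?_
  conv_rhs => rw [Finset.sum_comm]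
  exact Finset.sum_congr rfl fun h _ => Finset.sum_comm

section ToHad

/-- The values of the morphism `P^! → C ⊗ D^!` on the generators. -/
noncomputable def dualToHad :
    Module.Dual k (P.obj (Fin 2)) →ₗ[k] (C.had D.koszulDual).obj (Fin 2) :=
  ∑ h, C.tmul _ h ∘ₗ D.dualGen ∘ₗ
    Module.Dual.transpose (R := k) (e.ev h)

theorem coeff_dualToHad (h : C.obj (Fin 2)) (ξ : Module.Dual k (P.obj (Fin 2))) :
    C.coeff D.koszulDual h (dualToHad e ξ) =
      D.dualGen (ξ ∘ₗ e.ev h) := by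
  rw [dualToHad, LinearMap.sum_apply, map_sum, Finset.sum_eq_single h]
  · exact C.coeff_tmul_self _ _
  · intro h' _ hh
    exact C.coeff_tmul_of_ne hh _
  · exact fun hh => (hh (Finset.mem_univ _)).elim

theorem dualToHad_dualSwap (ξ : Module.Dual k (P.obj (Fin 2))) :
    dualToHad e (dualSwap P.swapTwo ξ) = (C.had D.koszulDual).swapTwo (dualToHad e ξ) := by
  refine C.had_ext fun h => ?_
  rw [← C.map_map_symm (Equiv.swap 0 1) h]
  generalize C.map (Equiv.swap 0 1).symm h = h
  rw [coeff_dualToHad]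
  refine Eq.trans ?_ (C.coeff_map (Equiv.swap 0 1) h _).symm
  rw [coeff_dualToHad]
  refine Eq.trans ?_ (D.dualGen_dualSwap (ξ ∘ₗ e.ev h))
  congr 1
  refine LinearMap.ext fun d => ?_
  simp only [dualSwap, LinearMap.neg_apply, LinearMap.comp_apply, Module.Dual.transpose_apply]
  rw [← e.ev_swapTwo, C.map_map, Equiv.swap_swap, C.map_refl]

theorem freeLift_dualToHad {ι : Type} [Fintype ι]
    (b : Module.Basis ι k (P.obj (Fin 2)))
    (g : (freeOperad k (Module.Dual k (P.obj (Fin 2)))).obj (Fin 3))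
    (hg : g ∈ orthogonalRel P.swapTwo P.quadRel) :
    (freeLift (dualToHad e)).app (Fin 3) g = 0 := by
  classical
  refine C.had_ext fun H => ?_
  have hy := (mem_orthogonalRel_iff P b g).1 hg
  have hy' := hy.lift (n := fun z : Fin 3 × (Σ _ : C.obj (Fin 2), ι) × (Σ _ : C.obj (Fin 2), ι) =>
    D.rotComp z.1 (e.basisTwo b z.2.1) (e.basisTwo b z.2.2)) underlying component H
    (C.coeff P H ∘ₗ (e.equiv (Fin 3)).toLinearMap) fun z => by
      rw [basisTwo_apply, basisTwo_apply, rotComp_inc, LinearMap.comp_apply, LinearEquiv.coe_coe,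
        LinearEquiv.apply_symm_apply, C.coeff_tmul]
      rfl
  obtain ⟨G, hG⟩ := coords_surjective (e.basisTwo b).dualBasis (dualSwap D.swapTwo)
    fun z => if component z = H then coords b.dualBasis (dualSwap P.swapTwo) g (underlying z) else 0
  rw [← hG] at hy'
  have h0 := freeLift_dualGen_eq_zero
    ((mem_orthogonalRel_iff D (e.basisTwo b) G).2 hy')
  rw [freeLift_three (e.basisTwo b).dualBasis (dualSwap D.swapTwo) _ D.dualGen_dualSwap, hG] at h0
  rw [map_zero, freeLift_three b.dualBasis (dualSwap P.swapTwo) _ (dualToHad_dualSwap e), map_sum]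
  refine Eq.trans ?_ h0
  simp only [map_smul, C.coeff_rotComp, coeff_dualToHad, dualBasis_basisTwo, ite_smul, zero_smul,
    Finset.smul_sum, smul_ite, smul_zero]
  exact (sum_underlying _).symm

end ToHad

section FromHad

variable {Q : LinOperad.{u, w₁} k} (ψ : Module.Dual k (P.obj (Fin 2)) →ₗ[k] (C.had Q).obj (Fin 2))

/-- The values on the generators of the morphism `D^! → Q` that corresponds to a morphism
`P^! → C ⊗ Q`. -/
noncomputable def dualFromHad : Module.Dual k (D.obj (Fin 2)) →ₗ[k] Q.obj (Fin 2) :=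
  ∑ h, C.coeff Q h ∘ₗ ψ ∘ₗ Module.Dual.transpose (R := k) (e.inc h)

theorem dualFromHad_apply (ξ : Module.Dual k (D.obj (Fin 2))) :
    dualFromHad e ψ ξ = ∑ h, C.coeff Q h (ψ (ξ ∘ₗ e.inc h)) := by
  simp only [dualFromHad, LinearMap.sum_apply]
  rfl

theorem dualFromHad_comp_ev (h : C.obj (Fin 2)) (ξ : Module.Dual k (P.obj (Fin 2))) :
    dualFromHad e ψ (ξ ∘ₗ e.ev h) = C.coeff Q h (ψ ξ) := by
  rw [dualFromHad_apply, Finset.sum_eq_single h]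
  · congr 2
    refine LinearMap.ext fun x => ?_
    simp [e.ev_inc]
  · intro h' _ hh
    rw [show (ξ ∘ₗ e.ev h) ∘ₗ e.inc h' = 0 from LinearMap.ext fun x => by simp [e.ev_inc, hh],
      map_zero, map_zero]
  · exact fun hh => (hh (Finset.mem_univ _)).elim

variable {ψ}

theorem dualFromHad_dualSwap (hψ : ∀ ξ, ψ (dualSwap P.swapTwo ξ) = (C.had Q).swapTwo (ψ ξ))
    (ξ : Module.Dual k (D.obj (Fin 2))) :
    dualFromHad e ψ (dualSwap D.swapTwo ξ) = Q.swapTwo (dualFromHad e ψ ξ) := by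
  have hs : Function.Involutive (C.map (Equiv.swap (0 : Fin 2) 1)) := fun h => by
    rw [C.map_map, Equiv.swap_swap, C.map_refl]
  rw [dualFromHad_apply, dualFromHad_apply, map_sum]
  refine Fintype.sum_equiv hs.toPerm _ _ fun h => ?_
  rw [Function.Involutive.coe_toPerm]
  have h1 : dualSwap D.swapTwo ξ ∘ₗ e.inc h =
      dualSwap P.swapTwo (ξ ∘ₗ e.inc (C.map (Equiv.swap 0 1) h)) := by
    refine LinearMap.ext fun x => ?_
    simp only [dualSwap, LinearMap.neg_apply, LinearMap.comp_apply, Module.Dual.transpose_apply,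
      e.swapTwo_inc]
  rw [h1, hψ]
  rw [← congrArg (fun h' => C.coeff Q h' _) (hs h)]
  exact C.coeff_map _ _ _

theorem freeLift_dualFromHad {ι : Type} [Fintype ι] (b : Module.Basis ι k (P.obj (Fin 2)))
    (hC : ∀ c H, ∃ h h', C.rotComp c h h' = H)
    (hψ : ∀ ξ, ψ (dualSwap P.swapTwo ξ) = (C.had Q).swapTwo (ψ ξ))
    (hR : ∀ f : (freeOperad k (Module.Dual k (P.obj (Fin 2)))).obj (Fin 3),
      f ∈ orthogonalRel P.swapTwo P.quadRel → (freeLift ψ).app (Fin 3) f = 0)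
    (g : (freeOperad k (Module.Dual k (D.obj (Fin 2)))).obj (Fin 3))
    (hg : g ∈ orthogonalRel D.swapTwo D.quadRel) :
    (freeLift (dualFromHad e ψ)).app (Fin 3) g = 0 := by
  classical
  choose s s' hs using hC
  set y := coords (e.basisTwo b).dualBasis (dualSwap D.swapTwo) g with hy
  have hann := (mem_orthogonalRel_iff D (e.basisTwo b) g).1 hg
  rw [← hy] at hann
  -- a monomial of degree three with operations from `P` and a given component in `C(3)`
  let σ : C.obj (Fin 3) → Fin 3 × ι × ι →
      Fin 3 × (Σ _ : C.obj (Fin 2), ι) × (Σ _ : C.obj (Fin 2), ι) :=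
    fun H x => (x.1, ⟨s x.1 H, x.2.1⟩, ⟨s' x.1 H, x.2.2⟩)
  have hσ : ∀ H x, component (σ H x) = H := fun H x => hs _ _
  have hval : ∀ z : Fin 3 × (Σ _ : C.obj (Fin 2), ι) × (Σ _ : C.obj (Fin 2), ι),
      D.rotComp z.1 (e.basisTwo b z.2.1) (e.basisTwo b z.2.2) = (e.equiv (Fin 3)).symm
        (C.tmul P (component z) (P.rotComp z.1 (b (underlying z).2.1) (b (underlying z).2.2))) :=
    fun z => by rw [basisTwo_apply, basisTwo_apply, rotComp_inc]; rfl
  have hyz : ∀ z, y z = y (σ (component z) (underlying z)) := fun z => hann.eq_of_eq (by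
    rw [hval, hval, hσ]
    rfl)
  have hann' : ∀ H, Annihilates (fun x => P.rotComp x.1 (b x.2.1) (b x.2.2)) (y ∘ σ H) := fun H =>
    hann.comp (σ H) ((e.equiv (Fin 3)).symm.toLinearMap ∘ₗ C.tmul P H) fun x => by
      rw [hval, hσ]
      rfl
  have h0 : ∀ H, ∑ x, y (σ H x) • (C.had Q).rotComp x.1 (ψ (b.dualBasis x.2.1))
      (ψ (b.dualBasis x.2.2)) = 0 := by
    intro H
    obtain ⟨G, hG⟩ := coords_surjective b.dualBasis (dualSwap P.swapTwo) (y ∘ σ H)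
    have h1 := hann' H
    rw [← hG] at h1
    have h2 := hR G ((mem_orthogonalRel_iff P b G).2 h1)
    rwa [freeLift_three b.dualBasis (dualSwap P.swapTwo) _ hψ, hG] at h2
  rw [freeLift_three (e.basisTwo b).dualBasis (dualSwap D.swapTwo) _ (dualFromHad_dualSwap e hψ),
    ← hy]
  simp only [dualBasis_basisTwo, dualFromHad_comp_ev]
  have h3 : ∑ H, C.coeff Q H (∑ x, y (σ H x) • (C.had Q).rotComp x.1 (ψ (b.dualBasis x.2.1))
      (ψ (b.dualBasis x.2.2))) = 0 := Finset.sum_eq_zero fun H _ => by rw [h0, map_zero]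
  rw [← h3]
  simp only [map_sum, map_smul, C.coeff_rotComp, Finset.smul_sum, smul_ite, smul_zero]
  rw [Finset.sum_comm]
  refine Eq.trans (Finset.sum_congr rfl fun z _ => by rw [hyz z]; rfl)
    ((sum_underlying fun x h h' =>
    y (σ (C.rotComp x.1 h h') x) • Q.rotComp x.1 (C.coeff Q h (ψ (b.dualBasis x.2.1)))
      (C.coeff Q h' (ψ (b.dualBasis x.2.2)))).trans (Finset.sum_congr rfl fun x _ => ?_))
  symm
  rw [Finset.sum_comm]
  refine Finset.sum_congr rfl fun h _ => ?_
  rw [Finset.sum_comm]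
  refine Finset.sum_congr rfl fun h' _ => ?_
  rw [Finset.sum_ite_eq, if_pos (Finset.mem_univ _)]

end FromHad

/-- The Koszul dual of the Hadamard product of an operad in sets with a quadratic operad is obtained
by splitting the operations of the Koszul dual of the latter. -/
theorem nonempty_koszulDual_iso [Module.Finite k (P.obj (Fin 2))]
    (hC : ∀ c H, ∃ h h', C.rotComp c h h' = H) {Sym : Type} (hd : Sym ≃ C.obj (Fin 2))
    {Ω : Type v} {S : Identities k Ω} (e : Iso D (C.had P))
    (hdual : Iso (operadOf S) P.koszulDual) :
    Nonempty (Iso D.koszulDual (operadOf (C.dend hd S))) := by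
  let b := Module.finBasis k (P.obj (Fin 2))
  obtain ⟨χ, hχ⟩ := exists_dual_hom (dualToHad e) (dualToHad_dualSwap e) (freeLift_dualToHad e b)
  let G : Hom (operadOf (C.dend hd S)) D.koszulDual := C.dendLift hd (χ.comp hdual.hom)
  let Ψ : Hom P.koszulDual (C.had (operadOf (C.dend hd S))) :=
    (C.split hd S).comp hdual.symm.hom
  let ψ : Module.Dual k (P.obj (Fin 2)) →ₗ[k] (C.had (operadOf (C.dend hd S))).obj (Fin 2) :=
    Ψ.app (Fin 2) ∘ₗ P.dualGen
  have hψ : ∀ ξ, ψ (dualSwap P.swapTwo ξ) = (C.had (operadOf (C.dend hd S))).swapTwo (ψ ξ) :=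
    fun ξ => (congrArg (Ψ.app (Fin 2)) (P.dualGen_dualSwap ξ)).trans (Ψ.app_map _ _)
  have hψR : ∀ f : (freeOperad k (Module.Dual k (P.obj (Fin 2)))).obj (Fin 3),
      f ∈ orthogonalRel P.swapTwo P.quadRel → (freeLift ψ).app (Fin 3) f = 0 := by
    intro f hf
    have h : freeLift ψ = Ψ.comp (freeLift P.dualGen) := by
      refine freeOperad_hom_ext fun o => ?_
      rw [Hom.comp_app, freeLift_gen, freeLift_gen]
      rfl
    rw [h, Hom.comp_app]
    exact (congrArg _ (freeLift_dualGen_eq_zero hf)).trans (map_zero _)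
  obtain ⟨F, hF⟩ := exists_dual_hom (dualFromHad e ψ) (dualFromHad_dualSwap e hψ)
    (freeLift_dualFromHad e b hC hψ hψR)
  have hG : ∀ x, (C.hadHom G).app (Fin 2) (Ψ.app (Fin 2) x) = χ.app (Fin 2) x := by
    intro x
    have h := congrArg (fun H : Hom (operadOf S) (C.had D.koszulDual) =>
      H.app (Fin 2) (hdual.symm.hom.app (Fin 2) x)) (C.hadHom_dendLift hd (χ.comp hdual.hom))
    refine h.trans ?_
    exact congrArg (χ.app (Fin 2)) ((hdual.equiv (Fin 2)).apply_symm_apply x)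
  have hFχ : (C.hadHom F).comp χ = Ψ := by
    refine dual_hom_ext fun ξ => C.had_ext fun h => ?_
    rw [Hom.comp_app, C.coeff_hadHom, hχ, coeff_dualToHad, hF, dualFromHad_comp_ev]
    rfl
  refine ⟨Iso.ofHoms F G (dual_hom_ext fun ξ => ?_)
    (C.dend_hom_ext hd (Hom.ext_app fun A _ x => ?_))⟩
  · rw [Hom.comp_app, hF, dualFromHad_apply, map_sum, Hom.id_app]
    have h1 : ∀ h : C.obj (Fin 2), G.app (Fin 2) (C.coeff _ h (ψ (ξ ∘ₗ e.inc h))) =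
        D.dualGen
          ((ξ ∘ₗ e.inc h) ∘ₗ e.ev h) := by
      intro h
      rw [← coeff_dualToHad, ← hχ, ← hG]
      rfl
    simp only [h1]
    refine (map_sum D.dualGen _ _).symm.trans
      (congrArg _ (LinearMap.ext fun d => ?_))
    simp only [LinearMap.sum_apply, LinearMap.comp_apply]
    rw [← map_sum, e.sum_inc_ev]
  · have h1 : (C.hadHom G).app A ((C.split hd S).app A x) = χ.app A (hdual.equiv A x) :=
      congrArg (fun H : Hom (operadOf S) (C.had D.koszulDual) => H.app A x)
        (C.hadHom_dendLift hd (χ.comp hdual.hom))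
    have h2 : (C.hadHom F).app A (χ.app A (hdual.equiv A x)) = (C.split hd S).app A x :=
      (congrArg (fun H : Hom P.koszulDual (C.had (operadOf (C.dend hd S))) =>
        H.app A (hdual.equiv A x)) hFχ).trans
        (congrArg ((C.split hd S).app A) ((hdual.equiv A).symm_apply_apply x))
    rw [← h1] at h2
    refine C.had_ext fun h => ?_
    rw [Hom.comp_app, Hom.comp_app, C.coeff_hadHom, C.coeff_hadHom, Hom.comp_app, Hom.id_app,
      ← C.coeff_hadHom, ← C.coeff_hadHom, h2]

end Koszul

/-! ### Koszul duality for marked varieties -/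

section Consequences

variable {k : Type u} [Field k] {Ω : Type v}

instance finite_operadOf_two [Finite Ω] (S : Identities k Ω) :
    Module.Finite k ((operadOf S).obj (Fin 2)) := by
  have h : Finite (MTree Ω (Fin 2)) := by
    have h' : ∀ t : MTree Ω (Fin 2), ∃ x : Ω × Bool, t.1 = bif x.2 then
        .node x.1 (.leaf 0) (.leaf 1) else .node x.1 (.leaf 1) (.leaf 0) := by
      intro t
      obtain ⟨o, ho | ho⟩ := t.2.eq_of_two
      exacts [⟨(o, true), ho⟩, ⟨(o, false), ho⟩]
    choose f hf using h'
    exact Finite.of_injective f fun t s hts => Subtype.ext (by rw [hf, hf, hts])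
  have : Module.Finite k ((freeOperad k Ω).obj (Fin 2)) :=
    inferInstanceAs (Module.Finite k (MTree Ω (Fin 2) →₀ k))
  exact Module.Finite.of_surjective _ (proj_surjective S (Fin 2))

/-- Adding the trivial identity does not change the operad of a variety. -/
theorem nonempty_iso_of_subset {S S' : Identities k Ω} (h : ∀ n, S n ⊆ S' n)
    (h' : ∀ n, ∀ f ∈ S' n, f ∈ S n ∨ f = 0) : Nonempty (Iso (operadOf S) (operadOf S')) :=
  ⟨Iso.ofHoms (descend (proj S') fun n f hf => proj_eq_zero S' (h n hf))
    (descend (proj S) fun n f hf => by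
      rcases h' n f hf with h0 | h0
      · exact proj_eq_zero S h0
      · exact (congrArg _ h0).trans (map_zero _))
    (operadOf_hom_ext fun o => rfl) (operadOf_hom_ext fun o => rfl)⟩

namespace Marking

variable {C : SetOperad} {D : Type}

theorem exists_rotComp (M : Marking C D Ω) (c : Fin 3) (H : C.obj (Fin 3)) :
    ∃ h h', C.rotComp c h h' = H := by
  obtain ⟨a, b, hab⟩ := M.exists_comp
    (C.map unitSumFinTwo.symm (C.map (Equiv.addRight (c + 1)).symm H))
  refine ⟨C.map finTwoOption.symm a, b, ?_⟩
  rw [SetOperad.rotComp, C.map_map_symm, ← hab, C.map_map_symm, C.map_map_symm]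

theorem isBinaryQuadratic_var (M : Marking C D Ω) (M' : ∀ E : Type max u v, Marking C D E)
    {S : Identities k Ω} (h : (operadOf S).IsBinaryQuadratic) :
    (operadOf (M.var S)).IsBinaryQuadratic := by
  obtain ⟨E, _, _, τ, R, -, ⟨e⟩⟩ := h
  refine IsBinaryQuadratic.of_iso ((M.varIso S).trans ((C.hadIso e).trans
    ((M' E).varIso (quadIdentities τ R)).symm)) (isBinaryQuadratic_operadOf _ fun n f hf => ?_)
  have hn : ∀ n, ∀ f, f ∈ quadIdentities τ R n → n = 2 ∨ n = 3
    | 2, _, _ => Or.inl rfl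
    | 3, _, _ => Or.inr rfl
  cases (show (M' E).Identity (quadIdentities τ R) n f from hf) with
  | zero_left s i j => exact Or.inr rfl
  | zero_right s i j => exact Or.inr rfl
  | dot n f hfR h => exact hn n f hfR

/-- Marking the variables in the identities of a variety is Koszul dual to splitting the operations
of the Koszul dual variety. -/
theorem isBinaryQuadratic_and_nonempty_iso [Finite Ω] (M : Marking C D Ω)
    (M' : ∀ E : Type max u v, Marking C D E) {S : Identities k Ω}
    (hquad : (operadOf S).IsBinaryQuadratic) {Ω' : Type w} {S' : Identities k Ω'}
    (hdual : Iso (operadOf S') (operadOf S).koszulDual) {T : Identities k (D × Ω)}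
    (e : Iso (operadOf T) (operadOf (M.var S))) :
    (operadOf T).IsBinaryQuadratic ∧
      Nonempty (Iso (operadOf T).koszulDual (operadOf (C.dend M.hd S'))) :=
  ⟨IsBinaryQuadratic.of_iso e (M.isBinaryQuadratic_var M' hquad),
    nonempty_koszulDual_iso M.exists_rotComp M.hd (e.trans (M.varIso S)) hdual⟩

end Marking

end Consequences

/-! ### Sums of monomials -/

section Sums

variable {k : Type u} [Field k] {Ω : Type v} {A B : Type}

open Classical in
variable (k) in
/-- A monomial as an element of the free operad, if it is multilinear. -/
noncomputable def monoOf [Finite A] (t : MagTree Ω A) : (freeOperad k Ω).obj A :=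
  if h : t.IsMultilinear then mono k ⟨t, h⟩ else 0

variable (k) in
/-- The sum of the multilinear monomials in a list. -/
noncomputable def listSum [Finite A] (L : List (MagTree Ω A)) : (freeOperad k Ω).obj A :=
  (L.map (monoOf k)).sum

theorem monoOf_val [Finite A] (t : MTree Ω A) : monoOf k t.1 = mono k t := dif_pos t.2

theorem monoOf_eq_zero [Finite A] {t : MagTree Ω A} (h : ¬t.IsMultilinear) : monoOf k t = 0 :=
  dif_neg h

theorem monomialSum_eq_listSum [Finite A] (L : List (MagTree Ω A))
    (hL : ∀ t ∈ L, t.IsMultilinear) :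
    (monomialSum L hL : MPoly k Ω A) = listSum k L := by
  have h : L.attach.map (fun t => (Finsupp.single (⟨t.1, hL t.1 t.2⟩ : MTree Ω A) (1 : k))) =
      L.attach.map fun t => monoOf k t.1 :=
    List.map_congr_left fun t _ => (monoOf_val ⟨t.1, hL t.1 t.2⟩).symm
  rw [monomialSum, h, listSum]
  exact congrArg List.sum (List.attach_map_val (f := monoOf k))

theorem _root_.KDual.MagTree.isMultilinear_rename_iff (σ : A ≃ B) (t : MagTree Ω A) :
    (t.rename σ).IsMultilinear ↔ t.IsMultilinear := by
  refine ⟨fun h => ?_, fun h => h.rename σ⟩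
  have h' := h.rename σ.symm
  rwa [MagTree.rename_rename, Equiv.symm_comp_self,
    show t.rename id = t from MagTree.bind_leaf t] at h'

theorem listSum_append [Finite A] (L L' : List (MagTree Ω A)) :
    listSum k (L ++ L') = listSum k L + listSum k L' := by
  rw [listSum, List.map_append, List.sum_append]
  rfl

theorem map_monoOf [Finite A] [Finite B] (σ : A ≃ B) (t : MagTree Ω A) :
    (freeOperad k Ω).map σ (monoOf k t) = monoOf k (t.rename σ) := by
  by_cases h : t.IsMultilinear
  · obtain ⟨t, rfl⟩ : ∃ t' : MTree Ω A, t'.1 = t := ⟨⟨t, h⟩, rfl⟩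
    rw [monoOf_val, map_mono]
    exact (monoOf_val (t.rename σ)).symm
  · rw [monoOf_eq_zero h, monoOf_eq_zero (mt (MagTree.isMultilinear_rename_iff σ t).1 h), map_zero]

theorem map_listSum [Finite A] [Finite B] (σ : A ≃ B) (L : List (MagTree Ω A)) :
    (freeOperad k Ω).map σ (listSum k L) = listSum k (L.map (MagTree.rename σ)) := by
  rw [listSum, listSum, map_list_sum, List.map_map, List.map_map]
  exact congrArg List.sum (List.map_congr_left fun t _ => map_monoOf σ t)

theorem _root_.KDual.MagTree.IsMultilinear.of_node {o : Ω} {l : MagTree Ω A} {r : MagTree Ω B}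
    (h : (MagTree.node o (l.rename (Sum.inl : A → A ⊕ B)) (r.rename Sum.inr)).IsMultilinear) :
    l.IsMultilinear ∧ r.IsMultilinear := by
  obtain ⟨h1, h2⟩ := h
  rw [MagTree.leaves, MagTree.leaves_rename, MagTree.leaves_rename] at h1 h2
  rw [List.nodup_append'] at h1
  refine ⟨⟨h1.1.of_map, fun a => ?_⟩, ⟨h1.2.1.of_map, fun b => ?_⟩⟩
  · simpa using h2 (Sum.inl a)
  · simpa using h2 (Sum.inr b)

theorem binary_gen_monoOf [Finite A] [Finite B] (o : Ω) (l : MagTree Ω A) (r : MagTree Ω B) :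
    (freeOperad k Ω).binary (gen k o) (monoOf k l) (monoOf k r) =
      monoOf k (.node o (l.rename Sum.inl) (r.rename Sum.inr)) := by
  by_cases hl : l.IsMultilinear
  · obtain ⟨l, rfl⟩ : ∃ l' : MTree Ω A, l'.1 = l := ⟨⟨l, hl⟩, rfl⟩
    by_cases hr : r.IsMultilinear
    · obtain ⟨r, rfl⟩ : ∃ r' : MTree Ω B, r'.1 = r := ⟨⟨r, hr⟩, rfl⟩
      rw [monoOf_val, monoOf_val, binary_gen_mono]
      exact (monoOf_val (MTree.node o l r)).symm
    · rw [monoOf_eq_zero hr, map_zero, monoOf_eq_zero fun h => hr h.of_node.2]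
  · rw [monoOf_eq_zero hl, map_zero, LinearMap.zero_apply, monoOf_eq_zero fun h => hl h.of_node.1]

/-- The sum of the products of the monomials in two lists. -/
theorem listSum_flatMap_node [Finite A] [Finite B] (o : Ω) (L : List (MagTree Ω A))
    (L' : List (MagTree Ω B)) :
    listSum k ((L.map (MagTree.rename Sum.inl)).flatMap fun l =>
      (L'.map (MagTree.rename Sum.inr)).map fun r => MagTree.node o l r) =
      (freeOperad k Ω).binary (gen k o) (listSum k L) (listSum k L') := by
  induction L with
  | nil => simp [listSum]
  | cons l L ih =>
    have h : listSum k ((L'.map (MagTree.rename Sum.inr)).map fun r =>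
        MagTree.node o (l.rename (Sum.inl : A → A ⊕ B)) r) =
        (freeOperad k Ω).binary (gen k o) (monoOf k l) (listSum k L') := by
      rw [listSum, listSum, map_list_sum, List.map_map, List.map_map, List.map_map]
      exact congrArg List.sum (List.map_congr_left fun r _ => (binary_gen_monoOf o l r).symm)
    rw [List.map_cons, List.flatMap_cons, listSum_append, h, ih,
      show listSum k (l :: L) = monoOf k l + listSum k L from List.sum_cons, map_add,
      LinearMap.add_apply]

end Sums

namespace SetOperad

variable (C : SetOperad) {k : Type u} [Field k] {Q : LinOperad.{u, w} k}

variable (Q) in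
/-- The morphism from a Hadamard product that adds up all coefficients. -/
noncomputable def total : Hom (C.had Q) Q where
  app A _ := ∑ h, C.coeff Q h
  app_map {A B} _ _ σ f := by
    classical
    refine LinearMap.congr_fun (f := (∑ h, C.coeff Q h) ∘ₗ (C.had Q).map σ)
      (g := Q.map σ ∘ₗ ∑ h, C.coeff Q h) (C.had_hom_ext fun h x => ?_) f
    simp [map_tmul, coeff_tmul]
  app_one := by
    classical
    simp [one_had, coeff_tmul]
  app_comp {A B} _ _ f g := by
    classical
    refine LinearMap.congr_fun (LinearMap.congr_fun
      (f := (C.had Q).comp.compr₂ (∑ h, C.coeff Q h))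
      (g := Q.comp.compl₁₂ (∑ h, C.coeff Q h) (∑ h, C.coeff Q h)) ?_ f) g
    refine C.had_hom_ext fun h x => C.had_hom_ext fun h' y => ?_
    simp [comp_tmul, coeff_tmul]

theorem total_app {A : Type} [Finite A] (x : (C.had Q).obj A) :
    (C.total Q).app A x = ∑ h, C.coeff Q h x := by
  simp [total]

section SumBinary

variable {A B : Type} [Finite A] [Finite B] (d : C.obj (Fin 2)) (g : Q.obj (Fin 2))
  (x : (C.had Q).obj A) (y : (C.had Q).obj B) (H : C.obj (A ⊕ B))

open Classical in
/-- The part of the coefficient of `H` in a product that comes from the component `d` of the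
operation. -/
noncomputable def sumBinary : Q.obj (A ⊕ B) :=
  ∑ h, ∑ h', if C.binary d h h' = H then Q.binary g (C.coeff Q h x) (C.coeff Q h' y) else 0

variable {C d g x y H}

theorem sumBinary_eq_zero (hH : ∀ h h', C.binary d h h' ≠ H) : C.sumBinary d g x y H = 0 :=
  Finset.sum_eq_zero fun h _ => Finset.sum_eq_zero fun h' _ => if_neg (hH h h')

theorem sumBinary_eq_left {a : C.obj A} (hH : ∀ h h', C.binary d h h' = H ↔ h = a) :
    C.sumBinary d g x y H = Q.binary g (C.coeff Q a x) ((C.total Q).app B y) := by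
  classical
  rw [sumBinary, Finset.sum_comm, total_app, map_sum]
  exact Finset.sum_congr rfl fun h' _ =>
    by simp only [hH, Finset.sum_ite_eq', Finset.mem_univ, if_true]

theorem sumBinary_eq_right {b : C.obj B} (hH : ∀ h h', C.binary d h h' = H ↔ h' = b) :
    C.sumBinary d g x y H = Q.binary g ((C.total Q).app A x) (C.coeff Q b y) := by
  classical
  rw [sumBinary, total_app, map_sum, LinearMap.sum_apply]
  exact Finset.sum_congr rfl fun h _ =>
    by simp only [hH, Finset.sum_ite_eq', Finset.mem_univ, if_true]

theorem sumBinary_eq {a : C.obj A} {b : C.obj B}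
    (hH : ∀ h h', C.binary d h h' = H ↔ h = a ∧ h' = b) :
    C.sumBinary d g x y H = Q.binary g (C.coeff Q a x) (C.coeff Q b y) := by
  classical
  rw [sumBinary, Finset.sum_eq_single a, Finset.sum_eq_single b, if_pos ((hH a b).2 ⟨rfl, rfl⟩)]
  · exact fun h' _ hh => if_neg fun h => hh ((hH a h').1 h).2
  · exact fun h => (h (Finset.mem_univ _)).elim
  · exact fun h _ hh => Finset.sum_eq_zero fun h' _ => if_neg fun h1 => hh ((hH h h').1 h1).1
  · exact fun h => (h (Finset.mem_univ _)).elim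

end SumBinary

theorem coeff_binary {A B : Type} [Finite A] [Finite B] (g : C.obj (Fin 2) → Q.obj (Fin 2))
    (x : (C.had Q).obj A) (y : (C.had Q).obj B) (H : C.obj (A ⊕ B)) :
    C.coeff Q H ((C.had Q).binary (∑ d, C.tmul Q d (g d)) x y) =
      ∑ d, C.sumBinary d (g d) x y H := by
  classical
  simp only [sumBinary]
  conv_lhs => rw [← C.sum_tmul x, ← C.sum_tmul y]
  simp only [map_sum, LinearMap.sum_apply, binary_tmul, coeff_tmul]
  rw [Finset.sum_comm]
  conv_rhs => rw [Finset.sum_comm]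
  exact Finset.sum_congr rfl fun h _ => Finset.sum_comm

variable {D : Type} (hd : D ≃ C.obj (Fin 2)) {L : List D}

theorem sum_eq_sum_list (hL : L.Nodup) (hL' : ∀ d, d ∈ L) {M : Type w'} [AddCommMonoid M]
    (f : C.obj (Fin 2) → M) : ∑ h, f h = (L.map fun d => f (hd d)).sum := by
  classical
  let _ : Fintype D := Fintype.ofEquiv _ hd.symm
  rw [← List.sum_toFinset _ hL, ← hd.sum_comp,
    show L.toFinset = Finset.univ from Finset.eq_univ_iff_forall.2 fun d =>
      List.mem_toFinset.2 (hL' d)]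

variable {Ω : Type v}

theorem _root_.KDual.MagTree.starTerms_rename {A B : Type} (f : A → B) (t : MagTree Ω A) :
    (t.rename f).starTerms L = (t.starTerms L).map (MagTree.rename f) := by
  induction t with
  | leaf a => rfl
  | node o l r ihl ihr =>
    have hl : ((MagTree.node o l r).rename f).starTerms L = L.flatMap fun d =>
        ((l.rename f).starTerms L).flatMap fun l' =>
          ((r.rename f).starTerms L).map fun r' => MagTree.node (d, o) l' r' := rfl
    rw [hl, ihl, ihr]
    simp only [MagTree.starTerms, List.map_flatMap, List.flatMap_map, List.map_map]
    rfl

/-- The sum of the coefficients of the image of a monomial under `splitFree` is the sum of all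
monomials with split operations. -/
theorem total_splitFree (hL : L.Nodup) (hL' : ∀ d, d ∈ L) {A : Type} [Finite A] (t : MTree Ω A) :
    (C.total _).app A ((C.splitFree k Ω hd).app A (mono k t)) = listSum k (t.1.starTerms L) := by
  revert ‹Finite A›
  induction t using MTree.induction with
  | unit =>
    intro _
    rw [mono_unit, Hom.app_one, Hom.app_one]
    exact ((List.sum_singleton).trans (monoOf_val (MTree.unit (D × Ω)))).symm
  | @node A B o l r ihl ihr =>
    intro _
    have := l.finite
    have := r.finite
    have hgen : (C.total _).app (Fin 2) ((C.splitFree k Ω hd).app (Fin 2) (gen k o)) =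
        (L.map fun d => gen k (d, o)).sum := by
      rw [total_app, splitFree, freeLift_gen]
      simp only [map_sum]
      rw [Finset.sum_comm]
      classical
      simp only [coeff_tmul, Finset.sum_ite_eq, Finset.mem_univ, if_true]
      rw [C.sum_eq_sum_list hd hL hL']
      simp only [Equiv.symm_apply_apply]
    have hflat : ∀ {E : Type} [Finite E] (F : D → List (MagTree (D × Ω) E)) (L : List D),
        listSum k (L.flatMap F) = (L.map fun d => listSum k (F d)).sum := by
      intro E _ F L
      induction L with
      | nil => rfl
      | cons d L ih => rw [List.flatMap_cons, listSum_append, ih, List.map_cons, List.sum_cons]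
    have hbin : ∀ (L : List D) (x : (freeOperad k (D × Ω)).obj A)
        (y : (freeOperad k (D × Ω)).obj B),
        (freeOperad k (D × Ω)).binary (L.map fun d => gen k (d, o)).sum x y =
          (L.map fun d => (freeOperad k (D × Ω)).binary (gen k (d, o)) x y).sum := by
      intro L x y
      induction L with
      | nil => simp
      | cons d L ih =>
        rw [List.map_cons, List.sum_cons, map_add, LinearMap.add_apply, LinearMap.add_apply, ih,
          List.map_cons, List.sum_cons]
    have hnode : (MTree.node o l r).1.starTerms L = L.flatMap fun d =>
        ((l.1.starTerms L).map (MagTree.rename Sum.inl)).flatMap fun l' =>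
          ((r.1.starTerms L).map (MagTree.rename Sum.inr)).map fun r' =>
            MagTree.node (d, o) l' r' := by
      rw [← MagTree.starTerms_rename, ← MagTree.starTerms_rename]
      rfl
    rw [← binary_gen_mono, Hom.app_binary, Hom.app_binary, ihl, ihr, hgen, hnode, hflat, hbin]
    simp only [listSum_flatMap_node]
  | rename σ t ih =>
    intro _
    have := t.finite
    rw [← map_mono, Hom.app_map, Hom.app_map, ih, map_listSum]
    exact congrArg _ (MagTree.starTerms_rename σ t.1).symm

end SetOperad

/-! ### Dialgebras -/

/-- The operad `Perm` in sets, one of the inputs of whose operations is emphasized. -/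
@[reducible] def permOperad : SetOperad where
  obj A := A
  finite _ h := h
  map σ a := σ a
  one := ()
  comp f g := match f with
    | none => Sum.inr g
    | some a => Sum.inl a
  map_refl _ := rfl
  map_trans _ _ _ := rfl
  map_comp := by rintro A A' B B' σ τ (_ | a) b <;> rfl
  comp_one := by rintro A (_ | a) <;> rfl
  one_comp _ := rfl
  comp_assoc := by rintro A B D (_ | a) (_ | b) c <;> rfl
  comp_parallel := by rintro A B D (_ | _ | a) b c <;> rfl

/-- The emphasized input of the operations `⊣` and `⊢`. -/
def diSymEquiv : DiSym ≃ permOperad.obj (Fin 2) where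
  toFun d := match d with
    | .dashv => (0 : Fin 2)
    | .vdash => (1 : Fin 2)
  invFun i := if (i : Fin 2) = 0 then .dashv else .vdash
  left_inv := by rintro ⟨⟩ <;> rfl
  right_inv := by
    intro (i : Fin 2)
    fin_cases i <;> rfl

namespace MagTree

variable {Ω : Type v} {A B : Type} {f : A → B}

theorem mem_leaves_rename_iff (hf : Function.Injective f) (a : A) (t : MagTree Ω A) :
    f a ∈ (t.rename f).leaves ↔ a ∈ t.leaves := by
  rw [leaves_rename]
  exact List.mem_map_of_injective hf

theorem inr_notMem_leaves (b : B) (t : MagTree Ω A) :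
    (Sum.inr b : A ⊕ B) ∉ (t.rename Sum.inl).leaves := by
  simp [leaves_rename]

open Classical in
theorem diMark_rename (hf : Function.Injective f) (a : A) (t : MagTree Ω A) :
    (t.rename f).diMark (f a) = (t.diMark a).rename f := by
  induction t with
  | leaf b => rfl
  | node o l r ihl ihr =>
    have h : ((node o l r).rename f).diMark (f a) =
        if f a ∈ (l.rename f).leaves then
          node (.dashv, o) ((l.rename f).diMark (f a)) ((r.rename f).mapOps (Prod.mk .dashv))
        else node (.vdash, o) ((l.rename f).mapOps (Prod.mk .vdash)) ((r.rename f).diMark (f a)) :=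
      rfl
    rw [h, diMark, mapOps_rename, mapOps_rename, ihl, ihr]
    by_cases ha : a ∈ l.leaves
    · rw [if_pos ((mem_leaves_rename_iff hf a l).2 ha), if_pos ha]
      rfl
    · rw [if_neg (mt (mem_leaves_rename_iff hf a l).1 ha), if_neg ha]
      rfl

open Classical in
theorem diDendTerms_rename (hf : Function.Injective f) (a : A) (t : MagTree Ω A) :
    (t.rename f).diDendTerms (f a) = (t.diDendTerms a).map (rename f) := by
  induction t with
  | leaf b => rfl
  | node o l r ihl ihr =>
    have h : ((node o l r).rename f).diDendTerms (f a) =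
        if f a ∈ (l.rename f).leaves then
          ((l.rename f).diDendTerms (f a)).flatMap fun l' =>
            (r.rename f).diStar.map fun r' => node (.dashv, o) l' r'
        else (l.rename f).diStar.flatMap fun l' =>
          ((r.rename f).diDendTerms (f a)).map fun r' => node (.vdash, o) l' r' :=
      rfl
    rw [h, diDendTerms, diStar, diStar, starTerms_rename, starTerms_rename, ihl, ihr]
    by_cases ha : a ∈ l.leaves
    · rw [if_pos ((mem_leaves_rename_iff hf a l).2 ha), if_pos ha]
      simp only [List.map_flatMap, List.flatMap_map, List.map_map]
      rfl
    · rw [if_neg (mt (mem_leaves_rename_iff hf a l).1 ha), if_neg ha]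
      simp only [List.map_flatMap, List.flatMap_map, List.map_map]
      rfl

theorem diMark_node_inl (o : Ω) {l : MagTree Ω A} (r : MagTree Ω B) {a : A} (ha : a ∈ l.leaves) :
    (node o (l.rename Sum.inl) (r.rename Sum.inr)).diMark (Sum.inl a) =
      node (.dashv, o) ((l.diMark a).rename Sum.inl)
        ((r.mapOps (Prod.mk .dashv)).rename Sum.inr) := by
  rw [diMark, if_pos ((mem_leaves_rename_iff Sum.inl_injective a l).2 ha),
    diMark_rename Sum.inl_injective, mapOps_rename]

theorem diMark_node_inr (o : Ω) (l : MagTree Ω A) (r : MagTree Ω B) (b : B) :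
    (node o (l.rename Sum.inl) (r.rename Sum.inr)).diMark (Sum.inr b) =
      node (.vdash, o) ((l.mapOps (Prod.mk .vdash)).rename Sum.inl)
        ((r.diMark b).rename Sum.inr) := by
  rw [diMark, if_neg (inr_notMem_leaves b l), diMark_rename Sum.inr_injective, mapOps_rename]

theorem mapOps_snd_mapOps {D : Type} (d : D) (t : MagTree Ω A) :
    (t.mapOps (Prod.mk d)).mapOps Prod.snd = t := by
  induction t with
  | leaf b => rfl
  | node o l r ihl ihr => rw [mapOps, mapOps, ihl, ihr]

theorem mapOps_snd_diMark (a : A) (t : MagTree Ω A) : (t.diMark a).mapOps Prod.snd = t := by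
  induction t with
  | leaf b => rfl
  | node o l r ihl ihr =>
    rw [diMark]
    split_ifs
    · rw [mapOps, ihl, mapOps_snd_mapOps]
    · rw [mapOps, ihr, mapOps_snd_mapOps]

end MagTree

/-- The map `MagTree.diMark` on multilinear monomials. -/
noncomputable def MTree.diMark {Ω : Type v} {A : Type} (a : A) (t : MTree Ω A) :
    MTree (DiSym × Ω) A :=
  ⟨t.1.diMark a, t.2.of_leaves_eq (t.1.leaves_diMark a)⟩

/-- The marking of the operations of a monomial with one emphasized variable. -/
noncomputable def diMarking (Ω : Type v) : Marking permOperad DiSym Ω where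
  hd := diSymEquiv
  vd := .vdash
  dd := .dashv
  dot a t := t.diMark a
  binary_vd _ _ _ := rfl
  binary_dd _ _ _ := rfl
  eq_one _ := rfl
  exists_binary {A B} := by
    rintro ⟨a⟩ ⟨b⟩ (a' | b')
    exacts [⟨.dashv, a', b, rfl⟩, ⟨.vdash, a, b', rfl⟩]
  exists_comp {A B} := by
    rintro ⟨b⟩ (a' | b')
    exacts [⟨some a', b, rfl⟩, ⟨none, b', rfl⟩]
  dot_unit := rfl
  dot_rename σ a t := Subtype.ext (MagTree.diMark_rename σ.injective a t.1)
  dot_node {A B} d o a b l r := by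
    cases d with
    | dashv =>
      exact ⟨l.diMark a, r.mapOps (Prod.mk .dashv), Subtype.ext (MagTree.mapOps_snd_diMark a l.1),
        Subtype.ext (MagTree.mapOps_snd_mapOps _ r.1),
        Subtype.ext (MagTree.diMark_node_inl o r.1 (l.2.2 a)), Or.inr rfl, Or.inl rfl⟩
    | vdash =>
      exact ⟨l.mapOps (Prod.mk .vdash), r.diMark b, Subtype.ext (MagTree.mapOps_snd_mapOps _ l.1),
        Subtype.ext (MagTree.mapOps_snd_diMark b r.1),
        Subtype.ext (MagTree.diMark_node_inr o l.1 r.1 b), Or.inl rfl, Or.inr rfl⟩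

section Di

variable {k : Type u} [Field k] {Ω : Type v}

theorem dotHom_diMarking {A : Type} [Finite A] (a : A) (f : (freeOperad k Ω).obj A) :
    (diMarking Ω).dotHom (A := A) a f = diDot a f := by
  refine LinearMap.congr_fun (f := (diMarking Ω).dotHom (A := A) a) (g := diDot a)
    (freeOperad_ext fun t => ?_) f
  rw [Marking.dotHom_mono]
  exact (Finsupp.mapDomain_single).symm

theorem nonempty_diVar_iso (S : Identities k Ω) :
    Nonempty (Iso (operadOf (diVar S)) (operadOf ((diMarking Ω).var S))) := by
  refine nonempty_iso_of_subset (fun n f hf => ?_) fun n f hf => ?_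
  · cases (show DiIdentity S n f from hf) with
    | zero_left i j => exact Marking.Identity.zero_left (M := diMarking Ω) .dashv i j
    | zero_right i j => exact Marking.Identity.zero_right (M := diMarking Ω) .vdash i j
    | dot n f hfS a =>
      have h := Marking.Identity.dot (M := diMarking Ω) n f hfS a
      rw [dotHom_diMarking a f] at h
      exact h
  · cases (show (diMarking Ω).Identity S n f from hf) with
    | zero_left s i j =>
      cases s with
      | vdash => exact Or.inr (sub_self _)
      | dashv => exact Or.inl (DiIdentity.zero_left i j)
    | zero_right s i j =>
      cases s with
      | vdash => exact Or.inl (DiIdentity.zero_right i j)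
      | dashv => exact Or.inr (sub_self _)
    | dot n f hfS a =>
      have h := DiIdentity.dot n f hfS a
      rw [← dotHom_diMarking a f] at h
      exact Or.inl h

theorem coeff_splitFree_di {A : Type} [Finite A] (a : A) (t : MTree Ω A) :
    permOperad.coeff _ (A := A) a ((permOperad.splitFree k Ω diSymEquiv).app A (mono k t)) =
      listSum k (t.1.diDendTerms a) := by
  classical
  revert ‹Finite A› a
  induction t using MTree.induction with
  | unit =>
    intro _ _
    rw [mono_unit, Hom.app_one]
    exact (permOperad.coeff_tmul_self _ _).trans
      ((List.sum_singleton).trans (monoOf_val (MTree.unit (DiSym × Ω)))).symm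
  | @node A B o l r ihl ihr =>
    intro _ x
    have := l.finite
    have := r.finite
    have hstar : ∀ {E : Type} [Finite E] (t : MTree Ω E), (permOperad.total _).app E
        ((permOperad.splitFree k Ω diSymEquiv).app E (mono k t)) = listSum k t.1.diStar :=
      fun t => permOperad.total_splitFree diSymEquiv (L := [.vdash, .dashv])
        (by simp) (by rintro ⟨⟩ <;> simp) t
    rw [← binary_gen_mono, Hom.app_binary, SetOperad.splitFree, freeLift_gen, ← SetOperad.splitFree,
      permOperad.coeff_binary,
      permOperad.sum_eq_sum_list diSymEquiv (L := [.vdash, .dashv]) (by simp)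
        (by rintro ⟨⟩ <;> simp)]
    simp only [List.map_cons, List.map_nil, List.sum_cons, List.sum_nil, add_zero,
      Equiv.symm_apply_apply]
    rcases x with a | b
    · have hterms : (MTree.node o l r).1.diDendTerms (Sum.inl a) =
          ((l.1.diDendTerms a).map (MagTree.rename Sum.inl)).flatMap fun l' =>
            (r.1.diStar.map (MagTree.rename Sum.inr)).map fun r' =>
              MagTree.node (.dashv, o) l' r' := by
        rw [MagTree.diStar, ← MagTree.starTerms_rename,
          ← MagTree.diDendTerms_rename Sum.inl_injective]
        exact if_pos ((MagTree.mem_leaves_rename_iff Sum.inl_injective a l.1).2 (l.2.2 a))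
      rw [hterms, listSum_flatMap_node, ← ihl, ← hstar,
        SetOperad.sumBinary_eq_zero (d := diSymEquiv .vdash) fun _ _ => Sum.inr_ne_inl,
        SetOperad.sumBinary_eq_left (a := a) (d := diSymEquiv .dashv)
          fun _ _ => Sum.inl_injective.eq_iff, zero_add]
    · have hterms : (MTree.node o l r).1.diDendTerms (Sum.inr b) =
          (l.1.diStar.map (MagTree.rename Sum.inl)).flatMap fun l' =>
            ((r.1.diDendTerms b).map (MagTree.rename Sum.inr)).map fun r' =>
              MagTree.node (.vdash, o) l' r' := by
        rw [MagTree.diStar, ← MagTree.starTerms_rename,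
          ← MagTree.diDendTerms_rename Sum.inr_injective]
        exact if_neg (MagTree.inr_notMem_leaves b l.1)
      rw [hterms, listSum_flatMap_node, ← ihr, ← hstar,
        SetOperad.sumBinary_eq_zero (d := diSymEquiv .dashv) fun _ _ => Sum.inl_ne_inr,
        SetOperad.sumBinary_eq_right (b := b) (d := diSymEquiv .vdash)
          fun _ _ => Sum.inr_injective.eq_iff, add_zero]
  | @rename A B σ t ih =>
    intro _ b
    have := t.finite
    obtain ⟨a, rfl⟩ := σ.surjective b
    rw [← map_mono, Hom.app_map]
    refine (permOperad.coeff_map σ a _).trans ?_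
    rw [ih, map_listSum]
    exact congrArg _ (MagTree.diDendTerms_rename σ.injective a t.1).symm

theorem diDend_eq (S : Identities k Ω) : diDend S = permOperad.dend (diMarking Ω).hd S := by
  have h : ∀ (n : ℕ) (f : (freeOperad k Ω).obj (Fin n)) (a : Fin n), diDendDot a f =
      permOperad.coeff _ (A := Fin n) a ((permOperad.splitFree k Ω diSymEquiv).app (Fin n) f) := by
    intro n f a
    refine LinearMap.congr_fun (f := diDendDot a) (g := permOperad.coeff _ (A := Fin n) a ∘ₗ
      (permOperad.splitFree k Ω diSymEquiv).app (Fin n)) (freeOperad_ext fun t => ?_) f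
    refine Eq.trans ?_ ((monomialSum_eq_listSum _ fun t' ht' => t.2.of_leaves_eq
      (t.1.leaves_of_mem_diDendTerms a t' ht')).trans (coeff_splitFree_di a t).symm)
    exact (Finsupp.linearCombination_single k 1 t).trans (one_smul _ _)
  funext n
  ext g
  exact exists_congr fun f => and_congr_right fun _ => exists_congr fun a =>
    Iff.of_eq (congrArg (g = ·) (h n f a))

end Di

/-! ### Trialgebras -/

/-- The operad `ComTrias` in sets, a nonempty set of inputs of whose operations is emphasized. -/
@[reducible] def comTriasOperad : SetOperad where
  obj A := {H : Set A // H.Nonempty}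
  finite _ _ := inferInstance
  map σ H := ⟨σ.symm ⁻¹' H.1, H.2.preimage σ.symm.surjective⟩
  one := ⟨Set.univ, Set.univ_nonempty⟩
  comp {A B} H K := ⟨{x | Sum.elim (fun a => some a ∈ H.1) (fun b => none ∈ H.1 ∧ b ∈ K.1) x}, by
    obtain ⟨_ | a, ha⟩ := H.2
    · obtain ⟨b, hb⟩ := K.2
      exact ⟨Sum.inr b, ha, hb⟩
    · exact ⟨Sum.inl a, ha⟩⟩
  map_refl _ := rfl
  map_trans _ _ _ := rfl
  map_comp _ _ _ _ := Subtype.ext (Set.ext (by rintro (a | b) <;> exact Iff.rfl))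
  comp_one _ := Subtype.ext (Set.ext (by
    rintro (a | b)
    · exact Iff.rfl
    · exact and_iff_left trivial))
  one_comp _ := Subtype.ext (Set.ext (by
    rintro (a | b)
    · exact a.elim
    · exact and_iff_right trivial))
  comp_assoc _ _ _ := Subtype.ext (Set.ext (by
    rintro (a | b | c)
    · exact Iff.rfl
    · exact Iff.rfl
    · exact and_assoc))
  comp_parallel _ _ _ := Subtype.ext (Set.ext (by rintro ((a | b) | c) <;> exact Iff.rfl))

/-- The emphasized inputs of the operations `⊣`, `⊢` and `⊥`. -/
def triSet : TriSym → Set (Fin 2)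
  | .dashv => {0}
  | .vdash => {1}
  | .perp => Set.univ

theorem triSet_nonempty : ∀ d, (triSet d).Nonempty
  | .dashv => ⟨0, rfl⟩
  | .vdash => ⟨1, rfl⟩
  | .perp => ⟨0, trivial⟩

theorem triSet_bijective : Function.Bijective
    fun d => (⟨triSet d, triSet_nonempty d⟩ : comTriasOperad.obj (Fin 2)) := by
  constructor
  · intro d d' h
    have h0 := congrArg (fun H : {H : Set (Fin 2) // H.Nonempty} => (0 : Fin 2) ∈ H.1) h
    have h1 := congrArg (fun H : {H : Set (Fin 2) // H.Nonempty} => (1 : Fin 2) ∈ H.1) h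
    clear h
    cases d <;> cases d' <;> simp_all [triSet]
  · rintro ⟨H, hH⟩
    by_cases h0 : (0 : Fin 2) ∈ H <;> by_cases h1 : (1 : Fin 2) ∈ H
    · refine ⟨.perp, Subtype.ext (Set.ext fun i => ?_)⟩
      fin_cases i <;> simp [triSet, h0, h1]
    · refine ⟨.dashv, Subtype.ext (Set.ext fun i => ?_)⟩
      fin_cases i <;> simp [triSet, h0, h1]
    · refine ⟨.vdash, Subtype.ext (Set.ext fun i => ?_)⟩
      fin_cases i <;> simp [triSet, h0, h1]
    · obtain ⟨i, hi⟩ := hH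
      fin_cases i
      exacts [absurd hi h0, absurd hi h1]

/-- The emphasized inputs of an operation of trialgebras determine it. -/
noncomputable def triSymEquiv : TriSym ≃ comTriasOperad.obj (Fin 2) :=
  Equiv.ofBijective _ triSet_bijective

theorem binary_triSymEquiv_eq_iff {A B : Type} (d : TriSym) (h : comTriasOperad.obj A)
    (h' : comTriasOperad.obj B) (H : comTriasOperad.obj (A ⊕ B)) :
    comTriasOperad.binary (triSymEquiv d) h h' = H ↔
      (∀ a, Sum.inl a ∈ H.1 ↔ (0 : Fin 2) ∈ triSet d ∧ a ∈ h.1) ∧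
      ∀ b, Sum.inr b ∈ H.1 ↔ (1 : Fin 2) ∈ triSet d ∧ b ∈ h'.1 := by
  constructor
  · rintro rfl
    exact ⟨fun a => Iff.rfl, fun b => Iff.rfl⟩
  · rintro ⟨h1, h2⟩
    refine Subtype.ext (Set.ext ?_)
    rintro (a | b)
    exacts [(h1 a).symm, (h2 b).symm]

namespace MagTree

variable {Ω : Type v} {A B : Type}

theorem exists_mem_leaves_rename_iff (f : A → B) (H : Set B) (t : MagTree Ω A) :
    (∃ b ∈ (t.rename f).leaves, b ∈ H) ↔ ∃ a ∈ t.leaves, a ∈ f ⁻¹' H := by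
  simp [leaves_rename]

theorem IsMultilinear.exists_mem_leaves_iff {t : MagTree Ω A} (ht : t.IsMultilinear) (H : Set A) :
    (∃ a ∈ t.leaves, a ∈ H) ↔ H.Nonempty :=
  exists_congr fun a => and_iff_right (ht.2 a)

open Classical in
theorem triMark_rename (f : A → B) (H : Set B) (t : MagTree Ω A) :
    (t.rename f).triMark H = (t.triMark (f ⁻¹' H)).rename f := by
  induction t with
  | leaf b => rfl
  | node o l r ihl ihr =>
    have h : ((node o l r).rename f).triMark H =
        if ∃ b ∈ (l.rename f).leaves, b ∈ H then
          if ∃ b ∈ (r.rename f).leaves, b ∈ H then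
            node (.perp, o) ((l.rename f).triMark H) ((r.rename f).triMark H)
          else node (.dashv, o) ((l.rename f).triMark H) ((r.rename f).mapOps (Prod.mk .dashv))
        else node (.vdash, o) ((l.rename f).mapOps (Prod.mk .vdash)) ((r.rename f).triMark H) := rfl
    rw [h, triMark, mapOps_rename, mapOps_rename, ihl, ihr]
    simp only [exists_mem_leaves_rename_iff]
    split_ifs <;> rfl

open Classical in
theorem triDendTerms_rename (f : A → B) (H : Set B) (t : MagTree Ω A) :
    (t.rename f).triDendTerms H = (t.triDendTerms (f ⁻¹' H)).map (rename f) := by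
  induction t with
  | leaf b => rfl
  | node o l r ihl ihr =>
    have h : ((node o l r).rename f).triDendTerms H =
        if ∃ b ∈ (l.rename f).leaves, b ∈ H then
          if ∃ b ∈ (r.rename f).leaves, b ∈ H then
            ((l.rename f).triDendTerms H).flatMap fun l' =>
              ((r.rename f).triDendTerms H).map fun r' => node (.perp, o) l' r'
          else ((l.rename f).triDendTerms H).flatMap fun l' =>
            (r.rename f).triStar.map fun r' => node (.dashv, o) l' r'
        else (l.rename f).triStar.flatMap fun l' =>
          ((r.rename f).triDendTerms H).map fun r' => node (.vdash, o) l' r' := rfl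
    rw [h, triDendTerms, triStar, triStar, starTerms_rename, starTerms_rename, ihl, ihr]
    simp only [exists_mem_leaves_rename_iff]
    split_ifs <;> simp only [List.map_flatMap, List.flatMap_map, List.map_map] <;> rfl

theorem mapOps_snd_triMark (H : Set A) (t : MagTree Ω A) :
    (t.triMark H).mapOps Prod.snd = t := by
  induction t with
  | leaf b => rfl
  | node o l r ihl ihr =>
    rw [triMark]
    split_ifs
    · rw [mapOps, ihl, ihr]
    · rw [mapOps, ihl, mapOps_snd_mapOps]
    · rw [mapOps, ihr, mapOps_snd_mapOps]

end MagTree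

namespace MTree

variable {Ω : Type v} {A B : Type}

/-- The map `MagTree.triMark` on multilinear monomials. -/
noncomputable def triMark (H : Set A) (t : MTree Ω A) : MTree (TriSym × Ω) A :=
  ⟨t.1.triMark H, t.2.of_leaves_eq (t.1.leaves_triMark H)⟩

open Classical in
theorem triMark_node (o : Ω) (l : MTree Ω A) (r : MTree Ω B) (H : Set (A ⊕ B)) :
    (node o l r).triMark H =
      if (Sum.inl ⁻¹' H).Nonempty then
        if (Sum.inr ⁻¹' H).Nonempty then
          node (.perp, o) (l.triMark (Sum.inl ⁻¹' H)) (r.triMark (Sum.inr ⁻¹' H))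
        else node (.dashv, o) (l.triMark (Sum.inl ⁻¹' H)) (r.mapOps (Prod.mk .dashv))
      else node (.vdash, o) (l.mapOps (Prod.mk .vdash)) (r.triMark (Sum.inr ⁻¹' H)) := by
  apply Subtype.ext
  have h : ((node o l r).triMark H).1 =
      if ∃ x ∈ (l.1.rename Sum.inl).leaves, x ∈ H then
        if ∃ x ∈ (r.1.rename Sum.inr).leaves, x ∈ H then
          .node (.perp, o) ((l.1.rename Sum.inl).triMark H) ((r.1.rename Sum.inr).triMark H)
        else .node (.dashv, o) ((l.1.rename Sum.inl).triMark H)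
          ((r.1.rename Sum.inr).mapOps (Prod.mk .dashv))
      else .node (.vdash, o) ((l.1.rename Sum.inl).mapOps (Prod.mk .vdash))
        ((r.1.rename Sum.inr).triMark H) := rfl
  rw [h]
  simp only [MagTree.exists_mem_leaves_rename_iff, l.2.exists_mem_leaves_iff,
    r.2.exists_mem_leaves_iff, MagTree.triMark_rename, MagTree.mapOps_rename]
  split_ifs <;> rfl

open Classical in
theorem triDendTerms_node (o : Ω) (l : MTree Ω A) (r : MTree Ω B) (H : Set (A ⊕ B)) :
    (node o l r).1.triDendTerms H =
      if (Sum.inl ⁻¹' H).Nonempty then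
        if (Sum.inr ⁻¹' H).Nonempty then
          ((l.1.triDendTerms (Sum.inl ⁻¹' H)).map (MagTree.rename Sum.inl)).flatMap fun l' =>
            ((r.1.triDendTerms (Sum.inr ⁻¹' H)).map (MagTree.rename Sum.inr)).map fun r' =>
              MagTree.node (.perp, o) l' r'
        else ((l.1.triDendTerms (Sum.inl ⁻¹' H)).map (MagTree.rename Sum.inl)).flatMap fun l' =>
          (r.1.triStar.map (MagTree.rename Sum.inr)).map fun r' => MagTree.node (.dashv, o) l' r'
      else (l.1.triStar.map (MagTree.rename Sum.inl)).flatMap fun l' =>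
        ((r.1.triDendTerms (Sum.inr ⁻¹' H)).map (MagTree.rename Sum.inr)).map fun r' =>
          MagTree.node (.vdash, o) l' r' := by
  have h : (node o l r).1.triDendTerms H =
      if ∃ x ∈ (l.1.rename Sum.inl).leaves, x ∈ H then
        if ∃ x ∈ (r.1.rename Sum.inr).leaves, x ∈ H then
          ((l.1.rename Sum.inl).triDendTerms H).flatMap fun l' =>
            ((r.1.rename Sum.inr).triDendTerms H).map fun r' => MagTree.node (.perp, o) l' r'
        else ((l.1.rename Sum.inl).triDendTerms H).flatMap fun l' =>
          (r.1.rename Sum.inr).triStar.map fun r' => MagTree.node (.dashv, o) l' r'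
      else (l.1.rename Sum.inl).triStar.flatMap fun l' =>
        ((r.1.rename Sum.inr).triDendTerms H).map fun r' => MagTree.node (.vdash, o) l' r' := rfl
  rw [h]
  simp only [MagTree.exists_mem_leaves_rename_iff, l.2.exists_mem_leaves_iff,
    r.2.exists_mem_leaves_iff, MagTree.triDendTerms_rename, MagTree.triStar,
    MagTree.starTerms_rename]

end MTree

/-- The marking of the operations of a monomial with a nonempty set of emphasized variables. -/
noncomputable def triMarking (Ω : Type v) : Marking comTriasOperad TriSym Ω where
  hd := triSymEquiv
  vd := .vdash
  dd := .dashv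
  dot H t := t.triMark H.1
  binary_vd {A B} a a' b :=
    have h0 : (0 : Fin 2) ∉ triSet .vdash := by simp [triSet]
    (binary_triSymEquiv_eq_iff _ _ _ _).2
      ⟨fun x => iff_of_false (fun h => h0 h.1) fun h => h0 h.1, fun x => Iff.rfl⟩
  binary_dd {A B} a b b' :=
    have h1 : (1 : Fin 2) ∉ triSet .dashv := by simp [triSet]
    (binary_triSymEquiv_eq_iff _ _ _ _).2
      ⟨fun x => Iff.rfl, fun x => iff_of_false (fun h => h1 h.1) fun h => h1 h.1⟩
  eq_one H := Subtype.ext (H.2.eq_univ)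
  exists_binary {A B} _ _ H := by
    by_cases h1 : (Sum.inl ⁻¹' H.1 : Set A).Nonempty
    · by_cases h2 : (Sum.inr ⁻¹' H.1 : Set B).Nonempty
      · refine ⟨.perp, ⟨_, h1⟩, ⟨_, h2⟩, ((binary_triSymEquiv_eq_iff _ _ _ _).2 ?_).symm⟩
        simp [triSet]
      · refine ⟨.dashv, ⟨_, h1⟩, ⟨Set.univ, Set.univ_nonempty⟩,
          ((binary_triSymEquiv_eq_iff _ _ _ _).2 ?_).symm⟩
        rw [Set.not_nonempty_iff_eq_empty, Set.eq_empty_iff_forall_notMem] at h2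
        simpa [triSet] using h2
    · have h2 : (Sum.inr ⁻¹' H.1 : Set B).Nonempty := by
        obtain ⟨a | b, hx⟩ := H.2
        exacts [(h1 ⟨a, hx⟩).elim, ⟨b, hx⟩]
      refine ⟨.vdash, ⟨Set.univ, Set.univ_nonempty⟩, ⟨_, h2⟩,
          ((binary_triSymEquiv_eq_iff _ _ _ _).2 ?_).symm⟩
      rw [Set.not_nonempty_iff_eq_empty, Set.eq_empty_iff_forall_notMem] at h1
      simpa [triSet] using h1
  exists_comp {A B} _ H := by
    by_cases h2 : (Sum.inr ⁻¹' H.1 : Set B).Nonempty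
    · refine ⟨⟨{x | ∀ a, x = some a → Sum.inl a ∈ H.1}, none, by simp⟩, ⟨_, h2⟩,
        Subtype.ext (Set.ext ?_)⟩
      rintro (a | b) <;> simp
    · obtain ⟨a | b, hx⟩ := H.2
      · refine ⟨⟨some '' (Sum.inl ⁻¹' H.1), some a, a, hx, rfl⟩, ⟨Set.univ, Set.univ_nonempty⟩,
          Subtype.ext (Set.ext ?_)⟩
        rw [Set.not_nonempty_iff_eq_empty, Set.eq_empty_iff_forall_notMem] at h2
        rintro (a | b)
        · simp
        · simpa using h2 b
      · exact (h2 ⟨b, hx⟩).elim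
  dot_unit := rfl
  dot_rename σ H t := Subtype.ext ((MagTree.triMark_rename σ _ t.1).trans (by
    rw [← Set.preimage_comp, Equiv.symm_comp_self]
    rfl))
  dot_node {A B} d o a b l r := by
    have ha : a.1.Nonempty := a.2
    have hb : b.1.Nonempty := b.2
    have hn : ∀ (X : Type) (s : Set X), ¬({x | False ∧ x ∈ s} : Set X).Nonempty := by simp
    have hl : (Sum.inl ⁻¹' (comTriasOperad.binary (triSymEquiv d) a b).1 : Set A) =
      {x | (0 : Fin 2) ∈ triSet d ∧ x ∈ a.1} := rfl
    have hr : (Sum.inr ⁻¹' (comTriasOperad.binary (triSymEquiv d) a b).1 : Set B) =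
      {x | (1 : Fin 2) ∈ triSet d ∧ x ∈ b.1} := rfl
    have hlr := MTree.triMark_node o l r (comTriasOperad.binary (triSymEquiv d) a b).1
    rw [hl, hr] at hlr
    cases d with
    | dashv =>
      refine ⟨l.triMark a.1, r.mapOps (Prod.mk .dashv),
        Subtype.ext (MagTree.mapOps_snd_triMark _ l.1),
        Subtype.ext (MagTree.mapOps_snd_mapOps _ r.1), hlr.trans ?_, Or.inr rfl, Or.inl rfl⟩
      simp [triSet, ha]
    | vdash =>
      refine ⟨l.mapOps (Prod.mk .vdash), r.triMark b.1,
        Subtype.ext (MagTree.mapOps_snd_mapOps _ l.1),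
        Subtype.ext (MagTree.mapOps_snd_triMark _ r.1), hlr.trans ?_, Or.inl rfl, Or.inr rfl⟩
      simp [triSet]
    | perp =>
      refine ⟨l.triMark a.1, r.triMark b.1, Subtype.ext (MagTree.mapOps_snd_triMark _ l.1),
        Subtype.ext (MagTree.mapOps_snd_triMark _ r.1), hlr.trans ?_, Or.inr rfl, Or.inr rfl⟩
      simp [triSet, ha, hb]

section Tri

variable {k : Type u} [Field k] {Ω : Type v}

theorem dotHom_triMarking {A : Type} [Finite A] (H : comTriasOperad.obj A)
    (f : (freeOperad k Ω).obj A) : (triMarking Ω).dotHom H f = triDot H.1 f := by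
  refine LinearMap.congr_fun (f := (triMarking Ω).dotHom H) (g := triDot H.1)
    (freeOperad_ext fun t => ?_) f
  rw [Marking.dotHom_mono]
  exact (Finsupp.mapDomain_single).symm

theorem nonempty_triVar_iso (S : Identities k Ω) :
    Nonempty (Iso (operadOf (triVar S)) (operadOf ((triMarking Ω).var S))) := by
  refine nonempty_iso_of_subset (fun n f hf => ?_) fun n f hf => Or.inl ?_
  · cases (show TriIdentity S n f from hf) with
    | zero_left s i j => exact Marking.Identity.zero_left (M := triMarking Ω) s i j
    | zero_right s i j => exact Marking.Identity.zero_right (M := triMarking Ω) s i j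
    | dot n f hfS H hH =>
      have h := Marking.Identity.dot (M := triMarking Ω) n f hfS ⟨H, hH⟩
      rw [dotHom_triMarking ⟨H, hH⟩ f] at h
      exact h
  · cases (show (triMarking Ω).Identity S n f from hf) with
    | zero_left s i j => exact TriIdentity.zero_left s i j
    | zero_right s i j => exact TriIdentity.zero_right s i j
    | dot n f hfS H =>
      have h := TriIdentity.dot n f hfS H.1 H.2
      rw [← dotHom_triMarking H f] at h
      exact h

theorem coeff_splitFree_tri {A : Type} [Finite A] (H : comTriasOperad.obj A) (t : MTree Ω A) :
    comTriasOperad.coeff _ H ((comTriasOperad.splitFree k Ω triSymEquiv).app A (mono k t)) =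
      listSum k (t.1.triDendTerms H.1) := by
  classical
  revert ‹Finite A› H
  induction t using MTree.induction with
  | unit =>
    intro _ H
    rw [(triMarking Ω).eq_one H, mono_unit, Hom.app_one]
    exact (comTriasOperad.coeff_tmul_self _ _).trans
      ((List.sum_singleton).trans (monoOf_val (MTree.unit (TriSym × Ω)))).symm
  | @node A B o l r ihl ihr =>
    intro _ H
    have := l.finite
    have := r.finite
    have hL : [TriSym.vdash, .dashv, .perp].Nodup := by simp
    have hL' : ∀ d, d ∈ [TriSym.vdash, .dashv, .perp] := by rintro ⟨⟩ <;> simp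
    have hstar : ∀ {E : Type} [Finite E] (t : MTree Ω E), (comTriasOperad.total _).app E
        ((comTriasOperad.splitFree k Ω triSymEquiv).app E (mono k t)) = listSum k t.1.triStar :=
      fun t => comTriasOperad.total_splitFree triSymEquiv hL hL' t
    rw [← binary_gen_mono, Hom.app_binary, SetOperad.splitFree, freeLift_gen, ← SetOperad.splitFree,
      comTriasOperad.coeff_binary, comTriasOperad.sum_eq_sum_list triSymEquiv hL hL',
      MTree.triDendTerms_node]
    simp only [List.map_cons, List.map_nil, List.sum_cons, List.sum_nil, add_zero,
      Equiv.symm_apply_apply]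
    have hA : ∀ (h1 : (Sum.inl ⁻¹' H.1 : Set A).Nonempty) (h : comTriasOperad.obj A),
        (∀ a, Sum.inl a ∈ H.1 ↔ a ∈ h.1) ↔ h = ⟨_, h1⟩ := fun h1 h =>
      ⟨fun hh => Subtype.ext (Set.ext fun a => (hh a).symm), by rintro rfl a; rfl⟩
    have hB : ∀ (h2 : (Sum.inr ⁻¹' H.1 : Set B).Nonempty) (h : comTriasOperad.obj B),
        (∀ b, Sum.inr b ∈ H.1 ↔ b ∈ h.1) ↔ h = ⟨_, h2⟩ := fun h2 h =>
      ⟨fun hh => Subtype.ext (Set.ext fun a => (hh a).symm), by rintro rfl a; rfl⟩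
    have hA' : (Sum.inl ⁻¹' H.1 : Set A).Nonempty ↔ ¬∀ a, Sum.inl a ∉ H.1 := by
      rw [not_forall_not]
      rfl
    have hB' : (Sum.inr ⁻¹' H.1 : Set B).Nonempty ↔ ¬∀ b, Sum.inr b ∉ H.1 := by
      rw [not_forall_not]
      rfl
    have hv : ∀ h h', comTriasOperad.binary (triSymEquiv .vdash) h h' = H ↔
        (∀ a, Sum.inl a ∉ H.1) ∧ ∀ b, Sum.inr b ∈ H.1 ↔ b ∈ h'.1 := fun h h' => by
      rw [binary_triSymEquiv_eq_iff]
      simp [triSet]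
    have hd : ∀ h h', comTriasOperad.binary (triSymEquiv .dashv) h h' = H ↔
        (∀ a, Sum.inl a ∈ H.1 ↔ a ∈ h.1) ∧ ∀ b, Sum.inr b ∉ H.1 := fun h h' => by
      rw [binary_triSymEquiv_eq_iff]
      simp [triSet]
    have hp : ∀ h h', comTriasOperad.binary (triSymEquiv .perp) h h' = H ↔
        (∀ a, Sum.inl a ∈ H.1 ↔ a ∈ h.1) ∧ ∀ b, Sum.inr b ∈ H.1 ↔ b ∈ h'.1 := fun h h' => by
      rw [binary_triSymEquiv_eq_iff]
      simp [triSet]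
    by_cases h1 : (Sum.inl ⁻¹' H.1 : Set A).Nonempty
    · rw [SetOperad.sumBinary_eq_zero (d := triSymEquiv .vdash)
        fun h h' hh => hA'.1 h1 ((hv h h').1 hh).1, if_pos h1, zero_add]
      by_cases h2 : (Sum.inr ⁻¹' H.1 : Set B).Nonempty
      · rw [SetOperad.sumBinary_eq_zero (d := triSymEquiv .dashv)
            fun h h' hh => hB'.1 h2 ((hd h h').1 hh).2,
          SetOperad.sumBinary_eq (d := triSymEquiv .perp) (a := ⟨_, h1⟩) (b := ⟨_, h2⟩)
            fun h h' => (hp h h').trans (and_congr (hA h1 h) (hB h2 h')),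
          if_pos h2, listSum_flatMap_node, ihl, ihr, zero_add]
      · rw [SetOperad.sumBinary_eq_zero (d := triSymEquiv .perp)
            fun h h' hh => h2 ⟨_, (((hp h h').1 hh).2 _).2 h'.2.some_mem⟩,
          SetOperad.sumBinary_eq_left (d := triSymEquiv .dashv) (a := ⟨_, h1⟩)
            fun h h' => (hd h h').trans ((and_iff_left (not_not.1 (mt hB'.2 h2))).trans (hA h1 h)),
          if_neg h2, listSum_flatMap_node, ihl, hstar, add_zero]
    · have h2 : (Sum.inr ⁻¹' H.1 : Set B).Nonempty := by
        obtain ⟨a | b, hx⟩ := H.2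
        exacts [(h1 ⟨a, hx⟩).elim, ⟨b, hx⟩]
      rw [SetOperad.sumBinary_eq_zero (d := triSymEquiv .perp)
          fun h h' hh => h1 ⟨_, (((hp h h').1 hh).1 _).2 h.2.some_mem⟩,
        SetOperad.sumBinary_eq_zero (d := triSymEquiv .dashv)
          fun h h' hh => h1 ⟨_, (((hd h h').1 hh).1 _).2 h.2.some_mem⟩,
        SetOperad.sumBinary_eq_right (d := triSymEquiv .vdash) (b := ⟨_, h2⟩)
          fun h h' => (hv h h').trans ((and_iff_right (not_not.1 (mt hA'.2 h1))).trans (hB h2 h')),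
        if_neg h1, listSum_flatMap_node, ihr, hstar, add_zero, add_zero]
  | @rename A B σ t ih =>
    intro _ H
    have := t.finite
    rw [← comTriasOperad.map_map_symm σ H]
    generalize comTriasOperad.map σ.symm H = H
    rw [← map_mono, Hom.app_map, comTriasOperad.coeff_map, ih, map_listSum]
    refine congrArg _ (Eq.symm ((MagTree.triDendTerms_rename σ _ t.1).trans ?_))
    rw [← Set.preimage_comp, Equiv.symm_comp_self]
    rfl

theorem triDend_eq (S : Identities k Ω) : triDend S = comTriasOperad.dend (triMarking Ω).hd S := by
  have h : ∀ (n : ℕ) (f : (freeOperad k Ω).obj (Fin n)) (H : comTriasOperad.obj (Fin n)),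
      triDendDot H.1 f = comTriasOperad.coeff _ H
        ((comTriasOperad.splitFree k Ω triSymEquiv).app (Fin n) f) := by
    intro n f H
    refine LinearMap.congr_fun (f := triDendDot H.1) (g := comTriasOperad.coeff _ H ∘ₗ
      (comTriasOperad.splitFree k Ω triSymEquiv).app (Fin n)) (freeOperad_ext fun t => ?_) f
    refine Eq.trans ?_ ((monomialSum_eq_listSum _ fun t' ht' => t.2.of_leaves_eq
      (t.1.leaves_of_mem_triDendTerms H.1 t' ht')).trans (coeff_splitFree_tri H t).symm)
    exact (Finsupp.linearCombination_single k 1 t).trans (one_smul _ _)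
  funext n
  ext g
  refine exists_congr fun f => and_congr_right fun _ => ⟨?_, ?_⟩
  · rintro ⟨H, hH, hg⟩
    exact ⟨⟨H, hH⟩, hg.trans (h n f ⟨H, hH⟩)⟩
  · rintro ⟨H, hg⟩
    exact ⟨H.1, H.2, hg.trans (h n f H).symm⟩

end Tri

end KDual

theorem mainTheorem6 {k : Type u} [Field k] {Ω : Type v} [Finite Ω] (S : KDual.Identities k Ω)
    (hone : Module.finrank k ((KDual.operadOf S).obj (Fin 1)) = 1)
    (hquad : (KDual.operadOf S).IsBinaryQuadratic)
    {Ω' : Type w} (S' : KDual.Identities k Ω')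
    (hdual : Nonempty ((KDual.operadOf S').Iso (KDual.operadOf S).koszulDual)) :
    ((KDual.operadOf (KDual.diVar S)).IsBinaryQuadratic ∧
      Nonempty ((KDual.operadOf (KDual.diVar S)).koszulDual.Iso
        (KDual.operadOf (KDual.diDend S')))) ∧
    ((KDual.operadOf (KDual.triVar S)).IsBinaryQuadratic ∧
      Nonempty ((KDual.operadOf (KDual.triVar S)).koszulDual.Iso
        (KDual.operadOf (KDual.triDend S')))) := by
  obtain ⟨e⟩ := hdual
  obtain ⟨ed⟩ := KDual.nonempty_diVar_iso S
  obtain ⟨et⟩ := KDual.nonempty_triVar_iso S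
  rw [KDual.diDend_eq, KDual.triDend_eq]
  exact ⟨(KDual.diMarking Ω).isBinaryQuadratic_and_nonempty_iso KDual.diMarking hquad e ed,
    (KDual.triMarking Ω).isBinaryQuadratic_and_nonempty_iso KDual.triMarking hquad e et⟩
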